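/- Let $f:[0,\infty)\to[0,\infty)$ be a smooth function with $f(r)=\sin^2 r$ for $0\le r\le \frac{7\pi}{8}$, $f(r)=r^2$ for $r\ge\pi$ and $f(r)>0$ for $\frac{7\pi}{8}\le r\le\pi$. Such functions exist. For any such $f$ let $g_0=dr^2+f(r)\,(d\vartheta^2+\sin^2\vartheta\,d\varphi^2)$ in polar coordinates on $\mathbb{R}^3$ (so that $g_0$ is the round metric of $\mathbb{S}^3$ with a ball removed for $r\le\frac{7\pi}{8}$ and is Euclidean for $r\ge\pi$), and let $(\mathcal M,g)=(\mathbb{R}\times\mathbb{R}^3,\,-dt^2+g_0)$, with $T=\partial_t$ and time orientation such that $T$ is future directed. For a smooth $\psi:\mathcal M\to\mathbb{C}$ write $J^T_\mu(\psi)n^\mu=\mathbf{T}(\psi)(T,n)$, where $$\mathbf{T}_{\mu\nu}(\psi)=\tfrac12\big(\partial_\mu\psi\,\partial_\nu\bar\psi+\partial_\mu\bar\psi\,\partial_\nu\psi\big)-\tfrac12\big(\partial^\lambda\psi\,\partial_\lambda\bar\psi\big)g_{\mu\nu}$$ and $n$ is the future directed unit normal of the hypersurfaces $\{t=\mathrm{const}\}$;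 integrals over $\{t=\mathrm{const}\}$ are taken with respect to the volume form of the induced metric. Then the following hold. (A) With stationary field $T$ and hypersurface $\Sigma=\{t=0\}$, the spacetime $(\mathcal M,g)$ satisfies the following assumptions. 1. (Stationarity and asymptotic flatness.) $g$ is a smooth Lorentzian metric; $T$ is a Killing field with complete orbits; $\Sigma$ is a spacelike Cauchy hypersurface. There are a compact $K\subset\mathbb{R}^3$, an $R>0$ and a diffeomorphism from $\{y\in\mathbb{R}^3:|y|>R\}$ onto $\mathbb{R}^3\setminus K$ such that in the resulting coordinates $(t,r,\sigma)$, $\sigma\in\mathbb{S}^2$, $$g=-\Big(1-\frac{2m}{r}+h_1\Big)dt^2+\Big(1+\frac{2m}{r}+h_2\Big)dr^2+r^2\big(g_{\mathbb{S}^2}+h_3\big)+h_4\,dt\,d\sigma$$ for some $m\in\mathbb{R}$, $a\in(0,1]$ and smooth $t$-independent $h_1,h_2,h_3=O_4(r^{-1-a})$, $h_4=O_4(r^{-a})$, where $h_1,h_2$ are functions, $h_3(r,\cdot)$ is a symmetric $2$-tensor on $\mathbb{S}^2$, $h_4\,d\sigma$ denotes a $1$-form on $\mathbb{S}^2$ depending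 on $r$, and $h=O_4(r^b)$ means $r^{j_1}|\partial_r^{j_1}\partial_\sigma^{j_2}h|\le C r^b$ for $j_1+j_2\le4$. With $\mathcal I=\mathbb{R}\times(\mathbb{R}^3\setminus K)$ and $\mathcal D=\overline{J^-(\mathcal I)\cap J^+(\mathcal I)}$, the translates of $\Sigma\cap\mathcal D$ along the flow of $T$ for times $s\ge0$ cover $J^+(\Sigma)\cap\mathcal D$. 2. (No horizon.) $\mathcal D=\mathcal M$, and $\partial\mathcal D$, $J^+(\mathcal I)\cap\partial J^-(\mathcal I)$ and $J^-(\mathcal I)\cap\partial J^+(\mathcal I)$ are empty; in particular every condition on the horizon (non-degeneracy, positive surface gravity) holds trivially. 3. (No ergoregion.) $g(T,T)<0$ on $\mathcal M$. 4. (Boundedness of the energy.) There is a $C>0$ such that $\int_{\{t=t_2\}}J^T_\mu(\psi)n^\mu\le C\int_{\{t=t_1\}}J^T_\mu(\psi)n^\mu$ for all $0\le t_1\le t_2$ and all smooth solutions $\psi$ of $\square_g\psi=0$ on $J^+(\Sigma)\cap\mathcal D$. (B) For every function $h:[0,\infty)\to[0,\infty)$ with $h(t)\,\{\log(2+t)\}^2\to0$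 as $t\to\infty$ there is a $t_0>0$ such that for every $\tau>t_0$ there is a smooth solution $\psi:\mathcal M\to\mathbb{C}$ of $\square_g\psi=0$ (depending on $\tau$), with $\int_{\{t=s\}}J^T_\mu(\psi)n^\mu<\infty$ for all $s$ and with both integrals on the right-hand side below finite, such that $$\int_{\{t=\tau\}\cap\{r\le\frac{3\pi}{4}\}}J^T_\mu(\psi)n^\mu>h(\tau)\Big(\int_{\{t=0\}}(1+r)\,J^T_\mu(\psi)n^\mu+\int_{\{t=0\}}J^T_\mu(T\psi)n^\mu\Big).$$ -/

import Mathlib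

open Set Filter Topology MeasureTheory
open scoped ContDiff ENNReal

namespace LogSharp

/-- Three-dimensional Euclidean space. -/
abbrev E3 : Type := EuclideanSpace ℝ (Fin 3)

/-- The spacetime manifold `ℝ × ℝ³`; the first coordinate is `t`. -/
abbrev M : Type := ℝ × E3

/-- Coordinate indices: `Sum.inl ()` is the time index, `Sum.inr i` are the space indices. -/
abbrev Ix : Type := Unit ⊕ Fin 3

/-- A field of bilinear forms on `M`. -/
abbrev BilinField : Type := M → M →L[ℝ] M →L[ℝ] ℝ

/-- The coordinate vector fields `∂_t, ∂_1, ∂_2, ∂_3`. -/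
noncomputable def e : Ix → M :=
  Sum.elim (fun _ => ((1 : ℝ), (0 : E3))) (fun i => ((0 : ℝ), EuclideanSpace.single i (1 : ℝ)))

/-- The stationary vector field `T = ∂_t`. -/
noncomputable def T : M := e (Sum.inl ())

/-- The hypersurface `{t = τ}`. -/
def slice (τ : ℝ) : Set M := {p | p.1 = τ}

/-! ### Lorentzian geometry of a metric on `ℝ × ℝ³`, in the global coordinates -/

/-- The matrix `(g_{μν})`. -/
noncomputable def gram (g : BilinField) (p : M) : Matrix Ix Ix ℝ :=
  Matrix.of fun μ ν => g p (e μ) (e ν)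

/-- The matrix `(g_{ij})` of the metric induced on the slices of constant `t`. -/
noncomputable def spaceGram (g : BilinField) (p : M) : Matrix (Fin 3) (Fin 3) ℝ :=
  Matrix.of fun i j => g p (e (Sum.inr i)) (e (Sum.inr j))

/-- The inverse metric `g^{μν}`. -/
noncomputable def invGram (g : BilinField) (p : M) : Matrix Ix Ix ℝ := (gram g p)⁻¹

/-- The coordinate derivative `∂_μ`. -/
noncomputable def pd {F : Type*} [NormedAddCommGroup F] [NormedSpace ℝ F]
    (μ : Ix) (u : M → F) (p : M) : F := fderiv ℝ u p (e μ)

/-- The density `√|det g|`. -/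
noncomputable def volDensity (g : BilinField) (p : M) : ℝ := Real.sqrt |(gram g p).det|

/-- The wave operator `□_g ψ = |det g|^{-1/2} ∂_μ (|det g|^{1/2} g^{μν} ∂_ν ψ)`. -/
noncomputable def box (g : BilinField) (ψ : M → ℂ) (p : M) : ℂ :=
  (volDensity g p)⁻¹ •
    ∑ μ, ∑ ν, pd μ (fun q => (volDensity g q * invGram g q μ ν) • pd ν ψ q) p

/-- The derivative `Tψ = ∂_t ψ`. -/
noncomputable def Tder (ψ : M → ℂ) (p : M) : ℂ := fderiv ℝ ψ p T

/-- The energy momentum tensor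
`½ (Xψ Yψ̄ + Xψ̄ Yψ) - ½ (g^{αβ} ∂_α ψ ∂_β ψ̄) g(X, Y)` of `ψ`. -/
noncomputable def stress (g : BilinField) (ψ : M → ℂ) (p : M) (X Y : M) : ℝ :=
  (fderiv ℝ ψ p X * (starRingEnd ℂ) (fderiv ℝ ψ p Y)).re
    - 1 / 2 * (∑ α, ∑ β, invGram g p α β * (pd α ψ p * (starRingEnd ℂ) (pd β ψ p)).re) * g p X Y

/-- The future directed unit normal `n^μ = - g^{μ0} / √(-g^{00})` of the slices of constant `t`. -/
noncomputable def normal (g : BilinField) (p : M) : M :=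
  -((Real.sqrt (-(invGram g p (Sum.inl ()) (Sum.inl ()))))⁻¹ •
    ∑ μ, invGram g p μ (Sum.inl ()) • e μ)

/-- `J^T_μ(ψ) n^μ`, times the density of the volume form induced on the slice through `p`. -/
noncomputable def energyDensity (g : BilinField) (ψ : M → ℂ) (p : M) : ℝ :=
  stress g ψ p T (normal g p) * Real.sqrt (spaceGram g p).det

/-- The weighted energy `∫_{{t = τ} ∩ {x ∈ S}} w · J^T_μ(ψ) n^μ`, with values in `[0, ∞]`. -/
noncomputable def energyOn (g : BilinField) (ψ : M → ℂ) (τ : ℝ) (S : Set E3) (w : E3 → ℝ) :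
    ℝ≥0∞ :=
  ∫⁻ x in S, ENNReal.ofReal (w x * energyDensity g ψ (τ, x))

/-- The energy `∫_{{t = τ}} J^T_μ(ψ) n^μ`, with values in `[0, ∞]`. -/
noncomputable def energy (g : BilinField) (ψ : M → ℂ) (τ : ℝ) : ℝ≥0∞ :=
  energyOn g ψ τ univ (fun _ => 1)

/-- `g` is a smooth symmetric form of signature `(-, +, +, +)`. -/
structure IsLorentzMetric (g : BilinField) : Prop where
  smooth : ContDiff ℝ ∞ g
  symm : ∀ p v w, g p v w = g p w v
  signature : ∀ p, ∃ b : Module.Basis Ix ℝ M, ∀ μ ν,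
    g p (b μ) (b ν) = if μ = ν then Sum.elim (fun _ => -1) (fun _ => 1) μ else 0

/-- `X` is a Killing field of `g`: the Lie derivative `ℒ_X g` vanishes. -/
def IsKilling (g : BilinField) (X : M → M) : Prop :=
  ∀ p v w, fderiv ℝ g p (X p) v w + g p (fderiv ℝ X p v) w + g p v (fderiv ℝ X p w) = 0

/-- All integral curves of `X` exist for all times. -/
def IsCompleteField (X : M → M) : Prop :=
  ∀ p, ∃ γ : ℝ → M, γ 0 = p ∧ ∀ s, HasDerivAt γ (X (γ s)) s

/-! ### Causality; the time orientation is the one for which `T` is future directed -/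

/-- `v` is a future directed timelike vector at `p`. -/
def FutureTimelike (g : BilinField) (p v : M) : Prop := g p v v < 0 ∧ g p T v < 0

/-- `v` is a (nonzero) future directed causal vector at `p`. -/
def FutureCausal (g : BilinField) (p v : M) : Prop := v ≠ 0 ∧ g p v v ≤ 0 ∧ g p T v < 0

/-- There is a future directed `C¹` causal curve from `p` to `q`. -/
def CausalSegment (g : BilinField) (p q : M) : Prop :=
  ∃ γ : ℝ → M, ContDiffOn ℝ 1 γ (Icc 0 1) ∧ γ 0 = p ∧ γ 1 = q ∧
    ∀ s ∈ Icc (0 : ℝ) 1, FutureCausal g (γ s) (derivWithin γ (Icc 0 1) s)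

/-- The causal future `J⁺(A)`, by piecewise `C¹` future directed causal curves. -/
def Jplus (g : BilinField) (A : Set M) : Set M :=
  {q | ∃ p ∈ A, Relation.ReflTransGen (CausalSegment g) p q}

/-- The causal past `J⁻(A)`. -/
def Jminus (g : BilinField) (A : Set M) : Set M :=
  {p | ∃ q ∈ A, Relation.ReflTransGen (CausalSegment g) p q}

/-- `S` is a Cauchy hypersurface: every inextendible timelike curve meets it exactly once. -/
def IsCauchy (g : BilinField) (S : Set M) : Prop :=
  ∀ γ : ℝ → M, ContDiff ℝ 1 γ → (∀ s, FutureTimelike g (γ s) (deriv γ s)) →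
    (¬ ∃ q, Tendsto γ atTop (𝓝 q)) → (¬ ∃ q, Tendsto γ atBot (𝓝 q)) →
    ∃! s, γ s ∈ S

/-- The asymptotically flat region: the union of all translates along `T` of the end `S ⊆ ℝ³`. -/
def asympRegion (S : Set E3) : Set M := {p | p.2 ∈ S}

/-- The domain of outer communications `clos (J⁻(I) ∩ J⁺(I))` of the end `S`. -/
def outerDomain (g : BilinField) (S : Set E3) : Set M :=
  closure (Jminus g (asympRegion S) ∩ Jplus g (asympRegion S))

/-- The horizon `∂D`. -/
def horizon (g : BilinField) (S : Set E3) : Set M := frontier (outerDomain g S)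

/-- The future horizon `J⁺(I) ∩ ∂J⁻(I)`. -/
def futureHorizon (g : BilinField) (S : Set E3) : Set M :=
  Jplus g (asympRegion S) ∩ frontier (Jminus g (asympRegion S))

/-- The past horizon `J⁻(I) ∩ ∂J⁺(I)`. -/
def pastHorizon (g : BilinField) (S : Set E3) : Set M :=
  Jminus g (asympRegion S) ∩ frontier (Jplus g (asympRegion S))

/-! ### Asymptotic flatness -/

/-- `h = O_k(r^b)` on `{r > R}`. A derivative of order `j` in Cartesian coordinates is a
combination of the `r^{-j₂} ∂_r^{j₁} ∂_σ^{j₂}`, `j₁ + j₂ ≤ j`, with weights homogeneous in `r`, so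
that these bounds are the bounds `r^{j₁} |∂_r^{j₁} ∂_σ^{j₂} h| ≤ C r^b` for `j₁ + j₂ ≤ k`. -/
def BigO {F : Type*} [NormedAddCommGroup F] [NormedSpace ℝ F]
    (k : ℕ) (b R : ℝ) (h : E3 → F) : Prop :=
  ∃ C : ℝ, ∀ j ≤ k, ∀ y : E3, R < ‖y‖ → ‖y‖ ^ j * ‖iteratedFDeriv ℝ j h y‖ ≤ C * ‖y‖ ^ b

/-- `dr(v)` at `y ≠ 0`. -/
noncomputable def dr (y v : E3) : ℝ := inner ℝ (‖y‖⁻¹ • y) v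

/-- `dσ(v)` at `y ≠ 0`: the differential of the projection `σ(y) = y / |y|` to the unit sphere. -/
noncomputable def dsph (y v : E3) : E3 := ‖y‖⁻¹ • (v - dr y v • (‖y‖⁻¹ • y))

/-- `Φ` is a chart `ℝ³ \ B_R → ℝ³ \ K`, `K` compact, in which, together with `t`, the metric is
`-(1 - 2m/r + h₁) dt² + (1 + 2m/r + h₂) dr² + r² (g_{S²} + h₃) + h₄ dt dσ`
with `h₁, h₂, h₃ = O₄(r^{-1-a})` and `h₄ = O₄(r^{-a})`; here `h₃(y)` and `h₄(y)` are evaluated on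
vectors tangent to the unit sphere at `y / |y|` only. -/
structure IsAsympFlatEnd (g : BilinField) (R : ℝ) (Φ : OpenPartialHomeomorph E3 E3) : Prop where
  R_pos : 0 < R
  source_eq : Φ.source = {y | R < ‖y‖}
  compact_compl : IsCompact (Φ.target)ᶜ
  smooth : ContDiffOn ℝ ∞ Φ Φ.source
  smooth_symm : ContDiffOn ℝ ∞ Φ.symm Φ.target
  metric_form : ∃ (m a : ℝ) (h₁ h₂ : E3 → ℝ) (h₃ : E3 → E3 →L[ℝ] E3 →L[ℝ] ℝ)
      (h₄ : E3 → E3 →L[ℝ] ℝ),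
    0 < a ∧ a ≤ 1 ∧
    ContDiffOn ℝ ∞ h₁ {y | R < ‖y‖} ∧ ContDiffOn ℝ ∞ h₂ {y | R < ‖y‖} ∧
    ContDiffOn ℝ ∞ h₃ {y | R < ‖y‖} ∧ ContDiffOn ℝ ∞ h₄ {y | R < ‖y‖} ∧
    BigO 4 (-1 - a) R h₁ ∧ BigO 4 (-1 - a) R h₂ ∧ BigO 4 (-1 - a) R h₃ ∧ BigO 4 (-a) R h₄ ∧
    ∀ (t : ℝ) (y : E3), R < ‖y‖ → ∀ (s s' : ℝ) (v v' : E3),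
      g (t, Φ y) (s, fderiv ℝ Φ y v) (s', fderiv ℝ Φ y v') =
        -(1 - 2 * m / ‖y‖ + h₁ y) * (s * s')
        + (1 + 2 * m / ‖y‖ + h₂ y) * (dr y v * dr y v')
        + ‖y‖ ^ 2 * (inner ℝ (dsph y v) (dsph y v') + h₃ y (dsph y v) (dsph y v'))
        + (s * h₄ y (dsph y v') + s' * h₄ y (dsph y v))

/-- The stationary spacetime `(ℝ × ℝ³, g)`, with stationary field `T = ∂_t`, hypersurface
`Σ = {t = 0}` and redshift field `N = T`, satisfies Assumptions 1 to 4 and has no event horizon.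
* Assumption 1 (stationarity, asymptotic flatness): `lorentz` to `cauchy`, and
  `asympFlat`.
* Assumption 2 (non-degeneracy of the horizon) has content only if there is a horizon; what is
  required here is the stronger statement `noHorizon`. It also makes void the clauses of the other
  assumptions on the geometry of the horizon.
* Assumption 3 (smallness of the ergoregion; for an empty horizon, no ergoregion):
  `T_timelike`.
* Assumption 4 (boundedness of the energy of waves): last clause of `asympFlat`. Smooth functions
  on the closed set `J⁺(Σ) ∩ D` are given there as restrictions of smooth functions on `M`. -/
structure SatisfiesAssumptions (g : BilinField) : Prop where
  lorentz : IsLorentzMetric g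
  killing : IsKilling g (fun _ => T)
  complete : IsCompleteField (fun _ => T)
  spacelike : ∀ p ∈ slice 0, ∀ v : E3, v ≠ 0 → 0 < g p (0, v) (0, v)
  cauchy : IsCauchy g (slice 0)
  T_timelike : ∀ p, g p T T < 0
  asympFlat : ∃ (R : ℝ) (Φ : OpenPartialHomeomorph E3 E3), IsAsympFlatEnd g R Φ ∧
    -- no horizon
    (outerDomain g Φ.target = univ ∧ horizon g Φ.target = ∅ ∧
      futureHorizon g Φ.target = ∅ ∧ pastHorizon g Φ.target = ∅) ∧
    -- the translates of `Σ ∩ D` along `T` cover `J⁺(Σ) ∩ D`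
    (∀ p ∈ Jplus g (slice 0) ∩ outerDomain g Φ.target,
      ∃ s : ℝ, 0 ≤ s ∧ ∃ q ∈ slice 0 ∩ outerDomain g Φ.target, p = q + s • T) ∧
    -- boundedness of the energy
    ∃ C : ℝ, 0 < C ∧ ∀ ψ : M → ℂ, ContDiff ℝ ∞ ψ →
      (∀ p ∈ Jplus g (slice 0) ∩ outerDomain g Φ.target, box g ψ p = 0) →
      ∀ t t' : ℝ, 0 ≤ t → t ≤ t' → energy g ψ t' ≤ ENNReal.ofReal C * energy g ψ t

/-! ### The spacetime -/

/-- The radial profile of the metric: smooth on `[0, ∞)`, equal to `sin² r` for `r ≤ 7π/8`, to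
`r²` for `r ≥ π`, and positive in between. -/
structure IsProfile (f : ℝ → ℝ) : Prop where
  smooth : ContDiffOn ℝ ∞ f (Ici 0)
  sphere : ∀ r, 0 ≤ r → r ≤ 7 * Real.pi / 8 → f r = Real.sin r ^ 2
  flat : ∀ r, Real.pi ≤ r → f r = r ^ 2
  pos : ∀ r, 7 * Real.pi / 8 ≤ r → r ≤ Real.pi → 0 < f r

/-- The Euclidean metric `|dx|²`. -/
noncomputable def euclid : E3 →L[ℝ] E3 →L[ℝ] ℝ := innerSL ℝ

theorem euclid_apply (v w : E3) : euclid v w = inner ℝ v w := rfl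

/-- The form `dr ⊗ dr` on `ℝ³ \ {0}`. -/
noncomputable def drSq (x : E3) : E3 →L[ℝ] E3 →L[ℝ] ℝ :=
  (euclid (‖x‖⁻¹ • x)).smulRight (euclid (‖x‖⁻¹ • x))

/-- The form `dϑ² + sin² ϑ dφ² = r⁻² (|dx|² - dr²)` on `ℝ³ \ {0}`. -/
noncomputable def sphereForm (x : E3) : E3 →L[ℝ] E3 →L[ℝ] ℝ :=
  (‖x‖ ^ 2)⁻¹ • (euclid - drSq x)

open Classical in
/-- The Riemannian metric `g₀ = dr² + f(r) (dϑ² + sin² ϑ dφ²)` on `ℝ³`, written at the origin as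
the Euclidean form (its continuous extension when `f(r) = sin² r` near `0`). -/
noncomputable def g₀ (f : ℝ → ℝ) (x : E3) : E3 →L[ℝ] E3 →L[ℝ] ℝ :=
  if x = 0 then euclid else drSq x + f ‖x‖ • sphereForm x

/-- The ultrastatic metric `g = -dt² + g₀` on `ℝ × ℝ³`. -/
noncomputable def ultrastatic (f : ℝ → ℝ) : BilinField := fun p =>
  -((ContinuousLinearMap.fst ℝ ℝ E3).smulRight (ContinuousLinearMap.fst ℝ ℝ E3))
    + (g₀ f p.2).bilinearComp (ContinuousLinearMap.snd ℝ ℝ E3) (ContinuousLinearMap.snd ℝ ℝ E3)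

end LogSharp

namespace LogSharp

open scoped SchwartzMap

/-! ### Rapidly decreasing families of Fourier transforms -/

/-! The metric is static, and `g₀_apply` writes its spatial part as ρ|dx|² − κ(x·dx)² with ρ =
f(r)/r² and κ = (ρ − 1)/r², both smooth across the origin; its eigenvalues are 1 in the radial
direction and ρ in the tangential ones. Hence ρ□ is the divergence form operator div((1 + κxxᵀ)∇) −
ρ∂_t², which is flat for r ≥ π.

Part (A). The spatial metric is uniformly equivalent to the Euclidean one
(`exists_spaceQuad_bounds`). Timelike curves therefore have bounded coordinate speed, which gives
the Cauchy property, and steep straight lines join every point to the end in both time directions,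
so there is no horizon. The end is exactly Euclidean. The energy identity, integrated against a
cutoff to a cone opening to the past or to the future, shows that the energy cannot grow in either
time direction (`lintegral_enDens_le`), so C = 1 works.

Part (B). The highest weight harmonics sin^l r · Y_l of the round three-sphere have eigenvalue
l(l+2) (`ellOp_modeSm`) and concentrate at r = π/2. A cutoff placed where sin² r ≤ 1/4, while a
fixed share of the mass N sits where r ≤ 3π/4, produces a quasimode q whose squared error F is O(l²
2^{-l} N) (`quasimode_estimates`). Let λ² = l(l+2) and let ψ solve the wave equation with data (q,
−iλq). Then η = ∂_tψ + iλψ is again a solution, its energy density integrates to at most F at all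
times, and ∂_t(e^{iλt}∂_tψ) = e^{iλt}∂_tη. So up to time τ the local energy, initially of size λ²N,
is disturbed only by O(τ²F) (`le_energyOn_ball`). With l about 3 log(2+τ)/log 2 the disturbance is
negligible. The local energy is then at least a multiple of l²N, the norms of the data are at most a
multiple of l⁴N, and the quotient l⁻² is of order (log τ)⁻², which beats h.

Existence of ψ. On a single spherical mode, multiplication by √ρ turns the equation into a flat wave
equation with a smooth compactly supported potential (`ellOp_of_mode`). That equation is solved by a
Picard series on the Fourier side (`exists_wave_solution`). Uniqueness (`eq_zero_of_wave`) keeps the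
solution in its mode, so that the substitution can be undone (`exists_mode_solution`). Smooth
functions on spacetime form an algebra `Sm` with commuting derivations, which reduces the
differential identities to ring identities. -/

/-- Continuous functions of `(t, ξ)`, rapidly decreasing in `ξ`, locally uniformly in `t`. -/
structure RapidDecay (B : ℝ × E3 → ℂ) : Prop where
  cont : Continuous B
  bound : ∀ (N : ℝ) (k : ℕ), ∃ C : ℝ, ∀ t, |t| ≤ N → ∀ ξ, (1 + ‖ξ‖) ^ k * ‖B (t, ξ)‖ ≤ C

/-- Convolution in the frequency variable. -/
noncomputable def freqConv (G : 𝓢(E3, ℂ)) (B : ℝ × E3 → ℂ) (p : ℝ × E3) : ℂ :=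
  ∫ ζ, G ζ * B (p.1, p.2 - ζ)

/-- The weighted `L¹` norm bounding the convolution. -/
noncomputable def weightedNorm (G : 𝓢(E3, ℂ)) (k : ℕ) : ℝ := ∫ ζ, (1 + ‖ζ‖) ^ k * ‖G ζ‖

/-- The exponent 4 is the first integer above the dimension 3. -/
theorem integrable_of_decay {F : E3 → ℝ} (hF : AEStronglyMeasurable F volume) (C : ℝ)
    (h : ∀ ξ, (1 + ‖ξ‖) ^ 4 * ‖F ξ‖ ≤ C) : Integrable F := by
  have h1 : Integrable (fun x : E3 => C * (1 + ‖x‖) ^ (-(4 : ℝ))) :=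
    (integrable_one_add_norm (by simp; norm_num)).const_mul C
  refine h1.mono' hF (Eventually.of_forall fun x => ?_)
  have hx : (0 : ℝ) < 1 + ‖x‖ := by positivity
  rw [Real.rpow_neg hx.le, ← div_eq_mul_inv, le_div_iff₀ (by positivity)]
  have := h x
  rw [mul_comm]
  exact_mod_cast this

theorem integrable_decay_bound : Integrable (fun x : E3 => ((1 + ‖x‖) ^ 4)⁻¹) := by
  refine integrable_of_decay (Continuous.aestronglyMeasurable (by fun_prop (disch := intros; positivity))) 1 fun ξ => ?_
  have : (0 : ℝ) < (1 + ‖ξ‖) ^ 4 := by positivity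
  rw [Real.norm_of_nonneg (by positivity), mul_inv_cancel₀ this.ne']

theorem schwartz_decay (G : 𝓢(E3, ℂ)) (k : ℕ) : ∃ C : ℝ, ∀ ξ, (1 + ‖ξ‖) ^ k * ‖G ξ‖ ≤ C := by
  refine ⟨2 ^ k * ((Finset.Iic (k, 0)).sup fun m => SchwartzMap.seminorm ℝ m.1 m.2) G,
    fun ξ => ?_⟩
  have := SchwartzMap.one_add_le_sup_seminorm_apply (𝕜 := ℝ) (m := (k, 0)) (k := k) (n := 0)
    le_rfl le_rfl G ξ
  rw [norm_iteratedFDeriv_zero] at this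
  exact this

theorem integrable_weighted (G : 𝓢(E3, ℂ)) (k : ℕ) :
    Integrable (fun ζ => (1 + ‖ζ‖) ^ k * ‖G ζ‖) := by
  obtain ⟨C, hC⟩ := schwartz_decay G (4 + k)
  refine integrable_of_decay (Continuous.aestronglyMeasurable (by have := G.continuous; fun_prop)) C
    fun ξ => ?_
  rw [Real.norm_of_nonneg (by positivity), ← mul_assoc, ← pow_add]
  exact hC ξ

theorem weightedNorm_nonneg (G : 𝓢(E3, ℂ)) (k : ℕ) : 0 ≤ weightedNorm G k :=
  integral_nonneg fun _ => by positivity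

/-- Peetre's inequality: the weight is submultiplicative, so it can be distributed over the two
factors of a convolution. -/
theorem one_add_norm_pow_le (k : ℕ) (ξ ζ : E3) :
    (1 + ‖ξ‖) ^ k ≤ (1 + ‖ζ‖) ^ k * (1 + ‖ξ - ζ‖) ^ k := by
  rw [← mul_pow]
  gcongr
  have h1 : ‖ξ‖ ≤ ‖ζ‖ + ‖ξ - ζ‖ := by
    calc ‖ξ‖ = ‖ζ + (ξ - ζ)‖ := by simp
      _ ≤ _ := norm_add_le _ _
  nlinarith [norm_nonneg ζ, norm_nonneg (ξ - ζ), mul_nonneg (norm_nonneg ζ) (norm_nonneg (ξ - ζ))]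

theorem freqConv_integrand_le (G : 𝓢(E3, ℂ)) (B : ℝ × E3 → ℂ) (k : ℕ) {C : ℝ} (t : ℝ)
    (h : ∀ ξ, (1 + ‖ξ‖) ^ k * ‖B (t, ξ)‖ ≤ C) (ξ ζ : E3) :
    (1 + ‖ξ‖) ^ k * ‖G ζ * B (t, ξ - ζ)‖ ≤ (1 + ‖ζ‖) ^ k * ‖G ζ‖ * C := by
  rw [norm_mul]
  calc (1 + ‖ξ‖) ^ k * (‖G ζ‖ * ‖B (t, ξ - ζ)‖)
      ≤ ((1 + ‖ζ‖) ^ k * (1 + ‖ξ - ζ‖) ^ k) * (‖G ζ‖ * ‖B (t, ξ - ζ)‖) := by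
        gcongr; exact one_add_norm_pow_le k ξ ζ
    _ = (1 + ‖ζ‖) ^ k * ‖G ζ‖ * ((1 + ‖ξ - ζ‖) ^ k * ‖B (t, ξ - ζ)‖) := by ring
    _ ≤ _ := by gcongr; exact h _

/-- Convolution with a Schwartz function is bounded on every weighted sup norm, with the weight k
unchanged; this is what lets the Picard iteration keep its decay. -/
theorem freqConv_bound (G : 𝓢(E3, ℂ)) (B : ℝ × E3 → ℂ) (k : ℕ) {C : ℝ} (t : ℝ)
    (h : ∀ ξ, (1 + ‖ξ‖) ^ k * ‖B (t, ξ)‖ ≤ C) (ξ : E3) :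
    (1 + ‖ξ‖) ^ k * ‖freqConv G B (t, ξ)‖ ≤ weightedNorm G k * C := by
  have hpos : (0 : ℝ) < (1 + ‖ξ‖) ^ k := by positivity
  rw [← le_div_iff₀' hpos]
  have : weightedNorm G k * C / (1 + ‖ξ‖) ^ k
      = ∫ ζ, (1 + ‖ζ‖) ^ k * ‖G ζ‖ * (C / (1 + ‖ξ‖) ^ k) := by
    rw [integral_mul_const, weightedNorm, mul_div_assoc]
  rw [this]
  refine norm_integral_le_of_norm_le ((integrable_weighted G k).mul_const _)
    (Eventually.of_forall fun ζ => ?_)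
  rw [← mul_div_assoc, le_div_iff₀' hpos]
  exact freqConv_integrand_le G B k t h ξ ζ

theorem RapidDecay.freqConv {B : ℝ × E3 → ℂ} (hB : RapidDecay B) (G : 𝓢(E3, ℂ)) :
    RapidDecay (freqConv G B) where
  cont := by
    rw [continuous_iff_continuousAt]
    intro p
    obtain ⟨C, hC⟩ := hB.bound (|p.1| + 1) 0
    have hc := hB.cont
    have hG := G.continuous
    refine continuousAt_of_dominated (bound := fun ζ => ‖G ζ‖ * C)
      (Eventually.of_forall fun q => Continuous.aestronglyMeasurable (by fun_prop)) ?_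
      ((by simpa using integrable_weighted G 0 : Integrable (fun ζ => ‖G ζ‖)).mul_const C)
      (Eventually.of_forall fun ζ => Continuous.continuousAt (by fun_prop))
    have h1 : ∀ᶠ q : ℝ × E3 in 𝓝 p, |q.1| < |p.1| + 1 :=
      (continuous_fst.abs.tendsto p).eventually (gt_mem_nhds (by simp))
    filter_upwards [h1] with q hq
    refine Eventually.of_forall fun ζ => ?_
    rw [norm_mul]
    gcongr
    simpa using hC q.1 hq.le (q.2 - ζ)
  bound := by
    intro N k
    obtain ⟨C, hC⟩ := hB.bound N k
    exact ⟨_, fun t ht ξ => freqConv_bound G B k t (hC t ht) ξ⟩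

theorem RapidDecay.add {A B : ℝ × E3 → ℂ} (hA : RapidDecay A) (hB : RapidDecay B) :
    RapidDecay (fun p => A p + B p) where
  cont := hA.cont.add hB.cont
  bound := by
    intro N k
    obtain ⟨C, hC⟩ := hA.bound N k
    obtain ⟨D, hD⟩ := hB.bound N k
    refine ⟨C + D, fun t ht ξ => ?_⟩
    calc _ ≤ (1 + ‖ξ‖) ^ k * (‖A (t, ξ)‖ + ‖B (t, ξ)‖) := by gcongr; exact norm_add_le _ _
      _ ≤ _ := by rw [mul_add]; exact add_le_add (hC t ht ξ) (hD t ht ξ)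

/-- Multiplication by a factor of polynomial growth. -/
theorem RapidDecay.mul_of_growth {B : ℝ × E3 → ℂ} (hB : RapidDecay B) {m : ℝ × E3 → ℂ}
    (hm : Continuous m) (j : ℕ)
    (hmb : ∀ N : ℝ, ∃ C : ℝ, ∀ t, |t| ≤ N → ∀ ξ, ‖m (t, ξ)‖ ≤ C * (1 + ‖ξ‖) ^ j) :
    RapidDecay (fun p => m p * B p) where
  cont := hm.mul hB.cont
  bound := by
    intro N k
    obtain ⟨C, hC⟩ := hB.bound N (k + j)
    obtain ⟨D, hD⟩ := hmb N
    refine ⟨|D| * C, fun t ht ξ => ?_⟩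
    rw [norm_mul]
    calc (1 + ‖ξ‖) ^ k * (‖m (t, ξ)‖ * ‖B (t, ξ)‖)
        ≤ (1 + ‖ξ‖) ^ k * ((|D| * (1 + ‖ξ‖) ^ j) * ‖B (t, ξ)‖) := by
          gcongr
          exact (hD t ht ξ).trans (by gcongr; exact le_abs_self D)
      _ = |D| * ((1 + ‖ξ‖) ^ (k + j) * ‖B (t, ξ)‖) := by rw [pow_add]; ring
      _ ≤ _ := by gcongr; exact hC t ht ξ

theorem RapidDecay.const_mul {B : ℝ × E3 → ℂ} (hB : RapidDecay B) (c : ℂ) :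
    RapidDecay (fun p => c * B p) :=
  hB.mul_of_growth (m := fun _ => c) continuous_const 0 fun _ => ⟨‖c‖, by simp⟩

theorem RapidDecay.coord_mul {B : ℝ × E3 → ℂ} (hB : RapidDecay B) (i : Fin 3) :
    RapidDecay (fun p => (p.2 i : ℂ) * B p) := by
  refine hB.mul_of_growth (m := fun p => (p.2 i : ℂ)) (by fun_prop) 1
    fun _ => ⟨1, fun t _ ξ => ?_⟩
  have := PiLp.norm_apply_le ξ i
  rw [Complex.norm_real]
  linarith

theorem RapidDecay.of_schwartz (G : 𝓢(E3, ℂ)) : RapidDecay (fun p => G p.2) where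
  cont := G.continuous.comp continuous_snd
  bound := fun _ k => (schwartz_decay G k).imp fun _ hC _ _ ξ => hC ξ

theorem RapidDecay.integrable {B : ℝ × E3 → ℂ} (hB : RapidDecay B) (t : ℝ) :
    Integrable (fun ξ => B (t, ξ)) := by
  obtain ⟨C, hC⟩ := hB.bound |t| 4
  have hc := hB.cont
  have : Continuous (fun ξ => B (t, ξ)) := by fun_prop
  rw [← integrable_norm_iff this.aestronglyMeasurable]
  refine integrable_of_decay this.norm.aestronglyMeasurable C fun ξ => ?_
  rw [norm_norm]
  exact hC t le_rfl ξ

end LogSharp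

namespace LogSharp

open scoped SchwartzMap

/-! ### The free propagators in frequency space -/

/-- `cos(2π|ξ|t)`. -/
noncomputable def cosProp (p : ℝ × E3) : ℝ := Real.cos (2 * Real.pi * ‖p.2‖ * p.1)

/-- `sin(2π|ξ|t) / (2π|ξ|)`. -/
noncomputable def sinProp (p : ℝ × E3) : ℝ := p.1 * Real.sinc (2 * Real.pi * ‖p.2‖ * p.1)

@[fun_prop]
theorem continuous_cosProp : Continuous cosProp := by unfold cosProp; fun_prop

@[fun_prop]
theorem continuous_sinProp : Continuous sinProp := by unfold sinProp; fun_prop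

theorem abs_cosProp_le (p : ℝ × E3) : |cosProp p| ≤ 1 := Real.abs_cos_le_one _

theorem abs_sinProp_le (p : ℝ × E3) : |sinProp p| ≤ |p.1| := by
  rw [sinProp, abs_mul]
  exact mul_le_of_le_one_right (abs_nonneg _) (Real.abs_sinc_le_one _)

theorem mul_sinProp (p : ℝ × E3) :
    2 * Real.pi * ‖p.2‖ * sinProp p = Real.sin (2 * Real.pi * ‖p.2‖ * p.1) := by
  unfold sinProp
  by_cases h : 2 * Real.pi * ‖p.2‖ * p.1 = 0
  · rw [← mul_assoc, h, Real.sin_zero, zero_mul]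
  · rw [Real.sinc_of_ne_zero h, mul_div_assoc', mul_div_assoc', ← mul_assoc,
      mul_div_cancel_left₀ _ h]

theorem hasDerivAt_cosProp (t : ℝ) (ξ : E3) :
    HasDerivAt (fun s => cosProp (s, ξ)) (-((2 * Real.pi * ‖ξ‖) ^ 2 * sinProp (t, ξ))) t := by
  have h := ((hasDerivAt_id t).const_mul (2 * Real.pi * ‖ξ‖)).cos
  refine h.congr_deriv ?_
  have := mul_sinProp (t, ξ)
  simp only [id] at this ⊢
  rw [sq, mul_assoc (2 * Real.pi * ‖ξ‖), this]
  ring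

theorem hasDerivAt_sinProp (t : ℝ) (ξ : E3) :
    HasDerivAt (fun s => sinProp (s, ξ)) (cosProp (t, ξ)) t := by
  by_cases hξ : ξ = 0
  · subst hξ
    simpa [sinProp, cosProp] using hasDerivAt_id' t
  · have hne : 2 * Real.pi * ‖ξ‖ ≠ 0 := by
      have := norm_ne_zero_iff.2 hξ
      have := Real.pi_ne_zero
      positivity
    have h := (((hasDerivAt_id t).const_mul (2 * Real.pi * ‖ξ‖)).sin).div_const (2 * Real.pi * ‖ξ‖)
    refine (h.congr_deriv ?_).congr_of_eventuallyEq (Eventually.of_forall fun s => ?_)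
    · simp only [cosProp, id]
      field_simp
    · have := mul_sinProp (s, ξ)
      simp only at this ⊢
      rw [eq_div_iff hne, mul_comm, this]
      rfl

theorem cosProp_sq_add (p : ℝ × E3) :
    cosProp p ^ 2 + (2 * Real.pi * ‖p.2‖) ^ 2 * sinProp p ^ 2 = 1 := by
  rw [← mul_pow, mul_sinProp, cosProp, Real.cos_sq_add_sin_sq]

/-- The solution of `u'' = -(2π|ξ|)² u - h` with zero data. -/
noncomputable def duhamel (h : ℝ × E3 → ℂ) (p : ℝ × E3) : ℂ :=
  cosProp p * (∫ s in (0 : ℝ)..p.1, sinProp (s, p.2) * h (s, p.2))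
    - sinProp p * ∫ s in (0 : ℝ)..p.1, cosProp (s, p.2) * h (s, p.2)

/-- The time derivative of `duhamel`. -/
noncomputable def duhamelDeriv (h : ℝ × E3 → ℂ) (p : ℝ × E3) : ℂ :=
  -((2 * Real.pi * ‖p.2‖) ^ 2 * sinProp p : ℝ) * (∫ s in (0 : ℝ)..p.1, sinProp (s, p.2) * h (s, p.2))
    - cosProp p * ∫ s in (0 : ℝ)..p.1, cosProp (s, p.2) * h (s, p.2)

theorem continuous_primitive {h : ℝ × E3 → ℂ} (hh : Continuous h) :
    Continuous (fun p : ℝ × E3 => ∫ s in (0 : ℝ)..p.1, h (s, p.2)) :=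
  intervalIntegral.continuous_parametric_intervalIntegral_of_continuous
    (f := fun (p : ℝ × E3) s => h (s, p.2)) (by fun_prop) continuous_fst

theorem continuous_duhamel {h : ℝ × E3 → ℂ} (hh : Continuous h) : Continuous (duhamel h) := by
  have h1 := continuous_primitive (h := fun p => sinProp p * h p) (by fun_prop)
  have h2 := continuous_primitive (h := fun p => cosProp p * h p) (by fun_prop)
  unfold duhamel
  fun_prop

theorem continuous_duhamelDeriv {h : ℝ × E3 → ℂ} (hh : Continuous h) :
    Continuous (duhamelDeriv h) := by
  have h1 := continuous_primitive (h := fun p => sinProp p * h p) (by fun_prop)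
  have h2 := continuous_primitive (h := fun p => cosProp p * h p) (by fun_prop)
  unfold duhamelDeriv
  fun_prop

theorem hasDerivAt_primitive {h : ℝ × E3 → ℂ} (hh : Continuous h) (t : ℝ) (ξ : E3) :
    HasDerivAt (fun t => ∫ s in (0 : ℝ)..t, h (s, ξ)) (h (t, ξ)) t := by
  have hc : Continuous (fun s => h (s, ξ)) := by fun_prop
  exact intervalIntegral.integral_hasDerivAt_right (hc.intervalIntegrable _ _)
    (hc.stronglyMeasurableAtFilter _ _) hc.continuousAt

/-- The kernel sin(ω(t−s))/ω is expanded by the addition theorem, so that t stands outside the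
integrals; the two boundary terms then cancel. -/
theorem hasDerivAt_duhamel {h : ℝ × E3 → ℂ} (hh : Continuous h) (t : ℝ) (ξ : E3) :
    HasDerivAt (fun s => duhamel h (s, ξ)) (duhamelDeriv h (t, ξ)) t := by
  have h1 := hasDerivAt_primitive (h := fun p => sinProp p * h p) (by fun_prop) t ξ
  have h2 := hasDerivAt_primitive (h := fun p => cosProp p * h p) (by fun_prop) t ξ
  have h3 := ((hasDerivAt_cosProp t ξ).ofReal_comp.mul h1).sub
    ((hasDerivAt_sinProp t ξ).ofReal_comp.mul h2)
  refine h3.congr_deriv ?_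
  simp only [duhamelDeriv]
  push_cast
  ring

/-- Now the boundary terms add up to −h times the Wronskian cos² + ω² (sin/ω)² = 1. -/
theorem hasDerivAt_duhamelDeriv {h : ℝ × E3 → ℂ} (hh : Continuous h) (t : ℝ) (ξ : E3) :
    HasDerivAt (fun s => duhamelDeriv h (s, ξ))
      (-((2 * Real.pi * ‖ξ‖) ^ 2 : ℝ) * duhamel h (t, ξ) - h (t, ξ)) t := by
  have h1 := hasDerivAt_primitive (h := fun p => sinProp p * h p) (by fun_prop) t ξ
  have h2 := hasDerivAt_primitive (h := fun p => cosProp p * h p) (by fun_prop) t ξ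
  have h3 := ((((hasDerivAt_sinProp t ξ).const_mul ((2 * Real.pi * ‖ξ‖) ^ 2)).ofReal_comp.neg).mul
    h1).sub ((hasDerivAt_cosProp t ξ).ofReal_comp.mul h2)
  refine h3.congr_deriv ?_
  have h4 : ((cosProp (t, ξ) ^ 2 + (2 * Real.pi * ‖ξ‖) ^ 2 * sinProp (t, ξ) ^ 2 : ℝ) : ℂ) = 1 := by
    rw [cosProp_sq_add (t, ξ)]; simp
  simp only [duhamel, Pi.neg_apply]
  push_cast at h4 ⊢
  linear_combination -(h (t, ξ)) * h4

/-- The substitution s = tθ treats both signs of t at once. The gained factor |t|/(n+1) builds up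
the factorials of the Picard bound. -/
theorem norm_integral_zero_le {F : ℝ → ℂ} {K t : ℝ} (n : ℕ)
    (h : ∀ s, |s| ≤ |t| → ‖F s‖ ≤ K * |s| ^ n) :
    ‖∫ s in (0 : ℝ)..t, F s‖ ≤ K * |t| ^ (n + 1) / (n + 1) := by
  have h0 : ∫ s in (0 : ℝ)..t, F s = t • ∫ θ in (0 : ℝ)..1, F (t * θ) := by
    rw [intervalIntegral.smul_integral_comp_mul_left]; simp
  have h1 : ‖∫ θ in (0 : ℝ)..1, F (t * θ)‖ ≤ ∫ θ in (0 : ℝ)..1, K * |t| ^ n * θ ^ n := by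
    refine intervalIntegral.norm_integral_le_of_norm_le zero_le_one
      (Eventually.of_forall fun θ hθ => ?_) (Continuous.intervalIntegrable (by fun_prop) _ _)
    have hθ' : |t * θ| = |t| * θ := by rw [abs_mul, abs_of_pos hθ.1]
    have := h (t * θ) (by rw [hθ']; exact mul_le_of_le_one_right (abs_nonneg t) hθ.2)
    rwa [hθ', mul_pow, ← mul_assoc] at this
  simp only [intervalIntegral.integral_const_mul, integral_pow] at h1
  rw [h0, norm_smul, Real.norm_eq_abs]
  calc |t| * ‖∫ θ in (0 : ℝ)..1, F (t * θ)‖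
      ≤ |t| * (K * |t| ^ n * ((1 ^ (n + 1) - 0 ^ (n + 1)) / (n + 1))) := by gcongr
    _ = _ := by rw [one_pow, zero_pow n.succ_ne_zero]; ring

/-- Both propagators are bounded uniformly in ξ for |t| ≤ N, so no decay in ξ is lost. -/
theorem duhamel_bound {h : ℝ × E3 → ℂ} {K N t : ℝ} (n : ℕ) (ξ : E3)
    (ht : |t| ≤ N) (hb : ∀ s, |s| ≤ N → ‖h (s, ξ)‖ ≤ K * |s| ^ n) :
    ‖duhamel h (t, ξ)‖ ≤ 2 * N * K * |t| ^ (n + 1) / (n + 1) := by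
  have hN : 0 ≤ N := (abs_nonneg t).trans ht
  have h1 : ‖∫ s in (0 : ℝ)..t, sinProp (s, ξ) * h (s, ξ)‖ ≤ (N * K) * |t| ^ (n + 1) / (n + 1) := by
    refine norm_integral_zero_le n fun s hs => ?_
    rw [norm_mul, Complex.norm_real, mul_assoc]
    exact mul_le_mul ((abs_sinProp_le _).trans (hs.trans ht)) (hb s (hs.trans ht))
      (norm_nonneg _) hN
  have h2 : ‖∫ s in (0 : ℝ)..t, cosProp (s, ξ) * h (s, ξ)‖ ≤ K * |t| ^ (n + 1) / (n + 1) := by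
    refine norm_integral_zero_le n fun s hs => ?_
    rw [norm_mul, Complex.norm_real]
    exact (mul_le_of_le_one_left (norm_nonneg _) (abs_cosProp_le _)).trans (hb s (hs.trans ht))
  calc ‖duhamel h (t, ξ)‖
      ≤ |cosProp (t, ξ)| * ‖∫ s in (0 : ℝ)..t, sinProp (s, ξ) * h (s, ξ)‖
        + |sinProp (t, ξ)| * ‖∫ s in (0 : ℝ)..t, cosProp (s, ξ) * h (s, ξ)‖ := by
        refine (norm_sub_le _ _).trans (le_of_eq ?_)
        simp only [norm_mul, Complex.norm_real, Real.norm_eq_abs]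
    _ ≤ 1 * ((N * K) * |t| ^ (n + 1) / (n + 1)) + N * (K * |t| ^ (n + 1) / (n + 1)) := by
        gcongr
        · exact abs_cosProp_le _
        · exact (abs_sinProp_le _).trans ht
    _ = _ := by ring

/-! ### The Picard series -/

/-- The free evolution of the Fourier transforms `a`, `b` of the data. -/
noncomputable def freeEvol (a b : 𝓢(E3, ℂ)) (p : ℝ × E3) : ℂ :=
  cosProp p * a p.2 + sinProp p * b p.2

theorem rapidDecay_freeEvol (a b : 𝓢(E3, ℂ)) : RapidDecay (freeEvol a b) := by
  refine RapidDecay.add ((RapidDecay.of_schwartz a).mul_of_growth (m := fun p => cosProp p)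
    (by fun_prop) 0 fun N => ⟨1, fun t _ ξ => ?_⟩)
    ((RapidDecay.of_schwartz b).mul_of_growth (m := fun p => sinProp p)
    (by fun_prop) 0 fun N => ⟨N, fun t ht ξ => ?_⟩)
  · simpa using abs_cosProp_le (t, ξ)
  · simpa using (abs_sinProp_le (t, ξ)).trans ht

/-- The terms of the Picard series. -/
noncomputable def picardTerm (G a b : 𝓢(E3, ℂ)) : ℕ → ℝ × E3 → ℂ
  | 0 => freeEvol a b
  | n + 1 => duhamel (freqConv G (picardTerm G a b n))

/-- The two claims are proved together: decay of the n-th term makes its convolution continuous, and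
the explicit bound of exponential series type, for a fixed weight k, feeds the next step. -/
theorem picardTerm_bound_aux (G a b : 𝓢(E3, ℂ)) (n : ℕ) : RapidDecay (picardTerm G a b n) ∧
    ∀ (N : ℝ) (k : ℕ) (C : ℝ),
      (∀ t, |t| ≤ N → ∀ ξ, (1 + ‖ξ‖) ^ k * ‖freeEvol a b (t, ξ)‖ ≤ C) →
      ∀ t, |t| ≤ N → ∀ ξ, (1 + ‖ξ‖) ^ k * ‖picardTerm G a b n (t, ξ)‖
        ≤ C * (2 * N * weightedNorm G k) ^ n / n.factorial * |t| ^ n := by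
  induction n with
  | zero =>
    refine ⟨rapidDecay_freeEvol a b, fun N k C hC t ht ξ => ?_⟩
    simpa [picardTerm] using hC t ht ξ
  | succ n ih =>
    obtain ⟨hR, hb⟩ := ih
    have key : ∀ (N : ℝ) (k : ℕ) (C : ℝ),
      (∀ t, |t| ≤ N → ∀ ξ, (1 + ‖ξ‖) ^ k * ‖freeEvol a b (t, ξ)‖ ≤ C) →
      ∀ t, |t| ≤ N → ∀ ξ, (1 + ‖ξ‖) ^ k * ‖picardTerm G a b (n + 1) (t, ξ)‖
        ≤ C * (2 * N * weightedNorm G k) ^ (n + 1) / (n + 1).factorial * |t| ^ (n + 1) := by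
      intro N k C hC t ht ξ
      have hpos : (0 : ℝ) < (1 + ‖ξ‖) ^ k := by positivity
      have h1 := duhamel_bound (h := freqConv G (picardTerm G a b n)) (N := N) (t := t)
        (K := weightedNorm G k * (C * (2 * N * weightedNorm G k) ^ n / n.factorial)
          / (1 + ‖ξ‖) ^ k) n ξ ht (fun s hs => by
            have := freqConv_bound G (picardTerm G a b n) k s (fun ξ => hb N k C hC s hs ξ) ξ
            rw [div_mul_eq_mul_div, le_div_iff₀' hpos, mul_assoc]
            exact this)
      rw [← le_div_iff₀' hpos]
      refine h1.trans (le_of_eq ?_)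
      rw [Nat.factorial_succ]
      push_cast
      field_simp
      try ring
    refine ⟨⟨continuous_duhamel (hR.freqConv G).cont, fun N k => ?_⟩, key⟩
    obtain ⟨C, hC⟩ := (rapidDecay_freeEvol a b).bound N k
    refine ⟨|C * (2 * N * weightedNorm G k) ^ (n + 1) / (n + 1).factorial| * |N| ^ (n + 1),
      fun t ht ξ => (key N k C hC t ht ξ).trans ?_⟩
    exact mul_le_mul (le_abs_self _)
      (pow_le_pow_left₀ (abs_nonneg t) (ht.trans (le_abs_self N)) _) (by positivity) (abs_nonneg _)

theorem rapidDecay_picardTerm (G a b : 𝓢(E3, ℂ)) (n : ℕ) : RapidDecay (picardTerm G a b n) :=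
  (picardTerm_bound_aux G a b n).1

/-- The majorant is an exponential series, uniform for |t| ≤ N and in ξ for each weight; every
exchange of the sum with a limit or an integral rests on it. -/
theorem exists_picardTerm_bound (G a b : 𝓢(E3, ℂ)) (N : ℝ) (k : ℕ) : ∃ m : ℕ → ℝ, Summable m ∧
    ∀ n t, |t| ≤ N → ∀ ξ, (1 + ‖ξ‖) ^ k * ‖picardTerm G a b n (t, ξ)‖ ≤ m n := by
  obtain ⟨C, hC⟩ := (rapidDecay_freeEvol a b).bound N k
  refine ⟨fun n => |C| * ((2 * |N| * weightedNorm G k * |N|) ^ n / n.factorial),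
    (Real.summable_pow_div_factorial _).mul_left _, fun n t ht ξ => ?_⟩
  refine ((picardTerm_bound_aux G a b n).2 N k C hC t ht ξ).trans ?_
  have hN : 0 ≤ N := (abs_nonneg t).trans ht
  have hw := weightedNorm_nonneg G k
  rw [abs_of_nonneg hN]
  calc C * (2 * N * weightedNorm G k) ^ n / n.factorial * |t| ^ n
      ≤ |C| * (2 * N * weightedNorm G k) ^ n / n.factorial * N ^ n := by
        gcongr; exact le_abs_self C
    _ = _ := by simp only [mul_pow]; ring

/-- The Fourier transform of the solution of `∂_t² u = Δu - Q u`, where `G` is the Fourier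
transform of `Q`. -/
noncomputable def picardSum (G a b : 𝓢(E3, ℂ)) (p : ℝ × E3) : ℂ := ∑' n, picardTerm G a b n p

theorem summable_norm_picardTerm (G a b : 𝓢(E3, ℂ)) (p : ℝ × E3) :
    Summable (fun n => ‖picardTerm G a b n p‖) := by
  obtain ⟨m, hm, hb⟩ := exists_picardTerm_bound G a b |p.1| 0
  refine hm.of_nonneg_of_le (fun _ => norm_nonneg _) fun n => ?_
  simpa using hb n p.1 le_rfl p.2

theorem rapidDecay_picardSum (G a b : 𝓢(E3, ℂ)) : RapidDecay (picardSum G a b) where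
  cont := by
    rw [continuous_iff_continuousAt]
    intro p
    obtain ⟨m, hm, hb⟩ := exists_picardTerm_bound G a b (|p.1| + 1) 0
    have h1 : {q : ℝ × E3 | |q.1| < |p.1| + 1} ∈ 𝓝 p :=
      (isOpen_lt (by fun_prop) continuous_const).mem_nhds (by simp)
    refine (continuousOn_tsum (fun n => (rapidDecay_picardTerm G a b n).cont.continuousOn) hm
      fun n q hq => ?_).continuousAt h1
    simpa using hb n q.1 (le_of_lt hq) q.2
  bound := by
    intro N k
    obtain ⟨m, hm, hb⟩ := exists_picardTerm_bound G a b N k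
    refine ⟨∑' n, m n, fun t ht ξ => ?_⟩
    have hpos : (0 : ℝ) < (1 + ‖ξ‖) ^ k := by positivity
    have h2 : ‖picardSum G a b (t, ξ)‖ ≤ (∑' n, m n) / (1 + ‖ξ‖) ^ k := by
      rw [← tsum_div_const]
      refine tsum_of_norm_bounded (hm.div_const _).hasSum fun n => ?_
      rw [le_div_iff₀' hpos]
      exact hb n t ht ξ
    rwa [le_div_iff₀' hpos] at h2

theorem hasSum_freqConv_picardTerm (G a b : 𝓢(E3, ℂ)) (p : ℝ × E3) :
    HasSum (fun n => freqConv G (picardTerm G a b n) p) (freqConv G (picardSum G a b) p) := by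
  obtain ⟨m, hm, hb⟩ := exists_picardTerm_bound G a b |p.1| 0
  have hGi : Integrable (fun ζ => ‖G ζ‖) := by simpa using integrable_weighted G 0
  have hc := fun n => (rapidDecay_picardTerm G a b n).cont
  have hGc := G.continuous
  have hm0 : ∀ n, 0 ≤ m n := fun n => le_trans (by positivity) (hb n p.1 le_rfl 0)
  refine hasSum_integral_of_dominated_convergence (bound := fun n ζ => ‖G ζ‖ * m n)
    (fun n => Continuous.aestronglyMeasurable (by have := hc n; fun_prop))
    (fun n => Eventually.of_forall fun ζ => ?_)
    (Eventually.of_forall fun ζ => hm.mul_left _) ?_ (Eventually.of_forall fun ζ => ?_)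
  · rw [norm_mul]
    gcongr
    simpa using hb n p.1 le_rfl (p.2 - ζ)
  · simp_rw [tsum_mul_left]
    exact hGi.mul_const _
  · exact (summable_norm_picardTerm G a b _).of_norm.hasSum.mul_left _

theorem hasSum_integral_of_bound {F : ℕ → ℝ → ℂ} {f : ℝ → ℂ} {m : ℕ → ℝ} (hm : Summable m) (t : ℝ)
    (hF : ∀ n, Continuous (F n)) (hb : ∀ n s, |s| ≤ |t| → ‖F n s‖ ≤ m n)
    (hs : ∀ s, HasSum (fun n => F n s) (f s)) :
    HasSum (fun n => ∫ s in (0 : ℝ)..t, F n s) (∫ s in (0 : ℝ)..t, f s) := by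
  refine intervalIntegral.hasSum_integral_of_dominated_convergence (fun n _ => m n)
    (fun n => (hF n).aestronglyMeasurable) (fun n => Eventually.of_forall fun s hs => hb n s ?_)
    (Eventually.of_forall fun _ _ => hm) (by simp)
    (Eventually.of_forall fun s _ => hs s)
  rcases le_total 0 t with h | h
  · rw [uIoc_of_le h] at hs
    rw [abs_of_pos hs.1, abs_of_nonneg h]; exact hs.2
  · rw [uIoc_of_ge h] at hs
    rw [abs_of_nonpos hs.2, abs_of_nonpos h]; linarith [hs.1]

theorem hasSum_duhamel_picardTerm (G a b : 𝓢(E3, ℂ)) (p : ℝ × E3) :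
    HasSum (fun n => picardTerm G a b (n + 1) p) (duhamel (freqConv G (picardSum G a b)) p) := by
  obtain ⟨m, hm, hb⟩ := exists_picardTerm_bound G a b |p.1| 0
  have hc := fun n => ((rapidDecay_picardTerm G a b n).freqConv G).cont
  have hb' : ∀ n s, |s| ≤ |p.1| → ‖freqConv G (picardTerm G a b n) (s, p.2)‖
      ≤ weightedNorm G 0 * m n := fun n s hs => by
    simpa using freqConv_bound G _ 0 s (hb n s hs) p.2
  refine ((hasSum_integral_of_bound ((hm.mul_left (weightedNorm G 0)).mul_left |p.1|) p.1
    (fun n => by have := hc n; fun_prop) (fun n s hs => ?_)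
    fun s => (hasSum_freqConv_picardTerm G a b (s, p.2)).mul_left _).mul_left _).sub
    ((hasSum_integral_of_bound (hm.mul_left (weightedNorm G 0)) p.1
    (fun n => by have := hc n; fun_prop) (fun n s hs => ?_)
    fun s => (hasSum_freqConv_picardTerm G a b (s, p.2)).mul_left _).mul_left _)
  · rw [norm_mul, Complex.norm_real]
    exact mul_le_mul ((abs_sinProp_le _).trans hs) (hb' n s hs) (norm_nonneg _) (abs_nonneg _)
  · rw [norm_mul, Complex.norm_real]
    exact (mul_le_of_le_one_left (norm_nonneg _) (abs_cosProp_le _)).trans (hb' n s hs)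

/-- Splitting off the first term of the series and summing the others gives the integral equation of
the perturbed wave equation. -/
theorem picardSum_eq (G a b : 𝓢(E3, ℂ)) (p : ℝ × E3) :
    picardSum G a b p = freeEvol a b p + duhamel (freqConv G (picardSum G a b)) p := by
  rw [picardSum, (summable_norm_picardTerm G a b p).of_norm.tsum_eq_zero_add,
    (hasSum_duhamel_picardTerm G a b p).tsum_eq]
  rfl

/-- The time derivative of `picardSum`. -/
noncomputable def picardDeriv (G a b : 𝓢(E3, ℂ)) (p : ℝ × E3) : ℂ :=
  -((2 * Real.pi * ‖p.2‖) ^ 2 * sinProp p : ℝ) * a p.2 + cosProp p * b p.2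
    + duhamelDeriv (freqConv G (picardSum G a b)) p

theorem hasDerivAt_picardSum (G a b : 𝓢(E3, ℂ)) (t : ℝ) (ξ : E3) :
    HasDerivAt (fun s => picardSum G a b (s, ξ)) (picardDeriv G a b (t, ξ)) t := by
  have h1 := ((hasDerivAt_cosProp t ξ).ofReal_comp.mul_const (a ξ)).add
    ((hasDerivAt_sinProp t ξ).ofReal_comp.mul_const (b ξ))
  have h2 := h1.add (hasDerivAt_duhamel ((rapidDecay_picardSum G a b).freqConv G).cont t ξ)
  refine (h2.congr_deriv ?_).congr_of_eventuallyEq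
    (Eventually.of_forall fun s => picardSum_eq G a b (s, ξ))
  simp [picardDeriv]

/-- At fixed ξ this is the second order equation u'' = −(2π|ξ|)²u − G∗u; the convolution is the
Fourier side of the potential. -/
theorem hasDerivAt_picardDeriv (G a b : 𝓢(E3, ℂ)) (t : ℝ) (ξ : E3) :
    HasDerivAt (fun s => picardDeriv G a b (s, ξ))
      (-((2 * Real.pi * ‖ξ‖) ^ 2 : ℝ) * picardSum G a b (t, ξ)
        - freqConv G (picardSum G a b) (t, ξ)) t := by
  have h1 := ((((hasDerivAt_sinProp t ξ).const_mul ((2 * Real.pi * ‖ξ‖) ^ 2)).ofReal_comp.neg).mul_const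
    (a ξ)).add ((hasDerivAt_cosProp t ξ).ofReal_comp.mul_const (b ξ))
  have h2 := h1.add (hasDerivAt_duhamelDeriv ((rapidDecay_picardSum G a b).freqConv G).cont t ξ)
  refine h2.congr_deriv ?_
  rw [picardSum_eq G a b (t, ξ), freeEvol]
  push_cast
  ring

theorem rapidDecay_duhamelDeriv {h : ℝ × E3 → ℂ} (hh : RapidDecay h) :
    RapidDecay (duhamelDeriv h) where
  cont := continuous_duhamelDeriv hh.cont
  bound := by
    intro N k
    have hc := hh.cont
    -- Two additional powers of decay pay for the factor |ξ|² that the time derivative of the cosine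
    -- produces.
    obtain ⟨C, hC⟩ := hh.bound N (k + 2)
    refine ⟨(2 * Real.pi) ^ 2 * |N| * (|N| * C * |N|) + C * |N|, fun t ht ξ => ?_⟩
    have hN : 0 ≤ N := (abs_nonneg t).trans ht
    rw [abs_of_nonneg hN]
    have hC0 : 0 ≤ C := le_trans (by positivity) (hC t ht 0)
    have hpos : (0 : ℝ) < (1 + ‖ξ‖) ^ (k + 2) := by positivity
    have hb : ∀ s, |s| ≤ N → ‖h (s, ξ)‖ ≤ C / (1 + ‖ξ‖) ^ (k + 2) := fun s hs => by
      rw [le_div_iff₀' hpos]; exact hC s hs ξ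
    have h1 : ‖∫ s in (0 : ℝ)..t, sinProp (s, ξ) * h (s, ξ)‖
        ≤ (N * (C / (1 + ‖ξ‖) ^ (k + 2))) * N := by
      have := norm_integral_zero_le (F := fun s => sinProp (s, ξ) * h (s, ξ))
        (K := N * (C / (1 + ‖ξ‖) ^ (k + 2))) (t := t) 0 fun s hs => by
          rw [norm_mul, Complex.norm_real, pow_zero, mul_one]
          exact mul_le_mul ((abs_sinProp_le _).trans (hs.trans ht)) (hb s (hs.trans ht))
            (norm_nonneg _) hN
      refine this.trans ?_
      simp only [zero_add, pow_one, Nat.cast_zero, div_one]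
      gcongr
    have h2 : ‖∫ s in (0 : ℝ)..t, cosProp (s, ξ) * h (s, ξ)‖
        ≤ (C / (1 + ‖ξ‖) ^ (k + 2)) * N := by
      have := norm_integral_zero_le (F := fun s => cosProp (s, ξ) * h (s, ξ))
        (K := C / (1 + ‖ξ‖) ^ (k + 2)) (t := t) 0 fun s hs => by
          rw [norm_mul, Complex.norm_real, pow_zero, mul_one]
          exact (mul_le_of_le_one_left (norm_nonneg _) (abs_cosProp_le _)).trans
            (hb s (hs.trans ht))
      refine this.trans ?_
      simp only [zero_add, pow_one, Nat.cast_zero, div_one]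
      gcongr
    have h3 : ‖duhamelDeriv h (t, ξ)‖ ≤ ((2 * Real.pi * ‖ξ‖) ^ 2 * N) *
        ((N * (C / (1 + ‖ξ‖) ^ (k + 2))) * N) + 1 * ((C / (1 + ‖ξ‖) ^ (k + 2)) * N) := by
      refine (norm_sub_le _ _).trans (add_le_add ?_ ?_)
      · rw [norm_mul, norm_neg, Complex.norm_real, norm_mul, Real.norm_of_nonneg (by positivity),
          Real.norm_eq_abs]
        gcongr
        exact (abs_sinProp_le (t, ξ)).trans ht
      · rw [norm_mul, Complex.norm_real]
        gcongr
        exact abs_cosProp_le (t, ξ)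
    calc (1 + ‖ξ‖) ^ k * ‖duhamelDeriv h (t, ξ)‖
        ≤ (1 + ‖ξ‖) ^ k * (((2 * Real.pi * (1 + ‖ξ‖)) ^ 2 * N) *
        ((N * (C / (1 + ‖ξ‖) ^ (k + 2))) * N)
          + (1 + ‖ξ‖) ^ 2 * ((C / (1 + ‖ξ‖) ^ (k + 2)) * N)) := by
          gcongr
          refine h3.trans ?_
          gcongr
          · simp
          · exact one_le_pow₀ (by simp)
      _ = _ := by
          rw [pow_add]
          field_simp

theorem rapidDecay_picardDeriv (G a b : 𝓢(E3, ℂ)) : RapidDecay (picardDeriv G a b) := by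
  refine RapidDecay.add (RapidDecay.add ?_ ?_)
    (rapidDecay_duhamelDeriv ((rapidDecay_picardSum G a b).freqConv G))
  · refine (RapidDecay.of_schwartz a).mul_of_growth
      (m := fun p => -((2 * Real.pi * ‖p.2‖) ^ 2 * sinProp p : ℝ)) (by fun_prop) 2
      fun N => ⟨(2 * Real.pi) ^ 2 * N, fun t ht ξ => ?_⟩
    rw [norm_neg, Complex.norm_real, norm_mul, Real.norm_of_nonneg (by positivity),
      Real.norm_eq_abs]
    calc _ ≤ (2 * Real.pi * (1 + ‖ξ‖)) ^ 2 * N := by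
          gcongr
          · simp
          · exact (abs_sinProp_le (t, ξ)).trans ht
      _ = _ := by ring
  · refine (RapidDecay.of_schwartz b).mul_of_growth (m := fun p => cosProp p) (by fun_prop) 0
      fun N => ⟨1, fun t ht ξ => ?_⟩
    simpa using abs_cosProp_le (t, ξ)

end LogSharp

namespace LogSharp

open scoped SchwartzMap FourierTransform

/-! ### Synthesis: from frequency space to smooth functions on spacetime -/

/-- The character `e^{2πi⟨ξ, x⟩}`. -/
noncomputable def planeWave (ξ x : E3) : ℂ :=
  Complex.exp ((2 * Real.pi * inner ℝ ξ x : ℝ) * Complex.I)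

theorem norm_planeWave (ξ x : E3) : ‖planeWave ξ x‖ = 1 := Complex.norm_exp_ofReal_mul_I _

theorem continuous_planeWave : Continuous (fun p : E3 × E3 => planeWave p.1 p.2) := by
  unfold planeWave; fun_prop

theorem planeWave_add (ξ ζ x : E3) : planeWave (ξ + ζ) x = planeWave ξ x * planeWave ζ x := by
  rw [planeWave, planeWave, planeWave, ← Complex.exp_add, inner_add_left]
  push_cast
  ring_nf

/-- The inverse Fourier transform in the space variables. -/
noncomputable def synth (B : ℝ × E3 → ℂ) (p : M) : ℂ := ∫ ξ, planeWave ξ p.2 * B (p.1, ξ)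

/-- The linear map sending `c` to the form `v ↦ dt(v) c`. -/
noncomputable def timeForm : ℂ →L[ℝ] M →L[ℝ] ℂ :=
  ContinuousLinearMap.smulRightL ℝ M ℂ (ContinuousLinearMap.fst ℝ ℝ E3)

/-- The linear map sending `c` to the form `v ↦ dx_i(v) c`. -/
noncomputable def coordForm (i : Fin 3) : ℂ →L[ℝ] M →L[ℝ] ℂ :=
  ContinuousLinearMap.smulRightL ℝ M ℂ
    ((EuclideanSpace.proj i).comp (ContinuousLinearMap.snd ℝ ℝ E3))

theorem timeForm_apply (c : ℂ) (v : M) : timeForm c v = v.1 • c := rfl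

theorem coordForm_apply (i : Fin 3) (c : ℂ) (v : M) : coordForm i c v = v.2 i • c := rfl

/-- `2πi ξ_i B`, the Fourier side of `∂_i`. -/
noncomputable def freqDeriv (i : Fin 3) (B : ℝ × E3 → ℂ) (p : ℝ × E3) : ℂ :=
  2 * Real.pi * Complex.I * ((p.2 i : ℂ) * B p)

theorem RapidDecay.freqDeriv {B : ℝ × E3 → ℂ} (hB : RapidDecay B) (i : Fin 3) :
    RapidDecay (freqDeriv i B) := (hB.coord_mul i).const_mul _

theorem RapidDecay.continuous_integrand {B : ℝ × E3 → ℂ} (hB : RapidDecay B) (p : M) :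
    Continuous (fun ξ => planeWave ξ p.2 * B (p.1, ξ)) := by
  have h1 := hB.cont
  have h2 : Continuous (fun ξ => planeWave ξ p.2) :=
    continuous_planeWave.comp (continuous_id.prodMk continuous_const)
  fun_prop

theorem RapidDecay.integrable_integrand {B : ℝ × E3 → ℂ} (hB : RapidDecay B) (p : M) :
    Integrable (fun ξ => planeWave ξ p.2 * B (p.1, ξ)) := by
  refine (hB.integrable p.1).mono (hB.continuous_integrand p).aestronglyMeasurable
    (Eventually.of_forall fun ξ => ?_)
  rw [norm_mul, norm_planeWave, one_mul]

theorem hasFDerivAt_planeWave (ξ : E3) (p : M) :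
    HasFDerivAt (fun q : M => planeWave ξ q.2)
      (∑ i, coordForm i (2 * Real.pi * Complex.I * (ξ i : ℂ) * planeWave ξ p.2)) p := by
  have h1 : HasFDerivAt (fun q : M => inner ℝ ξ q.2)
      ((innerSL ℝ ξ).comp (ContinuousLinearMap.snd ℝ ℝ E3)) p :=
    ((innerSL ℝ ξ).comp (ContinuousLinearMap.snd ℝ ℝ E3)).hasFDerivAt
  have h2 := (((Complex.ofRealCLM.hasFDerivAt.comp p (h1.const_mul (2 * Real.pi))).mul_const
    Complex.I).cexp)
  refine h2.congr_fderiv (ContinuousLinearMap.ext fun v => ?_)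
  simp [coordForm_apply, planeWave, PiLp.inner_apply, Fin.sum_univ_three]
  ring

/-- Differentiation under the integral: a time derivative acts on B, a space derivative multiplies
it by 2πiξ_i, and the decay of order 4 of both supplies the integrable majorant. -/
theorem hasFDerivAt_synth {B B' : ℝ × E3 → ℂ} (hB : RapidDecay B) (hB' : RapidDecay B')
    (h : ∀ t ξ, HasDerivAt (fun s => B (s, ξ)) (B' (t, ξ)) t) (p : M) :
    HasFDerivAt (synth B) (timeForm (synth B' p) + ∑ i, coordForm i (synth (freqDeriv i B) p)) p := by
  obtain ⟨C, hC⟩ := hB'.bound (|p.1| + 1) 4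
  have hD := fun i => (hB.freqDeriv i).bound (|p.1| + 1) 4
  choose D hD using hD
  let F' : M → E3 → (M →L[ℝ] ℂ) := fun q ξ => timeForm (planeWave ξ q.2 * B' (q.1, ξ))
    + ∑ i, coordForm i (planeWave ξ q.2 * freqDeriv i B (q.1, ξ))
  have hs : {q : M | |q.1| < |p.1| + 1} ∈ 𝓝 p :=
    (isOpen_lt (by fun_prop) continuous_const).mem_nhds (by simp)
  have hcF' : Continuous (F' p) := by
    have h1 := hB'.continuous_integrand p
    have h2 := fun i => (hB.freqDeriv i).continuous_integrand p
    fun_prop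
  have key := hasFDerivAt_integral_of_dominated_of_fderiv_le (𝕜 := ℝ) (μ := volume)
    (F := fun (q : M) ξ => planeWave ξ q.2 * B (q.1, ξ)) (F' := F') (x₀ := p) hs
    (bound := fun ξ => (‖timeForm‖ * C + ∑ i, ‖coordForm i‖ * D i) * ((1 + ‖ξ‖) ^ 4)⁻¹)
    (Eventually.of_forall fun q => (hB.continuous_integrand q).aestronglyMeasurable)
    (hB.integrable_integrand p) hcF'.aestronglyMeasurable
    (Eventually.of_forall fun ξ q hq => ?_) (integrable_decay_bound.const_mul _)
    (Eventually.of_forall fun ξ q hq => ?_)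
  · refine key.congr_fderiv ?_
    have h1 := (hB'.integrable_integrand p)
    have h2 := fun i => ((hB.freqDeriv i).integrable_integrand p)
    rw [integral_add (timeForm.integrable_comp h1)
      (integrable_finsetSum _ fun i _ => (coordForm i).integrable_comp (h2 i)),
      integral_finsetSum _ fun i _ => (coordForm i).integrable_comp (h2 i),
      timeForm.integral_comp_comm h1]
    simp_rw [fun i => (coordForm i).integral_comp_comm (h2 i)]
    rfl
  · have hpos : (0 : ℝ) < (1 + ‖ξ‖) ^ 4 := by positivity
    have hle : ∀ (L : ℂ →L[ℝ] M →L[ℝ] ℂ) (w : ℂ) (E : ℝ), (1 + ‖ξ‖) ^ 4 * ‖w‖ ≤ E →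
        ‖L (planeWave ξ q.2 * w)‖ ≤ ‖L‖ * E * ((1 + ‖ξ‖) ^ 4)⁻¹ := fun L w E hE => by
      refine (L.le_opNorm _).trans ?_
      rw [norm_mul, norm_planeWave, one_mul, mul_assoc]
      gcongr
      rw [← div_eq_mul_inv, le_div_iff₀' hpos]
      exact hE
    refine (norm_add_le _ _).trans ?_
    rw [add_mul, Finset.sum_mul]
    exact add_le_add (hle _ _ _ (hC q.1 (le_of_lt hq) ξ))
      ((norm_sum_le _ _).trans (Finset.sum_le_sum fun i _ => hle _ _ _ (hD i q.1 (le_of_lt hq) ξ)))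
  · have h1 : HasFDerivAt (fun q : M => B (q.1, ξ)) (timeForm (B' (q.1, ξ))) q := by
      have := (h q.1 ξ).hasFDerivAt.comp q (hasFDerivAt_fst (𝕜 := ℝ) (p := q))
      refine this.congr_fderiv ?_
      ext v <;> simp [timeForm_apply]
    refine ((hasFDerivAt_planeWave ξ q).mul h1).congr_fderiv (ContinuousLinearMap.ext fun v => ?_)
    simp [F', timeForm_apply, coordForm_apply, freqDeriv, Fin.sum_univ_three]
    ring

/-- The functions generated by the Picard solution and its time derivative under multiplication by
coordinates and convolution with `G`. -/
inductive PicardFamily (G a b : 𝓢(E3, ℂ)) : (ℝ × E3 → ℂ) → Prop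
  | sum : PicardFamily G a b (picardSum G a b)
  | deriv : PicardFamily G a b (picardDeriv G a b)
  | coord (i : Fin 3) {B} : PicardFamily G a b B → PicardFamily G a b (freqDeriv i B)
  | conv {B} : PicardFamily G a b B → PicardFamily G a b (freqConv G B)
  | add {A B} : PicardFamily G a b A → PicardFamily G a b B → PicardFamily G a b (fun p => A p + B p)
  | smul (c : ℂ) {B} : PicardFamily G a b B → PicardFamily G a b (fun p => c * B p)

theorem PicardFamily.rapidDecay {G a b : 𝓢(E3, ℂ)} {B : ℝ × E3 → ℂ} (h : PicardFamily G a b B) :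
    RapidDecay B := by
  induction h with
  | sum => exact rapidDecay_picardSum G a b
  | deriv => exact rapidDecay_picardDeriv G a b
  | coord i _ ih => exact ih.freqDeriv i
  | conv _ ih => exact ih.freqConv G
  | add _ _ ih1 ih2 => exact ih1.add ih2
  | smul c _ ih => exact ih.const_mul c

theorem hasDerivAt_freqConv (G : 𝓢(E3, ℂ)) {B B' : ℝ × E3 → ℂ} (hB : RapidDecay B)
    (hB' : RapidDecay B') (h : ∀ t ξ, HasDerivAt (fun s => B (s, ξ)) (B' (t, ξ)) t) (t : ℝ) (ξ : E3) :
    HasDerivAt (fun s => freqConv G B (s, ξ)) (freqConv G B' (t, ξ)) t := by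
  obtain ⟨C, hC⟩ := hB'.bound (|t| + 1) 0
  obtain ⟨D, hD⟩ := hB.bound |t| 0
  have h1 := hB.cont
  have h2 := hB'.cont
  have hG := G.continuous
  have hGi : Integrable (fun ζ => ‖G ζ‖) := by simpa using integrable_weighted G 0
  have hs : {s : ℝ | |s| < |t| + 1} ∈ 𝓝 t :=
    (isOpen_lt (by fun_prop) continuous_const).mem_nhds (by simp)
  refine (hasDerivAt_integral_of_dominated_loc_of_deriv_le (μ := volume)
    (F := fun s ζ => G ζ * B (s, ξ - ζ)) (F' := fun s ζ => G ζ * B' (s, ξ - ζ)) hs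
    (bound := fun ζ => ‖G ζ‖ * C)
    (Eventually.of_forall fun s => Continuous.aestronglyMeasurable (by fun_prop))
    ?_ (Continuous.aestronglyMeasurable (by fun_prop))
    (Eventually.of_forall fun ζ s hs => ?_) (hGi.mul_const C)
    (Eventually.of_forall fun ζ s hs => (h s (ξ - ζ)).const_mul _)).2
  · refine (hGi.mul_const D).mono' (Continuous.aestronglyMeasurable (by fun_prop))
      (Eventually.of_forall fun ζ => ?_)
    rw [norm_mul]
    gcongr
    simpa using hD t le_rfl (ξ - ζ)
  · rw [norm_mul]
    gcongr
    simpa using hC s (le_of_lt hs) (ξ - ζ)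

theorem freqDeriv_freqDeriv_sum (B : ℝ × E3 → ℂ) (p : ℝ × E3) :
    ∑ i, freqDeriv i (freqDeriv i B) p = -((2 * Real.pi * ‖p.2‖) ^ 2 : ℝ) * B p := by
  have : ‖p.2‖ ^ 2 = ∑ i, (p.2 i) ^ 2 := by simp [EuclideanSpace.norm_sq_eq]
  rw [mul_pow, this]
  simp only [freqDeriv, Fin.sum_univ_three]
  push_cast
  linear_combination (4 * Real.pi ^ 2 * ((p.2 0 : ℂ) ^ 2 + (p.2 1 : ℂ) ^ 2 + (p.2 2 : ℂ) ^ 2) * B p)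
    * Complex.I_sq

/-- The family is closed under time derivatives because the equation expresses the derivative of
`picardDeriv` through the second coordinate multipliers and one convolution. -/
theorem PicardFamily.exists_deriv {G a b : 𝓢(E3, ℂ)} {B : ℝ × E3 → ℂ} (h : PicardFamily G a b B) :
    ∃ B', PicardFamily G a b B' ∧ ∀ t ξ, HasDerivAt (fun s => B (s, ξ)) (B' (t, ξ)) t := by
  induction h with
  | sum => exact ⟨_, .deriv, hasDerivAt_picardSum G a b⟩
  | deriv =>
    have hA : PicardFamily G a b (picardSum G a b) := .sum
    refine ⟨_, ((((hA.coord 0).coord 0).add ((hA.coord 1).coord 1)).add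
      ((hA.coord 2).coord 2)).add (hA.conv.smul (-1)), fun t ξ => ?_⟩
    refine (hasDerivAt_picardDeriv G a b t ξ).congr_deriv ?_
    rw [← freqDeriv_freqDeriv_sum (picardSum G a b) (t, ξ), Fin.sum_univ_three]
    ring
  | coord i _ ih =>
    obtain ⟨B', h1, h2⟩ := ih
    exact ⟨_, h1.coord i, fun t ξ =>
      ((h2 t ξ).const_mul (ξ i : ℂ)).const_mul (2 * Real.pi * Complex.I)⟩
  | conv h ih =>
    obtain ⟨B', h1, h2⟩ := ih
    exact ⟨_, h1.conv, hasDerivAt_freqConv G h.rapidDecay h1.rapidDecay h2⟩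
  | add _ _ ih1 ih2 =>
    obtain ⟨A', h1, h2⟩ := ih1
    obtain ⟨B', h3, h4⟩ := ih2
    exact ⟨_, h1.add h3, fun t ξ => (h2 t ξ).add (h4 t ξ)⟩
  | smul c _ ih =>
    obtain ⟨B', h1, h2⟩ := ih
    exact ⟨_, h1.smul c, fun t ξ => (h2 t ξ).const_mul _⟩

/-- The first derivatives of a synthesized member are syntheses of members again, so smoothness
follows by induction on the order, for the whole family at once. -/
theorem PicardFamily.contDiff_synth {G a b : 𝓢(E3, ℂ)} {B : ℝ × E3 → ℂ}
    (h : PicardFamily G a b B) : ContDiff ℝ ∞ (synth B) := by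
  rw [contDiff_infty]
  intro n
  induction n generalizing B with
  | zero =>
    obtain ⟨B', h1, h2⟩ := h.exists_deriv
    rw [Nat.cast_zero, contDiff_zero, continuous_iff_continuousAt]
    exact fun p => (hasFDerivAt_synth h.rapidDecay h1.rapidDecay h2 p).continuousAt
  | succ n ih =>
    obtain ⟨B', h1, h2⟩ := h.exists_deriv
    rw [Nat.cast_succ, contDiff_succ_iff_hasFDerivAt]
    refine ⟨_, ?_, hasFDerivAt_synth h.rapidDecay h1.rapidDecay h2⟩
    exact (timeForm.contDiff.comp (ih h1)).add
      (ContDiff.sum fun i _ => (coordForm i).contDiff.comp (ih (h.coord i)))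

/-- The convolution theorem: Fubini, multiplicativity of the characters and translation invariance.
-/
theorem synth_freqConv (G : 𝓢(E3, ℂ)) {B : ℝ × E3 → ℂ} (hB : RapidDecay B) (p : M) :
    synth (freqConv G B) p = (∫ ξ, planeWave ξ p.2 * G ξ) * synth B p := by
  obtain ⟨C, hC⟩ := hB.bound |p.1| 4
  have hc := hB.cont
  have hG := G.continuous
  have hw : Continuous (fun ξ => planeWave ξ p.2) :=
    continuous_planeWave.comp (continuous_id.prodMk continuous_const)
  have hGi : Integrable (fun ζ => planeWave ζ p.2 * G ζ) :=
    (RapidDecay.of_schwartz G).integrable_integrand p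
  have hBi := hB.integrable_integrand p
  have hprod : Integrable (fun z : E3 × E3 =>
      (planeWave z.2 p.2 * G z.2) * (planeWave (z.1 - z.2) p.2 * B (p.1, z.1 - z.2)))
      (volume.prod volume) := hGi.convolution_integrand (ContinuousLinearMap.mul ℝ ℂ) hBi
  have hpw : ∀ ξ ζ : E3, planeWave ξ p.2 = planeWave ζ p.2 * planeWave (ξ - ζ) p.2 := fun ξ ζ => by
    rw [← planeWave_add]; simp
  have h1 : ∀ ξ, planeWave ξ p.2 * freqConv G B (p.1, ξ)
      = ∫ ζ, (planeWave ζ p.2 * G ζ) * (planeWave (ξ - ζ) p.2 * B (p.1, ξ - ζ)) := fun ξ => by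
    rw [freqConv, ← integral_const_mul]
    congr 1
    ext ζ
    rw [hpw ξ ζ]
    ring
  simp_rw [synth, h1]
  rw [integral_integral_swap (f := fun ξ ζ => (planeWave ζ p.2 * G ζ) *
    (planeWave (ξ - ζ) p.2 * B (p.1, ξ - ζ))) hprod, ← integral_mul_const]
  congr 1
  ext ζ
  rw [integral_const_mul]
  congr 1
  exact integral_sub_right_eq_self (fun ξ => planeWave ξ p.2 * B (p.1, ξ)) ζ

theorem planeWave_integral_fourier (f : 𝓢(E3, ℂ)) (x : E3) :
    ∫ ξ, planeWave ξ x * (𝓕 f) ξ = f x := by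
  have h : 𝓕⁻ (𝓕 f) = f := FourierTransform.fourierInv_fourier_eq f
  have h2 : (𝓕⁻ (𝓕 f) : 𝓢(E3, ℂ)) x = f x := by rw [h]
  rw [← h2, SchwartzMap.fourierInv_coe, Real.fourierInv_eq']
  simp [planeWave]

/-- Existence for the flat wave equation with a smooth, compactly supported potential. -/
theorem exists_wave_solution {Q q₀ q₁ : E3 → ℂ} (hQ : ContDiff ℝ ∞ Q) (hQc : HasCompactSupport Q)
    (h₀ : ContDiff ℝ ∞ q₀) (h₀c : HasCompactSupport q₀) (h₁ : ContDiff ℝ ∞ q₁)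
    (h₁c : HasCompactSupport q₁) :
    ∃ u : M → ℂ, ContDiff ℝ ∞ u ∧ (∀ x, u (0, x) = q₀ x) ∧
      (∀ x, pd (Sum.inl ()) u (0, x) = q₁ x) ∧
      ∀ p, pd (Sum.inl ()) (pd (Sum.inl ()) u) p
        = ∑ i, pd (Sum.inr i) (pd (Sum.inr i) u) p - Q p.2 * u p := by
  let Qs : 𝓢(E3, ℂ) := hQc.toSchwartzMap hQ
  let as : 𝓢(E3, ℂ) := h₀c.toSchwartzMap h₀
  let bs : 𝓢(E3, ℂ) := h₁c.toSchwartzMap h₁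
  let G := 𝓕 Qs
  let a := 𝓕 as
  let b := 𝓕 bs
  have pd_time : ∀ {B B' : ℝ × E3 → ℂ}, PicardFamily G a b B → PicardFamily G a b B' →
      (∀ t ξ, HasDerivAt (fun s => B (s, ξ)) (B' (t, ξ)) t) →
      pd (Sum.inl ()) (synth B) = synth B' := fun hB hB' h => by
    ext p
    rw [pd, (hasFDerivAt_synth hB.rapidDecay hB'.rapidDecay h p).fderiv]
    simp [e, timeForm_apply, coordForm_apply]
  have pd_space : ∀ {B : ℝ × E3 → ℂ} (i : Fin 3), PicardFamily G a b B →
      pd (Sum.inr i) (synth B) = synth (freqDeriv i B) := fun i hB => by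
    obtain ⟨B', hB', h⟩ := hB.exists_deriv
    ext p
    rw [pd, (hasFDerivAt_synth hB.rapidDecay hB'.rapidDecay h p).fderiv]
    simp [e, timeForm_apply, coordForm_apply]
  have hA : PicardFamily G a b (picardSum G a b) := .sum
  have hA' : PicardFamily G a b (picardDeriv G a b) := .deriv
  refine ⟨synth (picardSum G a b), hA.contDiff_synth, fun x => ?_, fun x => ?_, fun p => ?_⟩
  · have h : ∀ ξ, picardSum G a b (0, ξ) = a ξ := fun ξ => by
      rw [picardSum_eq]
      simp [freeEvol, duhamel, cosProp, sinProp]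
    simp only [synth, h]
    exact planeWave_integral_fourier as x
  · have h : ∀ ξ, picardDeriv G a b (0, ξ) = b ξ := fun ξ => by
      simp [picardDeriv, duhamelDeriv, cosProp, sinProp]
    rw [pd_time hA hA' (hasDerivAt_picardSum G a b)]
    simp only [synth, h]
    exact planeWave_integral_fourier bs x
  · rw [pd_time hA hA' (hasDerivAt_picardSum G a b)]
    have h2 : PicardFamily G a b _ := ((((hA.coord 0).coord 0).add ((hA.coord 1).coord 1)).add
      ((hA.coord 2).coord 2)).add (hA.conv.smul (-1))
    rw [pd_time hA' h2 fun t ξ => ?_]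
    · simp_rw [fun i => pd_space i hA, fun i => pd_space i (hA.coord i)]
      have hi := fun i => ((hA.coord i).coord i).rapidDecay.integrable_integrand p
      have hc := hA.conv.rapidDecay.integrable_integrand p
      have hQp : Q p.2 * synth (picardSum G a b) p = synth (freqConv G (picardSum G a b)) p := by
        rw [synth_freqConv G hA.rapidDecay, planeWave_integral_fourier Qs]
        rfl
      rw [hQp, Fin.sum_univ_three]
      simp only [synth]
      rw [← integral_add (hi 0) (hi 1), ← integral_add (by exact (hi 0).add (hi 1)) (hi 2),
        ← integral_sub (by exact ((hi 0).add (hi 1)).add (hi 2)) hc]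
      congr 1
      ext ξ
      ring
    · refine (hasDerivAt_picardDeriv G a b t ξ).congr_deriv ?_
      rw [← freqDeriv_freqDeriv_sum (picardSum G a b) (t, ξ), Fin.sum_univ_three]
      ring

end LogSharp

namespace LogSharp

/-! ### The algebra of smooth functions on spacetime and its derivations -/

/-- The algebra of smooth complex functions on spacetime. -/
def Sm : Subalgebra ℂ (M → ℂ) where
  carrier := {u | ContDiff ℝ ∞ u}
  mul_mem' := fun ha hb => ContDiff.mul (𝕜 := ℝ) (n := ∞) ha hb
  add_mem' := fun ha hb => ContDiff.add (𝕜 := ℝ) (n := ∞) ha hb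
  algebraMap_mem' := fun c => (contDiff_const : ContDiff ℝ ∞ fun _ : M => c)

theorem Sm.contDiff (u : Sm) : ContDiff ℝ ∞ (u : M → ℂ) := u.2

theorem Sm.differentiable (u : Sm) : Differentiable ℝ (u : M → ℂ) :=
  (Sm.contDiff u).differentiable (by simp)

theorem Sm.continuous (u : Sm) : Continuous (u : M → ℂ) := (Sm.contDiff u).continuous

theorem contDiff_pd {u : M → ℂ} (hu : ContDiff ℝ ∞ u) (μ : Ix) : ContDiff ℝ ∞ (pd μ u) :=
  (hu.fderiv_right (m := ∞) (by simp)).clm_apply contDiff_const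

/-- The coordinate derivations of the algebra of smooth functions. -/
noncomputable def dd (μ : Ix) : Derivation ℂ Sm Sm where
  toFun u := ⟨pd μ u, contDiff_pd (Sm.contDiff u) μ⟩
  map_add' u v := by
    ext p
    change fderiv ℝ ((u : M → ℂ) + (v : M → ℂ)) p (e μ) = _
    rw [fderiv_add (Sm.differentiable u).differentiableAt (Sm.differentiable v).differentiableAt]
    rfl
  map_smul' c u := by
    ext p
    change fderiv ℝ (c • (u : M → ℂ)) p (e μ) = _
    rw [fderiv_const_smul (Sm.differentiable u).differentiableAt]
    rfl
  map_one_eq_zero' := by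
    ext p
    change fderiv ℝ (fun _ => (1 : ℂ)) p (e μ) = 0
    simp
  leibniz' u v := by
    ext p
    change fderiv ℝ ((u : M → ℂ) * (v : M → ℂ)) p (e μ) = _
    rw [fderiv_mul (Sm.differentiable u).differentiableAt (Sm.differentiable v).differentiableAt]
    rfl

theorem dd_apply (μ : Ix) (u : Sm) (p : M) : (dd μ u : M → ℂ) p = pd μ u p := rfl

theorem dd_comm (μ ν : Ix) (u : Sm) : dd μ (dd ν u) = dd ν (dd μ u) := by
  have key : ∀ μ ν : Ix, ∀ p, (dd μ (dd ν u) : M → ℂ) p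
      = fderiv ℝ (fderiv ℝ (u : M → ℂ)) p (e μ) (e ν) := fun μ ν p => by
    change fderiv ℝ (fun q => fderiv ℝ (u : M → ℂ) q (e ν)) p (e μ) = _
    have h : DifferentiableAt ℝ (fderiv ℝ (u : M → ℂ)) p :=
      (((Sm.contDiff u).fderiv_right (m := ∞) (by simp)).differentiable (by simp)).differentiableAt
    rw [fderiv_clm_apply h (differentiableAt_const _)]
    simp
  ext p
  rw [key, key]
  exact ((Sm.contDiff u).contDiffAt.isSymmSndFDerivAt (by rw [minSmoothness_of_isRCLikeNormedField]; exact WithTop.coe_le_coe.2 le_top)).eq _ _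

/-- The time derivative. -/
noncomputable abbrev dt : Derivation ℂ Sm Sm := dd (Sum.inl ())

/-- The space derivatives. -/
noncomputable abbrev dx (i : Fin 3) : Derivation ℂ Sm Sm := dd (Sum.inr i)

theorem dx_comm_one_zero (u : Sm) : dx 1 (dx 0 u) = dx 0 (dx 1 u) := dd_comm _ _ u
theorem dx_comm_two_zero (u : Sm) : dx 2 (dx 0 u) = dx 0 (dx 2 u) := dd_comm _ _ u
theorem dx_comm_two_one (u : Sm) : dx 2 (dx 1 u) = dx 1 (dx 2 u) := dd_comm _ _ u
theorem dt_dx (i : Fin 3) (u : Sm) : dt (dx i u) = dx i (dt u) := dd_comm _ _ u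

/-- The space coordinates. -/
noncomputable def X (i : Fin 3) : Sm := ⟨fun p => (p.2 i : ℂ), by
  have : ContDiff ℝ ∞ (fun p : M => p.2 i) :=
    ((EuclideanSpace.proj (𝕜 := ℝ) i).comp (ContinuousLinearMap.snd ℝ ℝ E3)).contDiff
  exact Complex.ofRealCLM.contDiff.comp this⟩

theorem X_apply (i : Fin 3) (p : M) : (X i : M → ℂ) p = (p.2 i : ℂ) := rfl

theorem pd_X (μ : Ix) (i : Fin 3) (p : M) : pd μ (X i) p = ((e μ).2 i : ℂ) := by
  have h : HasFDerivAt (X i : M → ℂ)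
      (Complex.ofRealCLM.comp ((EuclideanSpace.proj i).comp (ContinuousLinearMap.snd ℝ ℝ E3))) p :=
    (Complex.ofRealCLM.comp ((EuclideanSpace.proj (𝕜 := ℝ) i).comp
      (ContinuousLinearMap.snd ℝ ℝ E3))).hasFDerivAt
  rw [pd, h.fderiv]
  simp

theorem dt_X (i : Fin 3) : dt (X i) = 0 := by
  ext p
  rw [dd_apply, pd_X]
  simp [e]

theorem dx_X (i j : Fin 3) : dx i (X j) = if i = j then 1 else 0 := by
  ext p
  rw [dd_apply, pd_X]
  by_cases h : i = j
  · subst h; simp [e]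
  · simp [e, h, Ne.symm h]

/-! ### Polar decomposition of the flat operators, and radial functions. -/

/-- `|x|²`. -/
noncomputable def R2 : Sm := ∑ i, X i * X i

/-- The radial derivation `x · ∇`. -/
noncomputable def Eu : Derivation ℂ Sm Sm := ∑ i, X i • dx i

/-- The rotations `x_a ∂_b - x_b ∂_a`. -/
noncomputable def rot (a b : Fin 3) : Derivation ℂ Sm Sm := X a • dx b - X b • dx a

/-- The flat Laplacian. -/
noncomputable def lap (u : Sm) : Sm := ∑ i, dx i (dx i u)

/-- The Laplacian of the unit sphere. -/
noncomputable def sphLap (u : Sm) : Sm :=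
  rot 0 1 (rot 0 1 u) + rot 0 2 (rot 0 2 u) + rot 1 2 (rot 1 2 u)

/-- The operator `div ((1 + κ x xᵀ) ∇u)`. -/
noncomputable def ellOp (κ u : Sm) : Sm := ∑ i, dx i (dx i u + κ * X i * Eu u)

/-- The bilinear form `⟨(1 + κ x xᵀ) ∇u, ∇v⟩`. -/
noncomputable def gradForm (κ u v : Sm) : Sm := ∑ i, dx i u * dx i v + κ * Eu u * Eu v

theorem Eu_apply (u : Sm) : Eu u = X 0 * dx 0 u + X 1 * dx 1 u + X 2 * dx 2 u := by
  simp [Eu, Fin.sum_univ_three, Derivation.coe_add]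

theorem rot_apply (a b : Fin 3) (u : Sm) : rot a b u = X a * dx b u - X b * dx a u := by
  simp [rot]

/-- This is r²Δ = (r∂_r)² + r∂_r + Δ_{S²}, multiplied by r² so that it holds at the origin as well.
-/
theorem R2_mul_lap (u : Sm) : R2 * lap u = Eu (Eu u) + Eu u + sphLap u := by
  simp only [R2, lap, sphLap, Eu_apply, rot_apply, Fin.sum_univ_three, map_add, map_sub,
    Derivation.leibniz, smul_eq_mul, dx_X, dx_comm_one_zero, dx_comm_two_zero, dx_comm_two_one]
  simp
  ring

/-- Rotations are Euclidean isometries and commute with the Laplacian; this will carry the spherical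
eigenvalue through the evolution. -/
theorem rot_lap (a b : Fin 3) (hab : a ≠ b) (u : Sm) : rot a b (lap u) = lap (rot a b u) := by
  fin_cases a <;> fin_cases b <;> first | exact absurd rfl hab | skip
  all_goals
    simp only [Fin.zero_eta, Fin.mk_one, Fin.reduceFinMk, lap, rot_apply, Fin.sum_univ_three,
      map_add, map_sub,
      Derivation.leibniz, smul_eq_mul, dx_X, dx_comm_one_zero, dx_comm_two_zero, dx_comm_two_one]
    simp
    ring

theorem lap_add (u v : Sm) : lap (u + v) = lap u + lap v := by simp [lap, Finset.sum_add_distrib]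

theorem sphLap_lap (u : Sm) : sphLap (lap u) = lap (sphLap u) := by
  simp only [sphLap, lap_add, rot_lap _ _ (by decide : (0 : Fin 3) ≠ 1),
    rot_lap _ _ (by decide : (0 : Fin 3) ≠ 2), rot_lap _ _ (by decide : (1 : Fin 3) ≠ 2)]

/-- A function annihilated by all rotations. -/
def IsRadial (u : Sm) : Prop := ∀ a b, rot a b u = 0

theorem IsRadial.sphLap_mul {κ : Sm} (h : IsRadial κ) (u : Sm) : sphLap (κ * u) = κ * sphLap u := by
  simp only [sphLap, Derivation.leibniz, h _ _, smul_eq_mul, mul_zero, add_zero, mul_add]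

theorem IsRadial.mul {u v : Sm} (hu : IsRadial u) (hv : IsRadial v) : IsRadial (u * v) :=
  fun a b => by simp [Derivation.leibniz, hu a b, hv a b]

theorem IsRadial.sub {u v : Sm} (hu : IsRadial u) (hv : IsRadial v) : IsRadial (u - v) :=
  fun a b => by simp [hu a b, hv a b]

theorem IsRadial.lap {u : Sm} (hu : IsRadial u) : IsRadial (lap u) := fun a b => by
  by_cases hab : a = b
  · subst hab; simp [rot_apply]
  · rw [rot_lap a b hab, hu a b]; simp [LogSharp.lap]

theorem IsRadial.of_mul_eq_one {u v : Sm} (hu : IsRadial u) (h : u * v = 1) : IsRadial v :=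
  fun a b => by
    have h1 : rot a b (u * v) = 0 := by rw [h]; exact Derivation.map_one_eq_zero _
    rw [Derivation.leibniz, hu a b, smul_zero, add_zero, smul_eq_mul] at h1
    have : v * (u * rot a b v) = 0 := by rw [h1, mul_zero]
    rwa [← mul_assoc, mul_comm v u, h, one_mul] at this

/-- The gradient of a radial function is radial: the three equations x_a∂_b u = x_b∂_a u determine
it. -/
theorem IsRadial.R2_mul_dx {u : Sm} (hu : IsRadial u) (i : Fin 3) : R2 * dx i u = X i * Eu u := by
  have h01 := hu 0 1
  have h02 := hu 0 2
  have h12 := hu 1 2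
  rw [rot_apply] at h01 h02 h12
  rw [Eu_apply, R2, Fin.sum_univ_three]
  fin_cases i
  · change _ * dx 0 u = X 0 * _
    linear_combination -(X 1) * h01 - (X 2) * h02
  · change _ * dx 1 u = X 1 * _
    linear_combination (X 0) * h01 - (X 2) * h12
  · change _ * dx 2 u = X 2 * _
    linear_combination (X 0) * h02 + (X 1) * h12

/-! ### The spatial operator, its energy identity and its form on a spherical mode. -/

theorem ellOp_eq (κ u : Sm) :
    ellOp κ u = lap u + κ * (Eu (Eu u) + 3 * Eu u) + Eu κ * Eu u := by
  simp only [ellOp, lap, Eu_apply, Fin.sum_univ_three, map_add,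
    Derivation.leibniz, smul_eq_mul, dx_X, dx_comm_one_zero, dx_comm_two_zero, dx_comm_two_one]
  simp
  ring

/-- The Leibniz rule for a symmetric second order operator without zeroth order term; the cutoff
error of the quasimode is read off from it. -/
theorem ellOp_mul (κ φ u : Sm) :
    ellOp κ (φ * u) = φ * ellOp κ u + u * ellOp κ φ + 2 * gradForm κ φ u := by
  simp only [ellOp_eq, lap, gradForm, Fin.sum_univ_three, map_add,
    Derivation.leibniz, smul_eq_mul]
  ring

theorem ellOp_add (κ u v : Sm) : ellOp κ (u + v) = ellOp κ u + ellOp κ v := by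
  simp only [ellOp_eq, lap_add, map_add]
  ring

theorem ellOp_smul (κ u : Sm) (c : ℂ) : ellOp κ (c • u) = c • ellOp κ u := by
  simp only [ellOp, Derivation.map_smul, ← smul_add, Finset.smul_sum, mul_smul_comm]

theorem dt_ellOp {κ : Sm} (h : dt κ = 0) (u : Sm) : dt (ellOp κ u) = ellOp κ (dt u) := by
  simp only [ellOp, Eu_apply, Fin.sum_univ_three, map_add, dt_dx, Derivation.leibniz, smul_eq_mul,
    dt_X, h, mul_zero, add_zero, map_zero]
  ring

/-- The energy flux. -/
noncomputable def flux (κ u v : Sm) (i : Fin 3) : Sm :=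
  dt v * (dx i u + κ * X i * Eu u) + dt u * (dx i v + κ * X i * Eu v)

/-- The polarized energy density. -/
noncomputable def energyForm (ρ κ u v : Sm) : Sm := ρ * dt u * dt v + gradForm κ u v

/-- Local energy balance. The form is bilinear rather than sesquilinear, so that it is a ring
identity; later v is the conjugate of u. -/
theorem dt_energyForm {ρ κ : Sm} (hρ : dt ρ = 0) (hκ : dt κ = 0) (u v : Sm) :
    dt (energyForm ρ κ u v) = (ρ * dt (dt u) - ellOp κ u) * dt v
      + dt u * (ρ * dt (dt v) - ellOp κ v) + ∑ i, dx i (flux κ u v i) := by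
  simp only [energyForm, gradForm, ellOp, flux, Eu_apply, Fin.sum_univ_three, map_add, dt_dx,
    Derivation.leibniz, smul_eq_mul, dt_X, hρ, hκ]
  simp
  ring

/-- Multiplication by `μ = √ρ` turns the wave equation on a spherical mode into a flat wave
equation with potential. -/
theorem ellOp_of_mode {κ μ ν : Sm} {c : ℂ} (hκ : IsRadial κ) (hμ : IsRadial μ) (hμν : μ * ν = 1)
    (hρ : 1 + R2 * κ = μ * μ) {u : Sm} (hu : sphLap u = -c • u) :
    ellOp κ (ν * u) = μ * (lap u - (ν * lap μ - c • (κ * ν * ν)) * u) := by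
  have hν := hμ.of_mul_eq_one hμν
  obtain ⟨v, rfl⟩ : ∃ v, u = μ * v := ⟨ν * u, by rw [← mul_assoc, hμν, one_mul]⟩
  have hv : sphLap v = -c • v := by
    have h1 := hν.sphLap_mul (μ * v)
    rwa [hu, mul_smul_comm, ← mul_assoc, mul_comm ν, hμν, one_mul] at h1
  rw [← mul_assoc ν, mul_comm ν, hμν, one_mul, ellOp_eq]
  have h2 := R2_mul_lap v
  rw [hv] at h2
  -- Differentiate 1 + r²κ = μ² and use that the gradient of κ is radial.
  have hd : ∀ i, 2 * μ * dx i μ = X i * (2 * κ + Eu κ) := fun i => by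
    have h3 := congrArg (dx i) hρ
    have h4 := hκ.R2_mul_dx i
    have h5 : dx i R2 = 2 * X i := by
      simp only [R2, Fin.sum_univ_three, map_add, Derivation.leibniz, smul_eq_mul, dx_X]
      fin_cases i <;> simp <;> ring
    simp only [map_add, Derivation.leibniz, smul_eq_mul, h5, Derivation.map_one_eq_zero] at h3
    linear_combination -h3 + h4
  -- By the formula for μ∂_iμ, the cross term of μΔ(μv) is exactly the first order part of the
  -- operator; this is why √ρ is the right multiplier.
  have hl : μ * lap (μ * v) = μ * μ * lap v + (2 * κ + Eu κ) * Eu v + μ * v * lap μ := by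
    have : μ * lap (μ * v) = μ * μ * lap v + ∑ i, 2 * μ * dx i μ * dx i v + μ * v * lap μ := by
      simp only [lap, Fin.sum_univ_three, map_add, Derivation.leibniz, smul_eq_mul]
      ring
    rw [this]
    simp only [hd, Eu_apply v, Fin.sum_univ_three]
    ring
  have hc : (-c • v : Sm) = -(algebraMap ℂ Sm c * v) := by rw [neg_smul, Algebra.smul_def]
  rw [hc] at h2
  rw [Algebra.smul_def c (κ * ν * ν)]
  linear_combination -hl - κ * h2 + lap v * hρ
    + (μ * v * lap μ - algebraMap ℂ Sm c * κ * v * (1 + μ * ν)) * hμν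

/-- Complex conjugation of smooth functions. -/
noncomputable def cj : Sm →+* Sm where
  toFun u := ⟨fun p => (starRingEnd ℂ) ((u : M → ℂ) p), Complex.conjCLE.contDiff.comp (Sm.contDiff u)⟩
  map_one' := by ext p; simp
  map_mul' u v := by ext p; simp
  map_zero' := by ext p; simp
  map_add' u v := by ext p; simp

theorem cj_apply (u : Sm) (p : M) : (cj u : M → ℂ) p = (starRingEnd ℂ) ((u : M → ℂ) p) := rfl

theorem dd_cj (μ : Ix) (u : Sm) : dd μ (cj u) = cj (dd μ u) := by
  ext p
  have h : HasFDerivAt (cj u : M → ℂ)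
      ((Complex.conjCLE : ℂ →L[ℝ] ℂ).comp (fderiv ℝ (u : M → ℂ) p)) p :=
    (Complex.conjCLE : ℂ →L[ℝ] ℂ).hasFDerivAt.comp p (Sm.differentiable u).differentiableAt.hasFDerivAt
  rw [dd_apply, pd, h.fderiv]
  rfl

theorem cj_X (i : Fin 3) : cj (X i) = X i := by
  ext p
  simp [cj_apply, X_apply]

theorem Eu_cj (u : Sm) : Eu (cj u) = cj (Eu u) := by
  simp only [Eu_apply, dd_cj, map_add, map_mul, cj_X]

theorem ellOp_cj {κ : Sm} (h : cj κ = κ) (u : Sm) : ellOp κ (cj u) = cj (ellOp κ u) := by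
  simp only [ellOp, Eu_cj, map_sum, ← dd_cj, map_add, map_mul, cj_X, h]

/-! ### Functions vanishing on the initial slice. -/

/-- The functions vanishing on the initial slice. -/
def VanishAtZero (u : Sm) : Prop := ∀ x, (u : M → ℂ) (0, x) = 0

/-- The fields ∂_i are tangent to the slice, so equality of data passes to all spatial derivatives.
-/
theorem VanishAtZero.dx {u : Sm} (h : VanishAtZero u) (i : Fin 3) : VanishAtZero (dx i u) :=
  fun x => by
    have h1 : HasFDerivAt (fun y : E3 => ((0 : ℝ), y)) (ContinuousLinearMap.inr ℝ ℝ E3) x :=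
      hasFDerivAt_prodMk_right 0 x
    have h2 := ((Sm.differentiable u).differentiableAt (x := (0, x))).hasFDerivAt.comp x h1
    have h3 : (fun y => (u : M → ℂ) (0, y)) = fun _ => 0 := funext h
    have h4 := h2.fderiv
    change fderiv ℝ (fun y => (u : M → ℂ) (0, y)) x = _ at h4
    rw [h3] at h4
    have h5 := congrArg (fun L => L (EuclideanSpace.single i (1 : ℝ))) h4
    simp at h5
    rw [dd_apply, pd]
    exact h5.symm

theorem VanishAtZero.add {u v : Sm} (hu : VanishAtZero u) (hv : VanishAtZero v) :
    VanishAtZero (u + v) := fun x => by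
  change (u : M → ℂ) (0, x) + (v : M → ℂ) (0, x) = 0
  rw [hu x, hv x, add_zero]

theorem VanishAtZero.mul_left {u : Sm} (hu : VanishAtZero u) (v : Sm) : VanishAtZero (v * u) :=
  fun x => by
  change (v : M → ℂ) (0, x) * (u : M → ℂ) (0, x) = 0
  rw [hu x, mul_zero]

theorem VanishAtZero.smul {u : Sm} (hu : VanishAtZero u) (c : ℂ) : VanishAtZero (c • u) := fun x => by
  change c • (u : M → ℂ) (0, x) = 0
  rw [hu x, smul_zero]

theorem VanishAtZero.neg {u : Sm} (hu : VanishAtZero u) : VanishAtZero (-u) := fun x => by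
  change -(u : M → ℂ) (0, x) = 0
  rw [hu x, neg_zero]

theorem VanishAtZero.sub {u v : Sm} (hu : VanishAtZero u) (hv : VanishAtZero v) :
    VanishAtZero (u - v) := by
  rw [sub_eq_add_neg]; exact hu.add hv.neg

theorem VanishAtZero.sum {ι : Type*} {s : Finset ι} {u : ι → Sm} (h : ∀ i ∈ s, VanishAtZero (u i)) :
    VanishAtZero (∑ i ∈ s, u i) := by
  classical
  induction s using Finset.induction_on with
  | empty => intro x; simp
  | insert i s hi ih =>
    rw [Finset.sum_insert hi]
    exact (h i (Finset.mem_insert_self i s)).add (ih fun j hj => h j (Finset.mem_insert_of_mem hj))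

theorem VanishAtZero.Eu {u : Sm} (hu : VanishAtZero u) : VanishAtZero (Eu u) := by
  rw [Eu_apply]
  exact (((hu.dx 0).mul_left _).add ((hu.dx 1).mul_left _)).add ((hu.dx 2).mul_left _)

theorem VanishAtZero.rot {u : Sm} (hu : VanishAtZero u) (a b : Fin 3) : VanishAtZero (rot a b u) := by
  rw [rot_apply]
  exact ((hu.dx b).mul_left _).sub ((hu.dx a).mul_left _)

theorem VanishAtZero.sphLap {u : Sm} (hu : VanishAtZero u) : VanishAtZero (sphLap u) :=
  (((hu.rot 0 1).rot 0 1).add ((hu.rot 0 2).rot 0 2)).add ((hu.rot 1 2).rot 1 2)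

theorem VanishAtZero.ellOp {u : Sm} (hu : VanishAtZero u) (κ : Sm) : VanishAtZero (ellOp κ u) :=
  VanishAtZero.sum fun i _ => ((hu.dx i).add (hu.Eu.mul_left _)).dx i

end LogSharp

namespace LogSharp

/-! ### Static and radial functions -/

/-- The smooth function on spacetime induced by a smooth function on space. -/
noncomputable def lift (h : E3 → ℂ) (hh : ContDiff ℝ ∞ h) : Sm :=
  ⟨fun p => h p.2, hh.comp contDiff_snd⟩

/-- The smooth function on spacetime induced by a smooth real function on space. -/
noncomputable def liftR (h : E3 → ℝ) (hh : ContDiff ℝ ∞ h) : Sm :=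
  lift (fun x => (h x : ℂ)) (Complex.ofRealCLM.contDiff.comp hh)

theorem liftR_apply (h : E3 → ℝ) (hh : ContDiff ℝ ∞ h) (p : M) :
    (liftR h hh : M → ℂ) p = h p.2 := rfl

theorem pd_lift (h : E3 → ℂ) (hh : ContDiff ℝ ∞ h) (μ : Ix) (p : M) :
    pd μ (lift h hh) p = fderiv ℝ h p.2 (e μ).2 := by
  have h1 : DifferentiableAt ℝ h p.2 := (hh.differentiable (by simp)).differentiableAt
  have h2 : HasFDerivAt (lift h hh : M → ℂ)
      ((fderiv ℝ h p.2).comp (ContinuousLinearMap.snd ℝ ℝ E3)) p :=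
    h1.hasFDerivAt.comp p hasFDerivAt_snd
  rw [pd, h2.fderiv]
  rfl

theorem dt_lift (h : E3 → ℂ) (hh : ContDiff ℝ ∞ h) : dt (lift h hh) = 0 := by
  ext p
  rw [dd_apply, pd_lift]
  simp [e]

theorem cj_liftR (h : E3 → ℝ) (hh : ContDiff ℝ ∞ h) : cj (liftR h hh) = liftR h hh := by
  ext p
  simp [cj_apply, liftR_apply]

/-- A smooth function with vanishing time derivative does not depend on time. -/
theorem static_of_dt_eq_zero {u : Sm} (h : dt u = 0) (t : ℝ) (x : E3) :
    (u : M → ℂ) (t, x) = (u : M → ℂ) (0, x) := by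
  have h1 : ∀ s, HasDerivAt (fun s : ℝ => (u : M → ℂ) (s, x)) 0 s := fun s => by
    have h2 := ((Sm.differentiable u) (s, x)).hasFDerivAt.comp_hasDerivAt s
      ((hasDerivAt_id s).prodMk (hasDerivAt_const s x))
    have h3 : fderiv ℝ (u : M → ℂ) (s, x) (1, 0) = 0 := congrFun (congrArg Subtype.val h) (s, x)
    rwa [h3] at h2
  exact is_const_of_deriv_eq_zero (fun s => (h1 s).differentiableAt) (fun s => (h1 s).deriv) t 0

/-- For v orthogonal to x the points x + θv and x − θv have equal norm, so the function is even in θ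
and its derivative at 0 vanishes. -/
theorem fderiv_eq_zero_of_radial {F : Type*} [NormedAddCommGroup F] [NormedSpace ℝ F] {h : E3 → F}
    (hr : ∀ x y : E3, ‖x‖ = ‖y‖ → h x = h y)
    {x v : E3} (hd : DifferentiableAt ℝ h x) (hxv : inner ℝ x v = 0) : fderiv ℝ h x v = 0 := by
  have h1 : HasDerivAt (fun θ : ℝ => h (x + θ • v)) (fderiv ℝ h x v) 0 := by
    have h2 : HasDerivAt (fun θ : ℝ => x + θ • v) v 0 := by
      simpa using ((hasDerivAt_id (0 : ℝ)).smul_const v).const_add x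
    have h3 : HasFDerivAt h (fderiv ℝ h x) (x + (0 : ℝ) • v) := by simpa using hd.hasFDerivAt
    exact h3.comp_hasDerivAt 0 h2
  have h4 : HasDerivAt (fun θ : ℝ => h (x + θ • v)) (-(fderiv ℝ h x v)) 0 := by
    have h5 : HasDerivAt (fun θ : ℝ => h (x + (-θ) • v)) (-(fderiv ℝ h x v)) 0 := by
      have h6 : HasDerivAt (fun θ : ℝ => h (x + θ • v)) (fderiv ℝ h x v) (-0) := by simpa using h1
      have h7 := h6.scomp (0 : ℝ) (hasDerivAt_neg (0 : ℝ))
      rw [neg_one_smul] at h7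
      exact h7
    refine h5.congr_of_eventuallyEq (Eventually.of_forall fun θ => hr _ _ ?_)
    have : ∀ θ : ℝ, ‖x + θ • v‖ ^ 2 = ‖x‖ ^ 2 + θ ^ 2 * ‖v‖ ^ 2 := fun θ => by
      rw [norm_add_sq_real, inner_smul_right, hxv, norm_smul, mul_pow, Real.norm_eq_abs, sq_abs]
      ring
    rw [← sq_eq_sq₀ (norm_nonneg _) (norm_nonneg _), this, this, neg_sq]
  have h7 := h1.unique h4
  have h8 : (2 : ℝ) • fderiv ℝ h x v = 0 := by
    rw [two_smul]; nth_rewrite 1 [h7]; simp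
  exact (smul_eq_zero.1 h8).resolve_left two_ne_zero

theorem isRadial_lift {h : E3 → ℂ} (hh : ContDiff ℝ ∞ h)
    (hr : ∀ x y : E3, ‖x‖ = ‖y‖ → h x = h y) : IsRadial (lift h hh) := fun a b => by
  ext p
  have key : fderiv ℝ h p.2 (p.2 a • EuclideanSpace.single b (1 : ℝ)
      - p.2 b • EuclideanSpace.single a (1 : ℝ)) = 0 :=
    fderiv_eq_zero_of_radial hr (hh.differentiable (by simp)).differentiableAt (by
      simp [inner_sub_right, inner_smul_right, EuclideanSpace.inner_single_right]; ring)
  rw [rot_apply]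
  change (X a : M → ℂ) p * (dx b (lift h hh) : M → ℂ) p
    - (X b : M → ℂ) p * (dx a (lift h hh) : M → ℂ) p = 0
  rw [dd_apply, dd_apply, pd_lift, pd_lift, X_apply, X_apply]
  simpa [e] using key

theorem isRadial_liftR {h : E3 → ℝ} (hh : ContDiff ℝ ∞ h)
    (hr : ∀ x y : E3, ‖x‖ = ‖y‖ → h x = h y) : IsRadial (liftR h hh) :=
  isRadial_lift _ fun x y hxy => by rw [hr x y hxy]

theorem sum_smul_single (x : E3) : ∑ i, x i • EuclideanSpace.single i (1 : ℝ) = x := by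
  ext j
  fin_cases j <;> simp [Fin.sum_univ_three]

theorem Eu_eq_fderiv (u : Sm) (p : M) :
    (Eu u : M → ℂ) p = fderiv ℝ (u : M → ℂ) p (0, p.2) := by
  rw [Eu_apply]
  change (X 0 : M → ℂ) p * (dx 0 u : M → ℂ) p + (X 1 : M → ℂ) p * (dx 1 u : M → ℂ) p
    + (X 2 : M → ℂ) p * (dx 2 u : M → ℂ) p = _
  have h1 : ((0 : ℝ), p.2) = ∑ i, p.2 i • e (Sum.inr i) := by
    refine Prod.ext ?_ ?_
    · simp [e, Prod.fst_sum]
    · simp only [e, Prod.snd_sum, Sum.elim_inr, Prod.smul_snd]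
      exact (sum_smul_single p.2).symm
  rw [h1, map_sum, Fin.sum_univ_three]
  simp [dd_apply, pd, X_apply]

theorem Eu_lift_of_hasDerivAt {h : E3 → ℂ} (hh : ContDiff ℝ ∞ h) {p : M} {c : ℂ}
    (hd : HasDerivAt (fun θ : ℝ => h (θ • p.2)) c 1) : (Eu (lift h hh) : M → ℂ) p = c := by
  rw [Eu_eq_fderiv]
  have h1 : HasDerivAt (fun θ : ℝ => (p.1, θ • p.2)) ((0 : ℝ), p.2) 1 :=
    (hasDerivAt_const (1 : ℝ) p.1).prodMk (by simpa using (hasDerivAt_id (1 : ℝ)).smul_const p.2)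
  have h2 : HasFDerivAt (lift h hh : M → ℂ) (fderiv ℝ (lift h hh : M → ℂ) p) (p.1, (1 : ℝ) • p.2) := by
    rw [one_smul]; exact (Sm.differentiable _ p).hasFDerivAt
  have h3 := h2.comp_hasDerivAt (1 : ℝ) h1
  exact h3.unique hd

theorem R2_apply (p : M) : (R2 : M → ℂ) p = ((‖p.2‖ ^ 2 : ℝ) : ℂ) := by
  rw [R2, Fin.sum_univ_three, EuclideanSpace.norm_sq_eq, Fin.sum_univ_three]
  change (X 0 : M → ℂ) p * (X 0 : M → ℂ) p + (X 1 : M → ℂ) p * (X 1 : M → ℂ) p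
    + (X 2 : M → ℂ) p * (X 2 : M → ℂ) p = _
  simp only [X_apply, Real.norm_eq_abs, sq_abs]
  push_cast
  ring

/-! ### Trigonometric functions of `|x|` -/

/-- The coefficients of `∑ (-y)^k / (2k+m)!`. -/
noncomputable def trigCoeff (m n : ℕ) : ℝ := (-1) ^ n / (2 * n + m).factorial

/-- The entire function `∑ (-y)^k / (2k+m)!`. -/
noncomputable def trigSeries (m : ℕ) : ℝ → ℝ := FormalMultilinearSeries.ofScalarsSum (trigCoeff m)

theorem trigCoeff_radius (m : ℕ) :
    (FormalMultilinearSeries.ofScalars ℝ (trigCoeff m)).radius = ⊤ := by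
  refine FormalMultilinearSeries.ofScalars_radius_eq_top_of_tendsto _ _
    (Eventually.of_forall fun n => ?_) ?_
  · exact div_ne_zero (pow_ne_zero _ (by norm_num)) (by exact_mod_cast (Nat.factorial_ne_zero _))
  · have h1 : ∀ n : ℕ, ‖trigCoeff m n.succ‖ / ‖trigCoeff m n‖
        = (((2 * n + m + 2 : ℕ) : ℝ) * ((2 * n + m + 1 : ℕ) : ℝ))⁻¹ := fun n => by
      have h2 : 2 * (n + 1) + m = 2 * n + m + 1 + 1 := by ring
      have hf : ((2 * n + m).factorial : ℝ) ≠ 0 := by exact_mod_cast Nat.factorial_ne_zero _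
      simp only [trigCoeff, norm_div, norm_pow, norm_neg, norm_one, one_pow, Nat.succ_eq_add_one, h2,
        Nat.factorial_succ, Real.norm_natCast]
      push_cast
      field_simp
      try ring
    simp_rw [h1]
    refine squeeze_zero (fun n => by positivity) (fun n => ?_)
      (tendsto_inv_atTop_nhds_zero_nat (𝕜 := ℝ) |>.comp (tendsto_add_atTop_nat 1))
    refine inv_anti₀ (by positivity) ?_
    push_cast
    nlinarith [Nat.cast_nonneg (α := ℝ) n, Nat.cast_nonneg (α := ℝ) m,
      mul_nonneg (Nat.cast_nonneg (α := ℝ) n) (Nat.cast_nonneg (α := ℝ) m)]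

theorem contDiff_trigSeries (m : ℕ) : ContDiff ℝ ∞ (trigSeries m) := by
  have h1 := (FormalMultilinearSeries.ofScalars ℝ (trigCoeff m)).hasFPowerSeriesOnBall
    (by rw [trigCoeff_radius]; simp)
  rw [trigCoeff_radius] at h1
  have h2 := h1.analyticOnNhd
  rw [Metric.eball_top] at h2
  exact h2.contDiff

theorem hasSum_trigSeries (m : ℕ) (y : ℝ) :
    HasSum (fun n : ℕ => (-1) ^ n / ((2 * n + m).factorial : ℝ) * y ^ n) (trigSeries m y) := by
  have h1 := (FormalMultilinearSeries.ofScalars ℝ (trigCoeff m)).hasSum (x := y)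
    (by rw [trigCoeff_radius]; simp)
  simpa [FormalMultilinearSeries.ofScalars_apply_eq, trigCoeff, trigSeries,
    FormalMultilinearSeries.ofScalarsSum, mul_comm] using h1

/-- Without its constant term the cosine is r² times an entire function of r²; hence cos|x| is
smooth on space although |x| is not. The sine is handled in the same way. -/
theorem cos_eq_trigSeries (r : ℝ) : Real.cos r = 1 - r ^ 2 * trigSeries 2 (r ^ 2) := by
  have h1 := (hasSum_trigSeries 2 (r ^ 2)).mul_left (-(r ^ 2))
  have h2 := (hasSum_nat_add_iff' 1).2 (Real.hasSum_cos r)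
  have h3 := h1.unique (h2.congr_fun ?_)
  · simp at h3
    linarith
  · intro n
    have : 2 * (n + 1) = 2 * n + 2 := by ring
    rw [this, ← pow_mul]
    ring

theorem sin_eq_trigSeries (r : ℝ) : Real.sin r = r * (1 - r ^ 2 * trigSeries 3 (r ^ 2)) := by
  have h1 := (hasSum_trigSeries 3 (r ^ 2)).mul_left (-(r ^ 3))
  have h2 := (hasSum_nat_add_iff' 1).2 (Real.hasSum_sin r)
  have h3 := h1.unique (h2.congr_fun ?_)
  · simp at h3
    linarith
  · intro n
    have : 2 * (n + 1) + 1 = 2 * n + 3 := by ring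
    rw [this, ← pow_mul]
    ring

/-- `sin |x| / |x|`. -/
noncomputable def sincN (x : E3) : ℝ := 1 - ‖x‖ ^ 2 * trigSeries 3 (‖x‖ ^ 2)

/-- `cos |x|`. -/
noncomputable def cosN (x : E3) : ℝ := 1 - ‖x‖ ^ 2 * trigSeries 2 (‖x‖ ^ 2)

theorem contDiff_sincN : ContDiff ℝ ∞ sincN :=
  contDiff_const.sub ((contDiff_norm_sq ℝ).mul ((contDiff_trigSeries 3).comp (contDiff_norm_sq ℝ)))

theorem contDiff_cosN : ContDiff ℝ ∞ cosN :=
  contDiff_const.sub ((contDiff_norm_sq ℝ).mul ((contDiff_trigSeries 2).comp (contDiff_norm_sq ℝ)))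

theorem norm_mul_sincN (x : E3) : ‖x‖ * sincN x = Real.sin ‖x‖ := (sin_eq_trigSeries ‖x‖).symm

theorem cosN_eq (x : E3) : cosN x = Real.cos ‖x‖ := (cos_eq_trigSeries ‖x‖).symm

/-- `sin |x| / |x|` on spacetime. -/
noncomputable def sSm : Sm := liftR sincN contDiff_sincN

/-- `cos |x|` on spacetime. -/
noncomputable def cSm : Sm := liftR cosN contDiff_cosN

theorem isRadial_sSm : IsRadial sSm :=
  isRadial_liftR _ fun x y h => by simp only [sincN, h]

theorem Eu_cSm : Eu cSm = -(R2 * sSm) := by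
  ext p
  have h1 : HasDerivAt (fun θ : ℝ => ((cosN (θ • p.2) : ℝ) : ℂ))
      ((-Real.sin (1 * ‖p.2‖) * ‖p.2‖ : ℝ) : ℂ) 1 := by
    have h2 : HasDerivAt (fun θ : ℝ => Real.cos (θ * ‖p.2‖)) (-Real.sin (1 * ‖p.2‖) * ‖p.2‖) 1 := by
      simpa using ((hasDerivAt_id (1 : ℝ)).mul_const ‖p.2‖).cos
    refine (h2.congr_of_eventuallyEq (Eventually.of_forall fun θ => ?_)).ofReal_comp
    simp only [cosN_eq, norm_smul, Real.norm_eq_abs]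
    rcases abs_choice θ with h | h <;> simp [h]
  refine (Eu_lift_of_hasDerivAt _ h1).trans ?_
  change _ = -((R2 : M → ℂ) p * (sSm : M → ℂ) p)
  rw [R2_apply, sSm, liftR_apply, one_mul, ← norm_mul_sincN]
  push_cast
  ring

theorem Eu_sSm : Eu sSm = cSm - sSm := by
  ext p
  change _ = (cSm : M → ℂ) p - (sSm : M → ℂ) p
  rw [sSm, cSm, liftR_apply, liftR_apply, cosN_eq]
  by_cases hp : p.2 = 0
  · refine (Eu_lift_of_hasDerivAt (c := 0) _ ?_).trans ?_
    · simp only [hp, smul_zero]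
      exact hasDerivAt_const _ _
    · simp [hp, sincN]
  · have hr : ‖p.2‖ ≠ 0 := norm_ne_zero_iff.2 hp
    have h1 : HasDerivAt (fun θ : ℝ => ((sincN (θ • p.2) : ℝ) : ℂ))
      ((Real.cos ‖p.2‖ - sincN p.2 : ℝ) : ℂ) 1 := by
      have h2 : HasDerivAt (fun θ : ℝ => Real.sin (θ * ‖p.2‖) / (θ * ‖p.2‖))
          (Real.cos ‖p.2‖ - sincN p.2) 1 := by
        have h3 := ((hasDerivAt_id (1 : ℝ)).mul_const ‖p.2‖)
        have h4 := h3.sin.div h3 (by simpa using hr)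
        refine h4.congr_deriv ?_
        have := norm_mul_sincN p.2
        simp only [id, one_mul]
        rw [← this]
        field_simp
      refine (h2.congr_of_eventuallyEq ?_).ofReal_comp
      -- The identity ‖θx‖ = θ‖x‖ needs θ ≥ 0, which holds near θ = 1.
      filter_upwards [lt_mem_nhds (zero_lt_one : (0 : ℝ) < 1)] with θ hθ
      have := norm_mul_sincN (θ • p.2)
      rw [norm_smul, Real.norm_of_nonneg hθ.le] at this
      rw [← this]
      field_simp
    refine (Eu_lift_of_hasDerivAt _ h1).trans ?_
    push_cast
    ring

/-! ### The coefficients of the metric in Cartesian coordinates -/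

/-- `κ = (f(r)/r² - 1)/r²`. -/
noncomputable def kapFun (f : ℝ → ℝ) (x : E3) : ℝ :=
  if x = 0 then -2 * trigSeries 3 0 else (f ‖x‖ / ‖x‖ ^ 2 - 1) / ‖x‖ ^ 2

/-- `ρ = f(r)/r²`. -/
noncomputable def rhoFun (f : ℝ → ℝ) (x : E3) : ℝ := 1 + ‖x‖ ^ 2 * kapFun f x

/-- The value of `κ` on the spherical region. -/
noncomputable def kapSphere (x : E3) : ℝ := -trigSeries 3 (‖x‖ ^ 2) * (1 + sincN x)

theorem norm_sq_mul_kapSphere (x : E3) : ‖x‖ ^ 2 * kapSphere x = sincN x ^ 2 - 1 := by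
  simp only [kapSphere, sincN]; ring

theorem contDiff_kapSphere : ContDiff ℝ ∞ kapSphere :=
  (((contDiff_trigSeries 3).comp (contDiff_norm_sq ℝ)).neg).mul (contDiff_const.add contDiff_sincN)

variable {f : ℝ → ℝ}

/-- With s = sin r / r the quotient (s² − 1)/r² factors as (s − 1)/r² times (s + 1), which is entire
in r². At the origin both sides equal −1/3, the limit prescribed in the definition. -/
theorem kapFun_eq_sphere (hf : IsProfile f) {x : E3} (hx : ‖x‖ ≤ 7 * Real.pi / 8) :
    kapFun f x = kapSphere x := by
  by_cases h : x = 0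
  · subst h; simp [kapFun, kapSphere, sincN]; ring
  · have hr : ‖x‖ ≠ 0 := norm_ne_zero_iff.2 h
    rw [kapFun, if_neg h, hf.sphere _ (norm_nonneg x) hx, ← norm_mul_sincN]
    have := norm_sq_mul_kapSphere x
    field_simp
    linarith

theorem kapFun_eq_zero (hf : IsProfile f) {x : E3} (hx : Real.pi ≤ ‖x‖) : kapFun f x = 0 := by
  have h : x ≠ 0 := by
    rintro rfl
    rw [norm_zero] at hx
    linarith [Real.pi_pos]
  have hr : ‖x‖ ≠ 0 := norm_ne_zero_iff.2 h
  rw [kapFun, if_neg h, hf.flat _ hx]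
  field_simp
  simp

/-- Near the origin the entire formula of the round sphere applies; elsewhere the norm is smooth and
|x| is interior to the domain of f. -/
theorem contDiff_kapFun (hf : IsProfile f) : ContDiff ℝ ∞ (kapFun f) := by
  rw [contDiff_iff_contDiffAt]
  intro x
  by_cases h : x = 0
  · refine contDiff_kapSphere.contDiffAt.congr_of_eventuallyEq ?_
    have h1 : {y : E3 | ‖y‖ < 7 * Real.pi / 8} ∈ 𝓝 x :=
      (isOpen_lt continuous_norm continuous_const).mem_nhds (by
        simp only [mem_ofPred_eq, h, norm_zero]; have := Real.pi_pos; positivity)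
    filter_upwards [h1] with y hy
    exact kapFun_eq_sphere hf (le_of_lt hy)
  · have hr : 0 < ‖x‖ := norm_pos_iff.2 h
    have hn : ContDiffAt ℝ ∞ (fun y : E3 => ‖y‖) x := contDiffAt_norm ℝ h
    have hfx : ContDiffAt ℝ ∞ f ‖x‖ := hf.smooth.contDiffAt (Ici_mem_nhds hr)
    have h1 : ContDiffAt ℝ ∞ (fun y : E3 => (f ‖y‖ / ‖y‖ ^ 2 - 1) / ‖y‖ ^ 2) x :=
      (((hfx.comp x hn).div (hn.pow 2) (by positivity)).sub contDiffAt_const).div (hn.pow 2)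
        (by positivity)
    refine h1.congr_of_eventuallyEq ?_
    filter_upwards [isOpen_ne.mem_nhds h] with y hy
    rw [kapFun, if_neg hy]

theorem contDiff_rhoFun (hf : IsProfile f) : ContDiff ℝ ∞ (rhoFun f) :=
  contDiff_const.add ((contDiff_norm_sq ℝ).mul (contDiff_kapFun hf))

theorem rhoFun_of_ne_zero {x : E3} (h : x ≠ 0) : rhoFun f x = f ‖x‖ / ‖x‖ ^ 2 := by
  have hr : ‖x‖ ≠ 0 := norm_ne_zero_iff.2 h
  rw [rhoFun, kapFun, if_neg h]
  field_simp
  ring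

theorem profile_pos (hf : IsProfile f) {r : ℝ} (hr : 0 < r) : 0 < f r := by
  rcases le_total r (7 * Real.pi / 8) with h | h
  · rw [hf.sphere r hr.le h]
    have := Real.sin_pos_of_pos_of_lt_pi hr (by linarith [Real.pi_pos])
    positivity
  · rcases le_total r Real.pi with h2 | h2
    · exact hf.pos r h h2
    · rw [hf.flat r h2]; positivity

theorem rhoFun_pos (hf : IsProfile f) (x : E3) : 0 < rhoFun f x := by
  by_cases h : x = 0
  · subst h; simp [rhoFun]
  · rw [rhoFun_of_ne_zero h]
    exact div_pos (profile_pos hf (norm_pos_iff.2 h)) (by positivity)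

theorem rhoFun_eq_one (hf : IsProfile f) {x : E3} (hx : Real.pi ≤ ‖x‖) : rhoFun f x = 1 := by
  rw [rhoFun, kapFun_eq_zero hf hx]; ring

theorem rhoFun_eq_sphere (hf : IsProfile f) {x : E3} (hx : ‖x‖ ≤ 7 * Real.pi / 8) :
    rhoFun f x = sincN x ^ 2 := by
  rw [rhoFun, kapFun_eq_sphere hf hx, norm_sq_mul_kapSphere]; ring

theorem kapFun_radial (f : ℝ → ℝ) (x y : E3) (h : ‖x‖ = ‖y‖) : kapFun f x = kapFun f y := by
  have : x = 0 ↔ y = 0 := by rw [← norm_eq_zero, h, norm_eq_zero]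
  simp only [kapFun, this, h]

theorem rhoFun_radial (f : ℝ → ℝ) (x y : E3) (h : ‖x‖ = ‖y‖) : rhoFun f x = rhoFun f y := by
  rw [rhoFun, rhoFun, kapFun_radial f x y h, h]

/-- The Cartesian form of the metric. It removes the coordinate singularity of the polar expression,
since both coefficients are smooth at the origin. -/
theorem g₀_apply (f : ℝ → ℝ) (x v w : E3) :
    g₀ f x v w = rhoFun f x * inner ℝ v w - kapFun f x * (inner ℝ x v * inner ℝ x w) := by
  by_cases h : x = 0
  · subst h
    simp [g₀, rhoFun, euclid_apply]
  · have hr : ‖x‖ ≠ 0 := norm_ne_zero_iff.2 h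
    rw [g₀, if_neg h, rhoFun_of_ne_zero h, kapFun, if_neg h]
    have hd : ∀ v w, drSq x v w = (‖x‖ ^ 2)⁻¹ * (inner ℝ x v * inner ℝ x w) := fun v w => by
      simp only [drSq, ContinuousLinearMap.smulRight_apply, smul_apply,
        euclid_apply, real_inner_smul_left, smul_eq_mul]
      field_simp
    simp only [sphereForm, add_apply, smul_apply,
      sub_apply, hd, euclid_apply, smul_eq_mul]
    field_simp
    ring

/-- `ρ` on spacetime. -/
noncomputable def rhoSm (hf : IsProfile f) : Sm := liftR (rhoFun f) (contDiff_rhoFun hf)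

/-- `κ` on spacetime. -/
noncomputable def kapSm (hf : IsProfile f) : Sm := liftR (kapFun f) (contDiff_kapFun hf)

/-- `√ρ` on spacetime. -/
noncomputable def muSm (hf : IsProfile f) : Sm :=
  liftR (fun x => Real.sqrt (rhoFun f x)) ((contDiff_rhoFun hf).sqrt fun x => (rhoFun_pos hf x).ne')

/-- `1/√ρ` on spacetime. -/
noncomputable def nuSm (hf : IsProfile f) : Sm :=
  liftR (fun x => (Real.sqrt (rhoFun f x))⁻¹)
    (((contDiff_rhoFun hf).sqrt fun x => (rhoFun_pos hf x).ne').inv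
      fun x => (Real.sqrt_pos.2 (rhoFun_pos hf x)).ne')

theorem isRadial_kapSm (hf : IsProfile f) : IsRadial (kapSm hf) :=
  isRadial_liftR _ (kapFun_radial f)

theorem isRadial_muSm (hf : IsProfile f) : IsRadial (muSm hf) :=
  isRadial_liftR _ fun x y h => by rw [rhoFun_radial f x y h]

theorem muSm_mul_nuSm (hf : IsProfile f) : muSm hf * nuSm hf = 1 := by
  ext p
  change (muSm hf : M → ℂ) p * (nuSm hf : M → ℂ) p = 1
  rw [muSm, nuSm, liftR_apply, liftR_apply, ← Complex.ofReal_mul,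
    mul_inv_cancel₀ (Real.sqrt_pos.2 (rhoFun_pos hf p.2)).ne', Complex.ofReal_one]

theorem rhoSm_eq (hf : IsProfile f) : rhoSm hf = 1 + R2 * kapSm hf := by
  ext p
  change (rhoSm hf : M → ℂ) p = 1 + (R2 : M → ℂ) p * (kapSm hf : M → ℂ) p
  rw [R2_apply, rhoSm, kapSm, liftR_apply, liftR_apply, rhoFun]
  push_cast
  ring

theorem muSm_mul_self (hf : IsProfile f) : muSm hf * muSm hf = rhoSm hf := by
  ext p
  change (muSm hf : M → ℂ) p * (muSm hf : M → ℂ) p = _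
  rw [muSm, rhoSm, liftR_apply, liftR_apply, ← Complex.ofReal_mul,
    Real.mul_self_sqrt (rhoFun_pos hf p.2).le]

end LogSharp

namespace LogSharp

/-! ### The metric, the wave operator and the energy in Cartesian coordinates -/

variable {f : ℝ → ℝ}

theorem ultrastatic_apply (f : ℝ → ℝ) (p v w : M) :
    ultrastatic f p v w = -(v.1 * w.1) + (rhoFun f p.2 * inner ℝ v.2 w.2
      - kapFun f p.2 * (inner ℝ p.2 v.2 * inner ℝ p.2 w.2)) := by
  rw [← g₀_apply f]
  simp [ultrastatic]

/-- The matrix `ρ - κ x xᵀ`. -/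
noncomputable def spaceMat (f : ℝ → ℝ) (x : E3) : Matrix (Fin 3) (Fin 3) ℝ :=
  Matrix.of fun i j => (if i = j then rhoFun f x else 0) - kapFun f x * (x i * x j)

/-- The matrix `1 + κ x xᵀ`. -/
noncomputable def spaceCo (f : ℝ → ℝ) (x : E3) : Matrix (Fin 3) (Fin 3) ℝ :=
  Matrix.of fun i j => (if i = j then 1 else 0) + kapFun f x * (x i * x j)

theorem spaceGram_ultrastatic (f : ℝ → ℝ) (p : M) :
    spaceGram (ultrastatic f) p = spaceMat f p.2 := by
  ext i j
  simp only [spaceGram, spaceMat, Matrix.of_apply, ultrastatic_apply, e, Sum.elim_inr]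
  by_cases h : i = j
  · subst h; simp [EuclideanSpace.inner_single_right]
  · simp [EuclideanSpace.inner_single_right, h, Ne.symm h]

theorem gram_ultrastatic (f : ℝ → ℝ) (p : M) :
    gram (ultrastatic f) p = Matrix.fromBlocks (-1) 0 0 (spaceMat f p.2) := by
  rw [← spaceGram_ultrastatic]
  ext i j
  rcases i with i | i <;> rcases j with j | j <;>
    simp [gram, spaceGram, ultrastatic_apply, e]

theorem rhoFun_eq (f : ℝ → ℝ) (x : E3) :
    rhoFun f x = 1 + (x 0 ^ 2 + x 1 ^ 2 + x 2 ^ 2) * kapFun f x := by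
  rw [rhoFun, EuclideanSpace.norm_sq_eq, Fin.sum_univ_three]
  simp only [Real.norm_eq_abs, sq_abs]

/-- The eigenvalues are ρ, ρ tangentially and ρ − κr² = 1 radially. -/
theorem spaceMat_det (f : ℝ → ℝ) (x : E3) : (spaceMat f x).det = rhoFun f x ^ 2 := by
  have h := rhoFun_eq f x
  rw [Matrix.det_fin_three]
  simp [spaceMat]
  linear_combination (rhoFun f x ^ 2) * h

/-- Radially the eigenvalues are 1 and ρ, tangentially ρ and 1; the product is ρ in either case. -/
theorem spaceMat_mul_spaceCo (f : ℝ → ℝ) (x : E3) :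
    spaceMat f x * spaceCo f x = rhoFun f x • 1 := by
  have h := rhoFun_eq f x
  ext i j
  rw [Matrix.mul_apply, Fin.sum_univ_three]
  fin_cases i <;> fin_cases j <;> simp [spaceMat, spaceCo]
  · linear_combination (kapFun f x * x 0 * x 0) * h
  · linear_combination (kapFun f x * x 0 * x 1) * h
  · linear_combination (kapFun f x * x 0 * x 2) * h
  · linear_combination (kapFun f x * x 1 * x 0) * h
  · linear_combination (kapFun f x * x 1 * x 1) * h
  · linear_combination (kapFun f x * x 1 * x 2) * h
  · linear_combination (kapFun f x * x 2 * x 0) * h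
  · linear_combination (kapFun f x * x 2 * x 1) * h
  · linear_combination (kapFun f x * x 2 * x 2) * h

theorem invGram_ultrastatic (hf : IsProfile f) (p : M) : invGram (ultrastatic f) p
    = Matrix.fromBlocks (-1) 0 0 ((rhoFun f p.2)⁻¹ • spaceCo f p.2) := by
  rw [invGram, gram_ultrastatic]
  refine Matrix.inv_eq_right_inv ?_
  rw [Matrix.fromBlocks_multiply]
  simp [spaceMat_mul_spaceCo, smul_smul, inv_mul_cancel₀ (rhoFun_pos hf p.2).ne']

theorem volDensity_ultrastatic (hf : IsProfile f) (p : M) :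
    volDensity (ultrastatic f) p = rhoFun f p.2 := by
  rw [volDensity, gram_ultrastatic, Matrix.det_fromBlocks_zero₂₁, spaceMat_det]
  simp [abs_of_pos (rhoFun_pos hf p.2), Real.sqrt_sq (rhoFun_pos hf p.2).le]

theorem pd_zero_fun (μ : Ix) (p : M) : pd μ (fun _ : M => (0 : ℂ)) p = 0 := by
  simp [pd]

/-- The volume density ρ cancels the factor ρ⁻¹ of the inverse spatial metric, which leaves a
divergence form operator with polynomial dependence on κ. -/
theorem rho_mul_box (hf : IsProfile f) (ψ : Sm) (p : M) :
    (rhoFun f p.2 : ℂ) * box (ultrastatic f) ψ p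
      = ((ellOp (kapSm hf) ψ - rhoSm hf * dt (dt ψ) : Sm) : M → ℂ) p := by
  have hρ := (rhoFun_pos hf p.2).ne'
  have h00 : (fun q => (volDensity (ultrastatic f) q * invGram (ultrastatic f) q (Sum.inl ()) (Sum.inl ()))
      • pd (Sum.inl ()) (ψ : M → ℂ) q) = ((-(rhoSm hf * dt ψ) : Sm) : M → ℂ) := by
    ext q
    rw [volDensity_ultrastatic hf, invGram_ultrastatic hf]
    change _ = -((rhoFun f q.2 : ℂ) * pd (Sum.inl ()) (ψ : M → ℂ) q)
    simp
  have h0i : ∀ i, (fun q => (volDensity (ultrastatic f) q * invGram (ultrastatic f) q (Sum.inl ()) (Sum.inr i))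
      • pd (Sum.inr i) (ψ : M → ℂ) q) = fun _ => 0 := fun i => by
    ext q
    rw [invGram_ultrastatic hf]
    simp
  have hi0 : ∀ i, (fun q => (volDensity (ultrastatic f) q * invGram (ultrastatic f) q (Sum.inr i) (Sum.inl ()))
      • pd (Sum.inl ()) (ψ : M → ℂ) q) = fun _ => 0 := fun i => by
    ext q
    rw [invGram_ultrastatic hf]
    simp
  have hij : ∀ i j, (fun q => (volDensity (ultrastatic f) q * invGram (ultrastatic f) q (Sum.inr i) (Sum.inr j))
      • pd (Sum.inr j) (ψ : M → ℂ) q)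
      = ((((if i = j then 1 else 0) + kapSm hf * (X i * X j)) * dx j ψ : Sm) : M → ℂ) := fun i j => by
    ext q
    rw [volDensity_ultrastatic hf, invGram_ultrastatic hf, Matrix.fromBlocks_apply₂₂,
      Matrix.smul_apply, smul_eq_mul, mul_inv_cancel_left₀ (rhoFun_pos hf q.2).ne']
    change _ = (((if i = j then 1 else 0 : Sm) : M → ℂ) q
      + (kapFun f q.2 : ℂ) * ((q.2 i : ℂ) * (q.2 j : ℂ))) * pd (Sum.inr j) (ψ : M → ℂ) q
    by_cases h : i = j
    · simp [spaceCo, h]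
    · simp [spaceCo, h]
  rw [box, volDensity_ultrastatic hf, Fintype.sum_sum_type]
  simp only [Fintype.sum_sum_type, Finset.univ_unique, Finset.sum_singleton]
  have hu : (default : Unit) = () := rfl
  rw [hu, h00]
  simp only [h0i, hi0, hij, pd_zero_fun, Finset.sum_const_zero, add_zero, zero_add]
  have hval : ∀ u : Sm, ∀ μ, pd μ (u : M → ℂ) p = (dd μ u : M → ℂ) p := fun _ _ => rfl
  simp only [hval]
  have hsum : (dd (Sum.inl ()) (-(rhoSm hf * dt ψ))) + ∑ i, ∑ j, dd (Sum.inr i)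
      (((if i = j then 1 else 0) + kapSm hf * (X i * X j)) * dx j ψ)
      = ellOp (kapSm hf) ψ - rhoSm hf * dt (dt ψ) := by
    have h1 : dt (rhoSm hf) = 0 := dt_lift _ _
    have hi : ∀ i, ∑ j, dx i (((if i = j then 1 else 0) + kapSm hf * (X i * X j)) * dx j ψ)
        = dx i (dx i ψ + kapSm hf * X i * Eu ψ) := fun i => by
      rw [← map_sum]
      congr 1
      simp only [add_mul, Finset.sum_add_distrib, ite_mul, one_mul, zero_mul, Finset.sum_ite_eq,
        Finset.mem_univ, if_true, Eu_apply, Fin.sum_univ_three]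
      ring
    rw [map_neg, Derivation.leibniz, h1, Finset.sum_congr rfl fun i _ => hi i, ellOp]
    rw [smul_zero, add_zero, neg_add_eq_sub, smul_eq_mul]
  rw [← hsum, Complex.real_smul, Complex.ofReal_inv, mul_inv_cancel_left₀ (by exact_mod_cast hρ)]
  simp only [AddMemClass.coe_add, Pi.add_apply, AddSubmonoidClass.coe_finsetSum, Finset.sum_apply]

theorem box_eq_zero_iff (hf : IsProfile f) (ψ : Sm) (p : M) : box (ultrastatic f) ψ p = 0 ↔
    ((rhoSm hf * dt (dt ψ) - ellOp (kapSm hf) ψ : Sm) : M → ℂ) p = 0 := by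
  have h := rho_mul_box hf ψ p
  have hρ : (rhoFun f p.2 : ℂ) ≠ 0 := by exact_mod_cast (rhoFun_pos hf p.2).ne'
  rw [← neg_sub (ellOp (kapSm hf) ψ)]
  change _ ↔ -((ellOp (kapSm hf) ψ - rhoSm hf * dt (dt ψ) : Sm) : M → ℂ) p = 0
  rw [← h, neg_eq_zero, mul_eq_zero]
  simp [hρ]

theorem normal_ultrastatic (hf : IsProfile f) (p : M) : normal (ultrastatic f) p = T := by
  rw [normal, Fintype.sum_sum_type]
  simp [invGram_ultrastatic hf, T, e]

/-! ### Energy densities for general radial coefficients. -/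

/-- Admissible coefficients `κ`: smooth, with `ρ = 1 + |x|² κ > 0`. -/
structure IsCoef (k : E3 → ℝ) : Prop where
  smooth : ContDiff ℝ ∞ k
  pos : ∀ x, 0 < 1 + ‖x‖ ^ 2 * k x

theorem IsProfile.isCoef (hf : IsProfile f) : IsCoef (kapFun f) := ⟨contDiff_kapFun hf, rhoFun_pos hf⟩

/-- The flat case, included so that the same energy estimates also yield uniqueness for the flat
equation with a potential. -/
theorem isCoef_zero : IsCoef (fun _ => 0) := ⟨contDiff_const, fun x => by simp⟩

variable {k : E3 → ℝ}

/-- `ρ = 1 + |x|² κ` on spacetime. -/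
noncomputable def rSm (hk : IsCoef k) : Sm :=
  liftR (fun x => 1 + ‖x‖ ^ 2 * k x) (contDiff_const.add ((contDiff_norm_sq ℝ).mul hk.smooth))

/-- `κ` on spacetime. -/
noncomputable def kSm (hk : IsCoef k) : Sm := liftR k hk.smooth

theorem rhoSm_eq_rSm (hf : IsProfile f) : rhoSm hf = rSm hf.isCoef := rfl

theorem kapSm_eq_kSm (hf : IsProfile f) : kapSm hf = kSm hf.isCoef := rfl

/-- The energy density `ρ|u_t|² + |∇u|² + κ|x·∇u|²`, without the factor `1/2`. -/
noncomputable def enDens (k : E3 → ℝ) (u : M → ℂ) (p : M) : ℝ :=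
  (1 + ‖p.2‖ ^ 2 * k p.2) * ‖pd (Sum.inl ()) u p‖ ^ 2 + ∑ i, ‖pd (Sum.inr i) u p‖ ^ 2
    + k p.2 * ‖∑ i, (p.2 i : ℂ) * pd (Sum.inr i) u p‖ ^ 2

/-- The induced volume density is ρ and cancels the inverse metric, just as in the wave operator;
the normal is T itself. -/
theorem energyDensity_ultrastatic (hf : IsProfile f) (ψ : M → ℂ) (p : M) :
    energyDensity (ultrastatic f) ψ p = 1 / 2 * enDens (kapFun f) ψ p := by
  have hρ := (rhoFun_pos hf p.2)
  rw [energyDensity, spaceGram_ultrastatic, spaceMat_det, Real.sqrt_sq hρ.le, stress,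
    normal_ultrastatic hf, invGram_ultrastatic hf]
  have h1 : fderiv ℝ ψ p T = pd (Sum.inl ()) ψ p := rfl
  have h2 : ultrastatic f p T T = -1 := by rw [ultrastatic_apply]; simp [T, e]
  rw [h1, h2]
  simp only [Fintype.sum_sum_type, Finset.univ_unique, Finset.sum_singleton, Fin.sum_univ_three,
    enDens, spaceCo, Complex.sq_norm, Complex.normSq_apply]
  rw [← rhoFun]
  simp
  field_simp
  ring

theorem ofReal_enDens (hk : IsCoef k) (u : Sm) (p : M) :
    (energyForm (rSm hk) (kSm hk) u (cj u) : M → ℂ) p = (enDens k u p : ℂ) := by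
  have hn : ∀ z : ℂ, ((‖z‖ ^ 2 : ℝ) : ℂ) = z * (starRingEnd ℂ) z := fun z => by
    rw [Complex.mul_conj, Complex.normSq_eq_norm_sq]
  simp only [energyForm, gradForm, Eu_cj, dd_cj]
  rw [enDens]
  push_cast [hn]
  simp only [Eu_apply, Fin.sum_univ_three, map_add, map_mul]
  change ((1 + ‖p.2‖ ^ 2 * k p.2 : ℝ) : ℂ) * pd (Sum.inl ()) (u : M → ℂ) p * (starRingEnd ℂ) (pd (Sum.inl ()) (u : M → ℂ) p)
    + (pd (Sum.inr 0) (u : M → ℂ) p * (starRingEnd ℂ) (pd (Sum.inr 0) (u : M → ℂ) p)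
      + pd (Sum.inr 1) (u : M → ℂ) p * (starRingEnd ℂ) (pd (Sum.inr 1) (u : M → ℂ) p)
      + pd (Sum.inr 2) (u : M → ℂ) p * (starRingEnd ℂ) (pd (Sum.inr 2) (u : M → ℂ) p)
      + (k p.2 : ℂ) * ((p.2 0 : ℂ) * pd (Sum.inr 0) (u : M → ℂ) p
        + (p.2 1 : ℂ) * pd (Sum.inr 1) (u : M → ℂ) p + (p.2 2 : ℂ) * pd (Sum.inr 2) (u : M → ℂ) p)
      * ((starRingEnd ℂ) (p.2 0 : ℂ) * (starRingEnd ℂ) (pd (Sum.inr 0) (u : M → ℂ) p)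
        + (starRingEnd ℂ) (p.2 1 : ℂ) * (starRingEnd ℂ) (pd (Sum.inr 1) (u : M → ℂ) p)
        + (starRingEnd ℂ) (p.2 2 : ℂ) * (starRingEnd ℂ) (pd (Sum.inr 2) (u : M → ℂ) p))) = _
  push_cast
  ring

theorem norm_radial_sum_le (x : E3) (a : Fin 3 → ℂ) :
    ‖∑ i, (x i : ℂ) * a i‖ ^ 2 ≤ ‖x‖ ^ 2 * ∑ i, ‖a i‖ ^ 2 := by
  have h1 : ‖∑ i, (x i : ℂ) * a i‖ ≤ ∑ i, |x i| * ‖a i‖ :=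
    (norm_sum_le _ _).trans (le_of_eq (Finset.sum_congr rfl fun i _ => by
      rw [norm_mul, Complex.norm_real, Real.norm_eq_abs]))
  have h2 := Finset.sum_mul_sq_le_sq_mul_sq Finset.univ (fun i => |x i|) (fun i => ‖a i‖)
  rw [EuclideanSpace.norm_sq_eq]
  simp only [Real.norm_eq_abs]
  exact (pow_le_pow_left₀ (norm_nonneg _) h1 2).trans h2

/-- Positivity of the gradient part of the energy. -/
theorem gradDens_bound (hk : IsCoef k) (x : E3) (a : Fin 3 → ℂ) :
    0 ≤ ∑ i, ‖a i‖ ^ 2 + k x * ‖∑ i, (x i : ℂ) * a i‖ ^ 2 ∧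
    (1 + ‖x‖ ^ 2 * k x) * ‖∑ i, (x i : ℂ) * a i‖ ^ 2
      ≤ (1 + ‖x‖ ^ 2) * (∑ i, ‖a i‖ ^ 2 + k x * ‖∑ i, (x i : ℂ) * a i‖ ^ 2) := by
  have h1 := norm_radial_sum_le x a
  have hρ := hk.pos x
  set g := ∑ i, ‖a i‖ ^ 2
  set d := ‖∑ i, (x i : ℂ) * a i‖ ^ 2
  have hd : 0 ≤ d := by positivity
  have hg : 0 ≤ g := Finset.sum_nonneg fun i _ => by positivity
  have hnn : 0 ≤ g + k x * d := by
    by_cases hx : ‖x‖ ^ 2 = 0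
    · rw [hx, zero_mul] at h1
      have : d = 0 := le_antisymm h1 hd
      rw [this]; simpa using hg
    · have hx' : 0 < ‖x‖ ^ 2 := lt_of_le_of_ne (by positivity) (Ne.symm hx)
      -- By Cauchy–Schwarz r²g ≥ d, hence r²(g + kd) ≥ (1 + r²k)d; the same inequality gives the
      -- second claim.
      have : 0 ≤ ‖x‖ ^ 2 * (g + k x * d) := by nlinarith
      exact nonneg_of_mul_nonneg_right this hx'
  refine ⟨hnn, ?_⟩
  nlinarith

theorem enDens_nonneg (hk : IsCoef k) (u : M → ℂ) (p : M) : 0 ≤ enDens k u p := by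
  have h1 := (gradDens_bound hk p.2 fun i => pd (Sum.inr i) u p).1
  have h2 : 0 ≤ (1 + ‖p.2‖ ^ 2 * k p.2) * ‖pd (Sum.inl ()) u p‖ ^ 2 :=
    mul_nonneg (hk.pos p.2).le (by positivity)
  rw [enDens, add_assoc]
  exact add_nonneg h2 h1

end LogSharp

namespace LogSharp

/-! ### Integrals over slices -/

theorem Sm.add_apply (u v : Sm) (p : M) : ((u + v : Sm) : M → ℂ) p = (u : M → ℂ) p + (v : M → ℂ) p := rfl
theorem Sm.sub_apply (u v : Sm) (p : M) : ((u - v : Sm) : M → ℂ) p = (u : M → ℂ) p - (v : M → ℂ) p := rfl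
theorem Sm.mul_apply (u v : Sm) (p : M) : ((u * v : Sm) : M → ℂ) p = (u : M → ℂ) p * (v : M → ℂ) p := rfl
theorem Sm.smul_apply (c : ℂ) (v : Sm) (p : M) : ((c • v : Sm) : M → ℂ) p = c * (v : M → ℂ) p := rfl
theorem Sm.neg_apply (v : Sm) (p : M) : ((-v : Sm) : M → ℂ) p = -(v : M → ℂ) p := rfl

theorem Sm.sum_apply {ι : Type*} (s : Finset ι) (u : ι → Sm) (p : M) :
    ((∑ i ∈ s, u i : Sm) : M → ℂ) p = ∑ i ∈ s, (u i : M → ℂ) p := by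
  simp only [AddSubmonoidClass.coe_finsetSum, Finset.sum_apply]

theorem Sm.continuous_slice (u : Sm) (t : ℝ) : Continuous (fun x => (u : M → ℂ) (t, x)) :=
  (Sm.continuous u).comp (by fun_prop)

/-- `G` vanishes outside the ball of radius `R` on the slices near time `t`. -/
def SpatialSupport (G : Sm) (t R : ℝ) : Prop :=
  ∀ s, |s - t| < 1 → ∀ x : E3, R ≤ ‖x‖ → (G : M → ℂ) (s, x) = 0

theorem SpatialSupport.mul_right {G : Sm} {t R : ℝ} (h : SpatialSupport G t R) (u : Sm) :
    SpatialSupport (G * u) t R := fun s hs x hx => by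
  rw [Sm.mul_apply, h s hs x hx, zero_mul]

theorem SpatialSupport.hasCompactSupport {G : Sm} {t R : ℝ} (h : SpatialSupport G t R) :
    HasCompactSupport (fun x => (G : M → ℂ) (t, x)) :=
  HasCompactSupport.intro (isCompact_closedBall (0 : E3) R) fun x hx => h t (by simp) x (by
    simp only [Metric.mem_closedBall, dist_zero_right, not_le] at hx
    exact hx.le)

theorem SpatialSupport.integrable {G : Sm} {t R : ℝ} (h : SpatialSupport G t R) :
    Integrable (fun x => (G : M → ℂ) (t, x)) :=
  (Sm.continuous_slice G t).integrable_of_hasCompactSupport h.hasCompactSupport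

theorem hasDerivAt_time (G : Sm) (t : ℝ) (x : E3) :
    HasDerivAt (fun s => (G : M → ℂ) (s, x)) ((dt G : M → ℂ) (t, x)) t :=
  ((Sm.differentiable G) (t, x)).hasFDerivAt.comp_hasDerivAt t
    ((hasDerivAt_id t).prodMk (hasDerivAt_const t x))

theorem SpatialSupport.dt {G : Sm} {t R : ℝ} (h : SpatialSupport G t R) :
    SpatialSupport (dt G) t R := fun s hs x hx => by
  have h1 : (fun s => (G : M → ℂ) (s, x)) =ᶠ[𝓝 s] fun _ => 0 := by
    have : {r : ℝ | |r - t| < 1} ∈ 𝓝 s := (isOpen_lt (by fun_prop) continuous_const).mem_nhds hs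
    filter_upwards [this] with r hr using h r hr x hx
  exact (hasDerivAt_time G s x).unique ((hasDerivAt_const s (0 : ℂ)).congr_of_eventuallyEq h1)

theorem hasDerivAt_slice_integral {G : Sm} {t R : ℝ} (h : SpatialSupport G t R) :
    HasDerivAt (fun s => ∫ x, (G : M → ℂ) (s, x)) (∫ x, (dt G : M → ℂ) (t, x)) t := by
  have hK : IsCompact (Icc (t - 1 / 2) (t + 1 / 2) ×ˢ Metric.closedBall (0 : E3) R) :=
    isCompact_Icc.prod (isCompact_closedBall _ _)
  obtain ⟨C, hC⟩ := hK.exists_bound_of_continuousOn (Sm.continuous (LogSharp.dt G)).continuousOn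
  refine (hasDerivAt_integral_of_dominated_loc_of_deriv_le (μ := volume)
    (F := fun s x => (G : M → ℂ) (s, x)) (F' := fun s x => (LogSharp.dt G : M → ℂ) (s, x))
    (s := Icc (t - 1 / 2) (t + 1 / 2)) (Icc_mem_nhds (by linarith) (by linarith))
    (bound := (Metric.closedBall (0 : E3) R).indicator fun _ => C)
    (Eventually.of_forall fun s => (Sm.continuous_slice G s).aestronglyMeasurable) h.integrable
    (Sm.continuous_slice _ t).aestronglyMeasurable
    (Eventually.of_forall fun x s hs => ?_) ?_
    (Eventually.of_forall fun x s _ => hasDerivAt_time G s x)).2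
  · by_cases hx : x ∈ Metric.closedBall (0 : E3) R
    · rw [indicator_of_mem hx]
      exact hC (s, x) ⟨hs, hx⟩
    · rw [indicator_of_notMem hx]
      simp only [Metric.mem_closedBall, dist_zero_right, not_le] at hx
      rw [h.dt s (by rw [abs_lt]; constructor <;> linarith [hs.1, hs.2]) x hx.le, norm_zero]
  · exact (integrable_indicator_iff measurableSet_closedBall).2
      (integrableOn_const (by exact measure_closedBall_lt_top.ne))

/-- Integration by parts against the constant 1. -/
theorem integral_dx_eq_zero {G : Sm} {t R : ℝ} (h : SpatialSupport G t R) (i : Fin 3) :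
    ∫ x, (dx i G : M → ℂ) (t, x) = 0 := by
  have hc : ContDiff ℝ ∞ (fun x => (G : M → ℂ) (t, x)) :=
    (Sm.contDiff G).comp (contDiff_const.prodMk contDiff_id)
  have hd : ∀ x, (dx i G : M → ℂ) (t, x)
      = fderiv ℝ (fun x => (G : M → ℂ) (t, x)) x (EuclideanSpace.single i 1) := fun x => by
    have h1 := ((Sm.differentiable G) (t, x)).hasFDerivAt.comp x (hasFDerivAt_prodMk_right t x)
    have h2 : HasFDerivAt (fun x => (G : M → ℂ) (t, x)) _ x := h1
    rw [h2.fderiv, dd_apply, pd]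
    simp [e]
  have hcs : HasCompactSupport (fun x => (dx i G : M → ℂ) (t, x)) := by
    simp_rw [hd]
    exact h.hasCompactSupport.fderiv_apply ℝ _
  have key := integral_mul_fderiv_eq_neg_fderiv_mul_of_integrable (μ := (volume : Measure E3))
    (f := fun _ : E3 => (1 : ℂ)) (g := fun x => (G : M → ℂ) (t, x))
    (v := EuclideanSpace.single i 1) (by simp) (by
      simp only [one_mul]
      simp_rw [← hd]
      exact (Sm.continuous_slice _ t).integrable_of_hasCompactSupport hcs) (by
      simpa using h.integrable) (fun _ _ => differentiableAt_const _)
    (fun x _ => (hc.differentiable (by simp)).differentiableAt)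
  simp only [one_mul, fderiv_fun_const, Pi.zero_apply, zero_apply,
    zero_mul, integral_zero, neg_zero] at key
  simp_rw [hd]
  exact key

/-! ### The cone cutoff -/

/-- A smooth nonincreasing cutoff, `1` on `(-∞, 0]` and `0` on `[1, ∞)`. -/
noncomputable def coneEta (y : ℝ) : ℝ := 1 - Real.smoothTransition y

/-- `√(1 + |x|²)`. -/
noncomputable def bracket (x : E3) : ℝ := Real.sqrt (1 + ‖x‖ ^ 2)

theorem contDiff_coneEta : ContDiff ℝ ∞ coneEta := contDiff_const.sub Real.smoothTransition.contDiff

theorem contDiff_bracket : ContDiff ℝ ∞ bracket :=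
  (contDiff_const.add (contDiff_norm_sq ℝ)).sqrt fun x => by positivity

theorem bracket_sq (x : E3) : bracket x ^ 2 = 1 + ‖x‖ ^ 2 := Real.sq_sqrt (by positivity)

theorem bracket_pos (x : E3) : 0 < bracket x := Real.sqrt_pos.2 (by positivity)

theorem norm_le_bracket (x : E3) : ‖x‖ ≤ bracket x := Real.le_sqrt_of_sq_le (by linarith)

theorem bracket_le (x : E3) : bracket x ≤ 1 + ‖x‖ :=
  Real.sqrt_le_iff.2 ⟨by positivity, by nlinarith [norm_nonneg x]⟩

theorem coneEta_nonneg (y : ℝ) : 0 ≤ coneEta y := sub_nonneg.2 (Real.smoothTransition.le_one y)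

theorem coneEta_le_one (y : ℝ) : coneEta y ≤ 1 := sub_le_self _ (Real.smoothTransition.nonneg y)

theorem coneEta_of_nonpos {y : ℝ} (h : y ≤ 0) : coneEta y = 1 := by
  rw [coneEta, Real.smoothTransition.zero_of_nonpos h, sub_zero]

theorem coneEta_of_one_le {y : ℝ} (h : 1 ≤ y) : coneEta y = 0 := by
  rw [coneEta, Real.smoothTransition.one_of_one_le h, sub_self]

theorem deriv_coneEta_nonpos (y : ℝ) : deriv coneEta y ≤ 0 := by
  have : Antitone coneEta := fun a b h => sub_le_sub_left (Real.smoothTransition.monotone h) 1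
  exact this.deriv_nonpos

/-- The cutoff to the cone `√(1+|x|²) + εt ≤ c`. -/
noncomputable def coneFun (ε c : ℝ) (p : M) : ℝ := coneEta (bracket p.2 + ε * p.1 - c)

/-- The derivative of the profile in `coneFun`. -/
noncomputable def coneSlope (ε c : ℝ) (p : M) : ℝ := deriv coneEta (bracket p.2 + ε * p.1 - c)

theorem contDiff_coneFun (ε c : ℝ) : ContDiff ℝ ∞ (coneFun ε c) := by
  unfold coneFun
  exact contDiff_coneEta.comp (((contDiff_bracket.comp contDiff_snd).add
    (contDiff_const.mul contDiff_fst)).sub contDiff_const)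

/-- The cutoff `coneFun` as an element of `Sm`. -/
noncomputable def coneSm (ε c : ℝ) : Sm :=
  ⟨fun p => (coneFun ε c p : ℂ), Complex.ofRealCLM.contDiff.comp (contDiff_coneFun ε c)⟩

theorem hasFDerivAt_bracket (x : E3) :
    HasFDerivAt bracket ((bracket x)⁻¹ • innerSL ℝ x) x := by
  have h1 : HasFDerivAt (fun y : E3 => 1 + ‖y‖ ^ 2) (2 • innerSL ℝ x) x :=
    (hasStrictFDerivAt_norm_sq x).hasFDerivAt.const_add 1
  have h2 := h1.sqrt (by positivity)
  refine h2.congr_fderiv ?_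
  ext v
  have := (bracket_pos x).ne'
  simp only [_root_.smul_apply, nsmul_eq_mul, smul_eq_mul, bracket] at this ⊢
  field_simp
  simp

theorem hasFDerivAt_coneSm (ε c : ℝ) (p : M) : HasFDerivAt (coneSm ε c : M → ℂ)
    (Complex.ofRealCLM.comp (coneSlope ε c p • (((bracket p.2)⁻¹ • innerSL ℝ p.2).comp
      (ContinuousLinearMap.snd ℝ ℝ E3) + ε • ContinuousLinearMap.fst ℝ ℝ E3))) p := by
  have h1 : HasFDerivAt (fun q : M => bracket q.2 + ε * q.1 - c)
      (((bracket p.2)⁻¹ • innerSL ℝ p.2).comp (ContinuousLinearMap.snd ℝ ℝ E3)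
        + ε • ContinuousLinearMap.fst ℝ ℝ E3) p :=
    (((hasFDerivAt_bracket p.2).comp p hasFDerivAt_snd).add
      (hasFDerivAt_fst.const_mul ε)).sub_const c
  have h2 : HasDerivAt coneEta (coneSlope ε c p) (bracket p.2 + ε * p.1 - c) :=
    ((contDiff_coneEta.differentiable (by simp)) _).hasDerivAt
  have h3 : HasFDerivAt (coneEta ∘ fun q : M => bracket q.2 + ε * q.1 - c) _ p :=
    HasDerivAt.comp_hasFDerivAt (h₂ := coneEta) p h2 h1
  exact Complex.ofRealCLM.hasFDerivAt.comp p h3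

theorem dt_coneSm (ε c : ℝ) (p : M) : (dt (coneSm ε c) : M → ℂ) p = (ε * coneSlope ε c p : ℝ) := by
  rw [dd_apply, pd, (hasFDerivAt_coneSm ε c p).fderiv]
  simp [e]; ring

theorem dx_coneSm (ε c : ℝ) (i : Fin 3) (p : M) :
    (dx i (coneSm ε c) : M → ℂ) p = (coneSlope ε c p * ((bracket p.2)⁻¹ * p.2 i) : ℝ) := by
  rw [dd_apply, pd, (hasFDerivAt_coneSm ε c p).fderiv]
  simp [e, EuclideanSpace.inner_single_right]

theorem spatialSupport_coneSm (ε c t : ℝ) : SpatialSupport (coneSm ε c) t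
    (1 + c + |ε| * (|t| + 1)) := fun s hs x hx => by
  change ((coneFun ε c (s, x) : ℝ) : ℂ) = 0
  rw [coneFun, coneEta_of_one_le, Complex.ofReal_zero]
  have h1 : |s| ≤ |t| + 1 := by
    have := abs_sub_abs_le_abs_sub s t
    linarith
  have h2 : -(ε * s) ≤ |ε| * (|t| + 1) := (neg_le_abs _).trans (by rw [abs_mul]; gcongr)
  have h3 := norm_le_bracket x
  simp only
  linarith

/-! ### The local energy inequality -/

variable {k : E3 → ℝ}

/-- The vector x is an eigenvector of 1 + κxxᵀ with eigenvalue 1 + r²κ = ρ. -/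
theorem sum_coord_flux (hk : IsCoef k) (u v : Sm) :
    ∑ i, X i * flux (kSm hk) u v i = rSm hk * (dt v * Eu u + dt u * Eu v) := by
  have h : rSm hk = 1 + R2 * kSm hk := by
    ext p
    rw [Sm.add_apply, Sm.mul_apply, R2_apply, rSm, kSm, liftR_apply, liftR_apply]
    push_cast
    rfl
  rw [h]
  simp only [flux, Eu_apply, R2, Fin.sum_univ_three]
  ring

/-- The operator `ρ∂_t² - div((1 + κxxᵀ)∇)`. -/
noncomputable def waveOp (hk : IsCoef k) (u : Sm) : Sm := rSm hk * dt (dt u) - ellOp (kSm hk) u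

theorem cj_rSm (hk : IsCoef k) : cj (rSm hk) = rSm hk := cj_liftR _ _
theorem cj_kSm (hk : IsCoef k) : cj (kSm hk) = kSm hk := cj_liftR _ _

theorem waveOp_cj (hk : IsCoef k) (u : Sm) : waveOp hk (cj u) = cj (waveOp hk u) := by
  rw [waveOp, waveOp, map_sub, map_mul, cj_rSm, ellOp_cj (cj_kSm hk), dd_cj, dd_cj]

/-- The energy in the cone. -/
noncomputable def coneEnergy (k : E3 → ℝ) (u : Sm) (ε c t : ℝ) : ℝ :=
  ∫ x, coneFun ε c (t, x) * enDens k u (t, x)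

theorem coneSm_mul_energyForm (hk : IsCoef k) (u : Sm) (ε c : ℝ) (p : M) :
    ((coneSm ε c * energyForm (rSm hk) (kSm hk) u (cj u) : Sm) : M → ℂ) p
      = ((coneFun ε c p * enDens k u p : ℝ) : ℂ) := by
  rw [Sm.mul_apply, ofReal_enDens hk, Complex.ofReal_mul]
  rfl

theorem integrable_cone_energy (hk : IsCoef k) (u : Sm) (ε c t : ℝ) :
    Integrable (fun x => coneFun ε c (t, x) * enDens k u (t, x)) := by
  have h := ((spatialSupport_coneSm ε c t).mul_right (energyForm (rSm hk) (kSm hk) u (cj u))).integrable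
  simp only [coneSm_mul_energyForm hk] at h
  exact h.re

/-- The radial component of the metric is 1, so waves have radial speed at most 1 and the energy
density dominates the flux through the cone. The bracket √(1+r²) smooths r and has slope at most 1.
The first claim says that the flux is real. -/
theorem radial_flux_le (hk : IsCoef k) (u : Sm) (p : M) {ε : ℝ} (hε : |ε| = 1) :
    ε * (bracket p.2)⁻¹ * ((rSm hk * (dt (cj u) * Eu u + dt u * Eu (cj u)) : Sm) : M → ℂ) p
      = ((ε * (bracket p.2)⁻¹ * ((rSm hk * (dt (cj u) * Eu u + dt u * Eu (cj u)) : Sm) : M → ℂ) p).re : ℂ)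
    ∧ (ε * (bracket p.2)⁻¹ * ((rSm hk * (dt (cj u) * Eu u + dt u * Eu (cj u)) : Sm) : M → ℂ) p).re
      ≤ enDens k u p := by
  set a := (dt u : M → ℂ) p with ha
  set b := (Eu u : M → ℂ) p with hb
  have hv : ((rSm hk * (dt (cj u) * Eu u + dt u * Eu (cj u)) : Sm) : M → ℂ) p
      = ((1 + ‖p.2‖ ^ 2 * k p.2 : ℝ) : ℂ) * ((2 * ((starRingEnd ℂ) a * b).re : ℝ) : ℂ) := by
    rw [Sm.mul_apply, Sm.add_apply, Sm.mul_apply, Sm.mul_apply, dd_cj, Eu_cj, cj_apply, cj_apply,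
      ← ha, ← hb]
    congr 1
    rw [Complex.ofReal_mul, Complex.ofReal_ofNat, Complex.re_eq_add_conj]
    simp
    ring
  rw [hv]
  have hreal : (ε * (bracket p.2)⁻¹ * (((1 + ‖p.2‖ ^ 2 * k p.2 : ℝ) : ℂ)
      * ((2 * ((starRingEnd ℂ) a * b).re : ℝ) : ℂ)) : ℂ)
      = ((ε * (bracket p.2)⁻¹ * ((1 + ‖p.2‖ ^ 2 * k p.2) * (2 * ((starRingEnd ℂ) a * b).re)) : ℝ) : ℂ) := by
    push_cast; ring
  rw [hreal, Complex.ofReal_re]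
  refine ⟨rfl, ?_⟩
  have h1 := (gradDens_bound hk p.2 fun i => pd (Sum.inr i) u p).2
  have hE : b = ∑ i, (p.2 i : ℂ) * pd (Sum.inr i) u p := by
    rw [hb, Eu_apply, Fin.sum_univ_three]
    rfl
  rw [← bracket_sq, ← hE] at h1
  have hN := bracket_pos p.2
  have hρ := hk.pos p.2
  have hre : |((starRingEnd ℂ) a * b).re| ≤ ‖a‖ * ‖b‖ := by
    refine (Complex.abs_re_le_norm _).trans (le_of_eq ?_)
    rw [norm_mul, RCLike.norm_conj]
  rw [enDens, ← hE, add_assoc]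
  set gr := ∑ i, ‖pd (Sum.inr i) (u : M → ℂ) p‖ ^ 2 + k p.2 * ‖b‖ ^ 2
  change _ ≤ (1 + ‖p.2‖ ^ 2 * k p.2) * ‖a‖ ^ 2 + gr
  set ρ := 1 + ‖p.2‖ ^ 2 * k p.2
  set N := bracket p.2
  have h2 : ρ * (N⁻¹ * ‖b‖) ^ 2 ≤ gr := by
    have : ρ * (N⁻¹ * ‖b‖) ^ 2 = (ρ * ‖b‖ ^ 2) / N ^ 2 := by field_simp
    rw [this, div_le_iff₀ (by positivity)]
    linarith
  calc ε * N⁻¹ * (ρ * (2 * ((starRingEnd ℂ) a * b).re))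
      ≤ |ε * N⁻¹ * (ρ * (2 * ((starRingEnd ℂ) a * b).re))| := le_abs_self _
    _ = ρ * (2 * (N⁻¹ * |((starRingEnd ℂ) a * b).re|)) := by
        rw [abs_mul, abs_mul, abs_mul, abs_mul, hε, abs_of_pos (inv_pos.2 hN), abs_of_pos hρ]
        norm_num; ring
    _ ≤ ρ * (2 * (N⁻¹ * (‖a‖ * ‖b‖))) := by gcongr
    _ ≤ ρ * (‖a‖ ^ 2 + (N⁻¹ * ‖b‖) ^ 2) := by
        gcongr
        nlinarith [sq_nonneg (‖a‖ - N⁻¹ * ‖b‖)]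
    _ ≤ _ := by rw [mul_add]; linarith

/-- The time derivative of the energy in the cone is controlled by the inhomogeneity. -/
theorem coneEnergy_deriv (hk : IsCoef k) (u : Sm) {ε : ℝ} (hε : |ε| = 1) (c t : ℝ) :
    ∃ d, HasDerivAt (coneEnergy k u ε c) d t ∧
      ε * d ≤ ε * ∫ x, coneFun ε c (t, x)
        * (2 * ((starRingEnd ℂ) ((dt u : M → ℂ) (t, x)) * (waveOp hk u : M → ℂ) (t, x)).re) := by
  set φ := coneSm ε c with hφ
  set En := energyForm (rSm hk) (kSm hk) u (cj u) with hEn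
  have hS := spatialSupport_coneSm ε c t
  rw [← hφ] at hS
  have h1 := hasDerivAt_slice_integral (hS.mul_right En)
  have h2 : ∀ s, ∫ x, ((φ * En : Sm) : M → ℂ) (s, x) = (coneEnergy k u ε c s : ℂ) := fun s => by
    simp only [hφ, hEn, coneSm_mul_energyForm hk]
    rw [integral_complex_ofReal]; rfl
  simp only [h2] at h1
  have h3 := Complex.reCLM.hasFDerivAt.comp_hasDerivAt t h1
  have h4 : HasDerivAt (coneEnergy k u ε c) (∫ x, (dt (φ * En) : M → ℂ) (t, x)).re t := h3
  refine ⟨_, h4, ?_⟩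
  have hE : dt En = waveOp hk u * cj (dt u) + dt u * cj (waveOp hk u)
      + ∑ i, dx i (flux (kSm hk) u (cj u) i) := by
    have hr0 : dt (rSm hk) = 0 := dt_lift _ _
    have hk0 : dt (kSm hk) = 0 := dt_lift _ _
    rw [hEn, dt_energyForm hr0 hk0, ← waveOp_cj, ← dd_cj]
    rfl
  let W : Sm := waveOp hk u * cj (dt u) + dt u * cj (waveOp hk u)
  let V : Fin 3 → Sm := flux (kSm hk) u (cj u)
  -- Three pieces: the terms with derivatives of the cutoff, the inhomogeneity, and a divergence
  -- that integrates to zero.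
  have hG : dt (φ * En) = (En * dt φ - ∑ i, dx i φ * V i) + φ * W + ∑ i, dx i (φ * V i) := by
    rw [Derivation.leibniz, hE]
    simp only [Derivation.leibniz, smul_eq_mul, Finset.sum_add_distrib, mul_add, W, V, Finset.mul_sum]
    have : ∀ i, flux (kSm hk) u (cj u) i * dx i φ = dx i φ * flux (kSm hk) u (cj u) i :=
      fun i => mul_comm _ _
    simp only [this]
    ring
  let A : Sm := En * dt φ - ∑ i, dx i φ * V i
  -- The cutoff depends on bracket + εt only, so its derivatives share the factor `coneSlope` and
  -- its spatial gradient is radial.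
  have hAval : ∀ x, (A : M → ℂ) (t, x) = ((coneSlope ε c (t, x) * (ε * enDens k u (t, x)
      - ε * (ε * (bracket x)⁻¹ * ((rSm hk * (dt (cj u) * Eu u + dt u * Eu (cj u)) : Sm) : M → ℂ) (t, x)).re) : ℝ) : ℂ) := by
    intro x
    have hr := (radial_flux_le hk u (t, x) hε).1
    have hε2 : (ε : ℂ) * ε = 1 := by
      rw [← Complex.ofReal_mul, ← abs_mul_abs_self, hε]; simp
    rw [Complex.ofReal_mul, Complex.ofReal_sub, Complex.ofReal_mul, Complex.ofReal_mul, ← hr,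
      ← sum_coord_flux]
    simp only [A, V, hEn, hφ, Sm.add_apply, Sm.sub_apply, Sm.mul_apply, dt_coneSm, dx_coneSm,
      ofReal_enDens hk, Fin.sum_univ_three, X_apply]
    push_cast
    linear_combination (-(coneSlope ε c (t, x) : ℂ) * (bracket x : ℂ)⁻¹ *
      ((x 0 : ℂ) * (flux (kSm hk) u (cj u) 0 : M → ℂ) (t, x)
      + (x 1 : ℂ) * (flux (kSm hk) u (cj u) 1 : M → ℂ) (t, x)
      + (x 2 : ℂ) * (flux (kSm hk) u (cj u) 2 : M → ℂ) (t, x))) * -hε2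
  have hWval : ∀ x, ((φ * W : Sm) : M → ℂ) (t, x) = ((coneFun ε c (t, x)
        * (2 * ((starRingEnd ℂ) ((dt u : M → ℂ) (t, x)) * (waveOp hk u : M → ℂ) (t, x)).re) : ℝ) : ℂ) := by
    intro x
    rw [Complex.ofReal_mul, Complex.ofReal_mul, Complex.ofReal_ofNat, Complex.re_eq_add_conj]
    simp only [W, Sm.mul_apply, Sm.add_apply, cj_apply]
    change (coneFun ε c (t, x) : ℂ) * _ = _
    congr 1
    simp
    ring
  have hAs : SpatialSupport A t (1 + c + |ε| * (|t| + 1)) := fun s hs x hx => by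
    have hdx : ∀ i, (dx i φ : M → ℂ) (s, x) = 0 := fun i => by
      have hsl : coneSlope ε c (s, x) = 0 := by
        have hz := hS.dt s hs x hx
        rw [dt_coneSm, Complex.ofReal_eq_zero, mul_eq_zero] at hz
        refine hz.resolve_left fun h0 => ?_
        rw [h0, abs_zero] at hε
        exact zero_ne_one hε
      rw [hφ, dx_coneSm, hsl, zero_mul, Complex.ofReal_zero]
    have h0 : (dt φ : M → ℂ) (s, x) = 0 := hS.dt s hs x hx
    simp only [A, Sm.sub_apply, Sm.mul_apply, Sm.sum_apply, hdx, h0]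
    simp
  have hint : ∫ x, (dt (φ * En) : M → ℂ) (t, x)
      = (∫ x, (A : M → ℂ) (t, x)) + ∫ x, ((φ * W : Sm) : M → ℂ) (t, x) := by
    rw [hG]
    change ∫ x, ((A + φ * W + ∑ i, dx i (φ * V i) : Sm) : M → ℂ) (t, x) = _
    simp only [Sm.add_apply _ (∑ i, dx i (φ * V i)), Sm.add_apply A, Sm.sum_apply]
    have hdi : ∀ i, Integrable (fun x => (dx i (φ * V i) : M → ℂ) (t, x)) := fun i => by
      refine (Sm.continuous_slice _ t).integrable_of_hasCompactSupport ?_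
      refine HasCompactSupport.intro (isCompact_closedBall (0 : E3) (1 + c + |ε| * (|t| + 1)))
        fun x hx => ?_
      simp only [Metric.mem_closedBall, dist_zero_right, not_le] at hx
      have hsl : coneSlope ε c (t, x) = 0 := by
        have hz := hS.dt t (by simp) x hx.le
        rw [dt_coneSm, Complex.ofReal_eq_zero, mul_eq_zero] at hz
        refine hz.resolve_left fun h0 => ?_
        rw [h0, abs_zero] at hε
        exact zero_ne_one hε
      have hz2 := hS t (by simp) x hx.le
      rw [Derivation.leibniz, Sm.add_apply, smul_eq_mul, smul_eq_mul, Sm.mul_apply, Sm.mul_apply,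
        hφ, dx_coneSm, hsl, hz2]
      simp
    rw [integral_add (f := fun x => (A : M → ℂ) (t, x) + ((φ * W : Sm) : M → ℂ) (t, x))
      (hAs.integrable.add (hS.mul_right W).integrable)
      (integrable_finsetSum _ fun i _ => hdi i), integral_add hAs.integrable (hS.mul_right W).integrable,
      integral_finsetSum _ fun i _ => hdi i]
    simp only [integral_dx_eq_zero (hS.mul_right (V _)), Finset.sum_const_zero, add_zero]
  rw [hint]
  simp only [hAval, hWval]
  rw [integral_complex_ofReal, integral_complex_ofReal, ← Complex.ofReal_add, Complex.ofReal_re, mul_add]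
  -- The profile decreases and the density dominates the flux, so the boundary term has the
  -- favourable sign.
  have hneg : ε * ∫ x, (coneSlope ε c (t, x) * (ε * enDens k u (t, x)
      - ε * (ε * (bracket x)⁻¹ * ((rSm hk * (dt (cj u) * Eu u + dt u * Eu (cj u)) : Sm) : M → ℂ) (t, x)).re)) ≤ 0 := by
    rw [← integral_const_mul]
    refine integral_nonpos fun x => ?_
    have hr := (radial_flux_le hk u (t, x) hε).2
    have hs : coneSlope ε c (t, x) ≤ 0 := deriv_coneEta_nonpos _
    have hε2 : ε * ε = 1 := by rw [← abs_mul_abs_self, hε, one_mul]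
    have : ∀ a b d : ℝ, ε * (a * (ε * b - ε * d)) = a * (b - d) := fun a b d => by
      linear_combination (a * (b - d)) * hε2
    simp only [Pi.zero_apply, this]
    exact mul_nonpos_of_nonpos_of_nonneg hs (sub_nonneg.2 hr)
  linarith

end LogSharp

namespace LogSharp

/-! ### Energy estimates and uniqueness -/

variable {k : E3 → ℝ}

theorem continuous_enDens_slice (hk : IsCoef k) (u : Sm) (t : ℝ) :
    Continuous fun x => enDens k u (t, x) := by
  have h := Complex.continuous_re.comp
    (Sm.continuous_slice (energyForm (rSm hk) (kSm hk) u (cj u)) t)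
  refine h.congr fun x => ?_
  simp only [Function.comp_apply, ofReal_enDens hk, Complex.ofReal_re]

theorem coneFun_nonneg (ε c : ℝ) (p : M) : 0 ≤ coneFun ε c p := coneEta_nonneg _

theorem coneFun_le_one (ε c : ℝ) (p : M) : coneFun ε c p ≤ 1 := coneEta_le_one _

theorem coneFun_eq_one {ε c : ℝ} {p : M} (h : 1 + ‖p.2‖ + ε * p.1 ≤ c) : coneFun ε c p = 1 :=
  coneEta_of_nonpos (by linarith [bracket_le p.2])

theorem coneEnergy_nonneg (hk : IsCoef k) (u : Sm) (ε c t : ℝ) : 0 ≤ coneEnergy k u ε c t :=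
  integral_nonneg fun _ => mul_nonneg (coneFun_nonneg _ _ _) (enDens_nonneg hk _ _)

/-- The choice ε = 1 gives monotonicity towards the future and ε = −1 towards the past. -/
theorem coneEnergy_le (hk : IsCoef k) (u : Sm) {t₁ t₂ : ℝ}
    (hw : ∀ s ∈ uIcc t₁ t₂, ∀ x, (waveOp hk u : M → ℂ) (s, x) = 0) {ε : ℝ} (hε : |ε| = 1)
    (hε' : 0 ≤ ε * (t₂ - t₁)) (c : ℝ) : coneEnergy k u ε c t₂ ≤ coneEnergy k u ε c t₁ := by
  choose d hd hd' using coneEnergy_deriv hk u hε c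
  have hle : ∀ s ∈ uIcc t₁ t₂, ε * d s ≤ 0 := fun s hs => by
    refine (hd' s).trans (le_of_eq ?_)
    simp only [hw s hs]
    simp
  have hcont : ∀ S, ContinuousOn (coneEnergy k u ε c) S := fun S s _ =>
    (hd s).continuousAt.continuousWithinAt
  rcases eq_or_eq_neg_of_abs_eq hε with rfl | rfl
  · have h12 : t₁ ≤ t₂ := by linarith
    rw [uIcc_of_le h12] at hle
    refine antitoneOn_of_deriv_nonpos (convex_Icc t₁ t₂) (hcont _)
      (fun s _ => (hd s).differentiableAt.differentiableWithinAt) (fun s hs => ?_)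
      (left_mem_Icc.2 h12) (right_mem_Icc.2 h12) h12
    rw [(hd s).deriv]
    linarith [hle s (interior_subset hs)]
  · have h12 : t₂ ≤ t₁ := by linarith
    rw [uIcc_of_ge h12] at hle
    refine monotoneOn_of_deriv_nonneg (convex_Icc t₂ t₁) (hcont _)
      (fun s _ => (hd s).differentiableAt.differentiableWithinAt) (fun s hs => ?_)
      (left_mem_Icc.2 h12) (right_mem_Icc.2 h12) h12
    rw [(hd s).deriv]
    linarith [hle s (interior_subset hs)]

/-- The total energy of a solution does not increase, in either time direction. -/
theorem lintegral_enDens_le (hk : IsCoef k) (u : Sm) {t₁ t₂ : ℝ}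
    (hw : ∀ s ∈ uIcc t₁ t₂, ∀ x, (waveOp hk u : M → ℂ) (s, x) = 0) :
    ∫⁻ x, ENNReal.ofReal (enDens k u (t₂, x)) ≤ ∫⁻ x, ENNReal.ofReal (enDens k u (t₁, x)) := by
  obtain ⟨ε, hε, hε'⟩ : ∃ ε : ℝ, |ε| = 1 ∧ 0 ≤ ε * (t₂ - t₁) := by
    rcases le_total t₁ t₂ with h | h
    · exact ⟨1, by simp, by linarith⟩
    · exact ⟨-1, by simp, by linarith⟩
  have hcone : ∀ c t, ENNReal.ofReal (coneEnergy k u ε c t)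
      = ∫⁻ x, ENNReal.ofReal (coneFun ε c (t, x) * enDens k u (t, x)) := fun c t =>
    ofReal_integral_eq_lintegral_ofReal (integrable_cone_energy hk u ε c t)
      (Eventually.of_forall fun _ => mul_nonneg (coneFun_nonneg _ _ _) (enDens_nonneg hk _ _))
  -- The cone constant 1 + n + εt₂ makes the cutoff equal to 1 on the ball of radius n at time t₂;
  -- the balls then exhaust space.
  have hball : ∀ n : ℕ, ∫⁻ x in Metric.closedBall (0 : E3) n, ENNReal.ofReal (enDens k u (t₂, x))
      ≤ ∫⁻ x, ENNReal.ofReal (enDens k u (t₁, x)) := fun n => by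
    calc ∫⁻ x in Metric.closedBall (0 : E3) n, ENNReal.ofReal (enDens k u (t₂, x))
        ≤ ∫⁻ x in Metric.closedBall (0 : E3) n,
          ENNReal.ofReal (coneFun ε (1 + n + ε * t₂) (t₂, x) * enDens k u (t₂, x)) := by
          refine setLIntegral_mono' measurableSet_closedBall fun x hx => ?_
          rw [coneFun_eq_one, one_mul]
          have := mem_closedBall_zero_iff.1 hx
          simp only
          linarith
      _ ≤ ∫⁻ x, ENNReal.ofReal (coneFun ε (1 + n + ε * t₂) (t₂, x) * enDens k u (t₂, x)) :=
          setLIntegral_le_lintegral _ _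
      _ ≤ ∫⁻ x, ENNReal.ofReal (coneFun ε (1 + n + ε * t₂) (t₁, x) * enDens k u (t₁, x)) := by
          rw [← hcone, ← hcone]
          exact ENNReal.ofReal_le_ofReal (coneEnergy_le hk u hw hε hε' _)
      _ ≤ _ := lintegral_mono fun x => ENNReal.ofReal_le_ofReal
          (mul_le_of_le_one_left (enDens_nonneg hk _ _) (coneFun_le_one _ _ _))
  have hdir : Directed (· ⊆ ·) fun n : ℕ => Metric.closedBall (0 : E3) n :=
    Monotone.directed_le fun m n h => Metric.closedBall_subset_closedBall (by exact_mod_cast h)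
  rw [← setLIntegral_univ, ← Metric.iUnion_closedBall_nat (0 : E3),
    setLIntegral_iUnion_of_directed _ hdir]
  exact iSup_le hball

theorem enDens_zero_ge (u : Sm) (p : M) : ‖(dt u : M → ℂ) p‖ ^ 2 ≤ enDens (fun _ => 0) u p := by
  rw [enDens, dd_apply]
  simp only [mul_zero, add_zero, one_mul, zero_mul]
  exact le_add_of_nonneg_right (by positivity)

/-- The flat energy in the cone, with a zeroth order term. -/
noncomputable def coneMass (u : Sm) (ε c t : ℝ) : ℝ :=
  ∫ x, coneFun ε c (t, x) * ‖(u : M → ℂ) (t, x)‖ ^ 2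

theorem coneSm_mul_sq (u : Sm) (ε c : ℝ) (p : M) :
    ((coneSm ε c * (u * cj u) : Sm) : M → ℂ) p = ((coneFun ε c p * ‖(u : M → ℂ) p‖ ^ 2 : ℝ) : ℂ) := by
  rw [Sm.mul_apply, Sm.mul_apply, cj_apply, Complex.mul_conj, Complex.normSq_eq_norm_sq,
    Complex.ofReal_mul]
  rfl

theorem integrable_coneMass (u : Sm) (ε c t : ℝ) :
    Integrable (fun x => coneFun ε c (t, x) * ‖(u : M → ℂ) (t, x)‖ ^ 2) := by
  have h := ((spatialSupport_coneSm ε c t).mul_right (u * cj u)).integrable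
  simp only [coneSm_mul_sq] at h
  exact h.re

/-- The cutoff term has a good sign, and 2 Re(u ∂_tū) ≤ |u|² + |∂_tu|². -/
theorem coneMass_deriv (u : Sm) {ε : ℝ} (hε : |ε| = 1) (c t : ℝ) :
    ∃ d, HasDerivAt (coneMass u ε c) d t ∧
      ε * d ≤ coneMass u ε c t + ∫ x, coneFun ε c (t, x) * ‖(dt u : M → ℂ) (t, x)‖ ^ 2 := by
  have hS := spatialSupport_coneSm ε c t
  have h1 := hasDerivAt_slice_integral (hS.mul_right (u * cj u))
  have h2 : ∀ s, ∫ x, ((coneSm ε c * (u * cj u) : Sm) : M → ℂ) (s, x) = (coneMass u ε c s : ℂ) :=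
    fun s => by
      simp only [coneSm_mul_sq]
      rw [integral_complex_ofReal]; rfl
  simp only [h2] at h1
  have h3 : ∀ x, (dt (coneSm ε c * (u * cj u)) : M → ℂ) (t, x)
      = ((ε * coneSlope ε c (t, x) * ‖(u : M → ℂ) (t, x)‖ ^ 2
        + coneFun ε c (t, x) * (2 * ((u : M → ℂ) (t, x) * (starRingEnd ℂ) ((dt u : M → ℂ) (t, x))).re) : ℝ) : ℂ) := by
    intro x
    rw [Derivation.leibniz, Derivation.leibniz, smul_eq_mul, smul_eq_mul, smul_eq_mul, smul_eq_mul,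
      dd_cj, Complex.ofReal_add, Complex.ofReal_mul (coneFun ε c (t, x)), Complex.ofReal_mul 2,
      Complex.ofReal_ofNat, Complex.re_eq_add_conj]
    simp only [Sm.add_apply, Sm.mul_apply, cj_apply, dt_coneSm]
    rw [Complex.mul_conj, Complex.normSq_eq_norm_sq]
    change (coneFun ε c (t, x) : ℂ) * _ + _ = _
    push_cast
    simp
    ring
  have hi := ((hS.mul_right (u * cj u)).dt).integrable
  simp only [h3] at h1 hi
  rw [integral_complex_ofReal] at h1
  have h4 : HasDerivAt (coneMass u ε c) _ t :=
    Complex.reCLM.hasFDerivAt.comp_hasDerivAt t h1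
  refine ⟨_, h4, ?_⟩
  rw [coneMass, ← integral_add (integrable_coneMass u ε c t) (integrable_coneMass (dt u) ε c t)]
  change ε * (∫ x, _ : ℝ) ≤ _
  rw [← integral_const_mul]
  have hir : Integrable fun x => ε * coneSlope ε c (t, x) * ‖(u : M → ℂ) (t, x)‖ ^ 2
        + coneFun ε c (t, x) * (2 * ((u : M → ℂ) (t, x) * (starRingEnd ℂ) ((dt u : M → ℂ) (t, x))).re) :=
    hi.re
  refine integral_mono (hir.const_mul ε)
    ((integrable_coneMass u ε c t).add (integrable_coneMass (dt u) ε c t)) fun x => ?_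
  have hs : coneSlope ε c (t, x) ≤ 0 := deriv_coneEta_nonpos _
  have hf := coneFun_nonneg ε c (t, x)
  have hε2 : ε * ε = 1 := by rw [← abs_mul_abs_self, hε, one_mul]
  set a := (u : M → ℂ) (t, x)
  set b := (dt u : M → ℂ) (t, x)
  have hre : |(a * (starRingEnd ℂ) b).re| ≤ ‖a‖ * ‖b‖ := by
    refine (Complex.abs_re_le_norm _).trans (le_of_eq ?_)
    rw [norm_mul, RCLike.norm_conj]
  have h5 : ε * (2 * (a * (starRingEnd ℂ) b).re) ≤ ‖a‖ ^ 2 + ‖b‖ ^ 2 := by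
    have : ε * (a * (starRingEnd ℂ) b).re ≤ |(a * (starRingEnd ℂ) b).re| := by
      refine (le_abs_self _).trans (le_of_eq ?_)
      rw [abs_mul, hε, one_mul]
    nlinarith [sq_nonneg (‖a‖ - ‖b‖)]
  have h6 : coneSlope ε c (t, x) * ‖a‖ ^ 2 ≤ 0 := mul_nonpos_of_nonpos_of_nonneg hs (by positivity)
  have h7 := mul_le_mul_of_nonneg_left h5 hf
  have h8 : ε * (ε * coneSlope ε c (t, x) * ‖a‖ ^ 2
      + coneFun ε c (t, x) * (2 * (a * (starRingEnd ℂ) b).re))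
      = coneSlope ε c (t, x) * ‖a‖ ^ 2 + coneFun ε c (t, x) * (ε * (2 * (a * (starRingEnd ℂ) b).re)) := by
    linear_combination (coneSlope ε c (t, x) * ‖a‖ ^ 2) * hε2
  simp only
  rw [h8]
  linarith

theorem waveOp_zero (u : Sm) : waveOp isCoef_zero u = dt (dt u) - lap u := by
  have hr : rSm isCoef_zero = 1 := by
    ext p
    rw [rSm, liftR_apply]
    simp
  have hk : kSm isCoef_zero = 0 := by
    ext p
    rw [kSm, liftR_apply]
    simp
  rw [waveOp, hr, hk, ellOp_eq]
  simp

/-- Uniqueness for the flat wave equation with a bounded potential. -/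
theorem eq_zero_of_wave {u q : Sm} {B : ℝ} (hq : ∀ p, ‖(q : M → ℂ) p‖ ≤ B)
    (hu : dt (dt u) = lap u - q * u) (h₀ : VanishAtZero u) (h₁ : VanishAtZero (dt u)) : u = 0 := by
  have hB : 0 ≤ B := (norm_nonneg _).trans (hq 0)
  have hW : waveOp isCoef_zero u = -(q * u) := by rw [waveOp_zero, hu]; ring
  have key : ∀ ε : ℝ, |ε| = 1 → ∀ s, 0 ≤ s → ∀ c, coneMass u ε c (ε * s) = 0 := by
    intro ε hε s hs c
    have hε2 : ε * ε = 1 := by rw [← abs_mul_abs_self, hε, one_mul]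
    choose d hd hd' using coneEnergy_deriv isCoef_zero u hε c
    choose d₂ hd₂ hd₂' using coneMass_deriv u hε c
    -- The mass is added because the potential term is controlled by u, which the energy alone does
    -- not see.
    let J : ℝ → ℝ := fun t => coneEnergy (fun _ => 0) u ε c t + coneMass u ε c t
    have hm : ∀ t, 0 ≤ coneMass u ε c t := fun t => integral_nonneg fun x =>
      mul_nonneg (coneFun_nonneg _ _ _) (by positivity)
    have hut : ∀ t, ∫ x, coneFun ε c (t, x) * ‖(dt u : M → ℂ) (t, x)‖ ^ 2
        ≤ coneEnergy (fun _ => 0) u ε c t := fun t =>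
      integral_mono (integrable_coneMass (dt u) ε c t) (integrable_cone_energy isCoef_zero u ε c t)
        fun x => mul_le_mul_of_nonneg_left (enDens_zero_ge u _) (coneFun_nonneg _ _ _)
    have hbd : ∀ t, ε * (d t + d₂ t) ≤ (B + 1) * J t := by
      intro t
      have h1 : ε * ∫ x, coneFun ε c (t, x)
          * (2 * ((starRingEnd ℂ) ((dt u : M → ℂ) (t, x)) * (waveOp isCoef_zero u : M → ℂ) (t, x)).re)
          ≤ B * (coneMass u ε c t + ∫ x, coneFun ε c (t, x) * ‖(dt u : M → ℂ) (t, x)‖ ^ 2) := by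
        refine (le_abs_self _).trans ?_
        rw [abs_mul, hε, one_mul, coneMass, ← integral_add (integrable_coneMass u ε c t)
          (integrable_coneMass (dt u) ε c t), ← integral_const_mul]
        refine (abs_integral_le_integral_abs).trans ?_
        refine integral_mono_of_nonneg (Eventually.of_forall fun x => abs_nonneg _)
          (((integrable_coneMass u ε c t).add (integrable_coneMass (dt u) ε c t)).const_mul B)
          (Eventually.of_forall fun x => ?_)
        have hf := coneFun_nonneg ε c (t, x)
        simp only [hW, Sm.neg_apply, Sm.mul_apply]
        set a := (u : M → ℂ) (t, x)
        set b := (dt u : M → ℂ) (t, x)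
        have h5 : |(2 * ((starRingEnd ℂ) b * -((q : M → ℂ) (t, x) * a)).re)|
            ≤ B * (‖a‖ ^ 2 + ‖b‖ ^ 2) := by
          rw [abs_mul, abs_two]
          have : |((starRingEnd ℂ) b * -((q : M → ℂ) (t, x) * a)).re| ≤ B * (‖a‖ * ‖b‖) := by
            refine (Complex.abs_re_le_norm _).trans ?_
            rw [norm_mul, RCLike.norm_conj, norm_neg, norm_mul]
            have := mul_le_mul_of_nonneg_right (hq (t, x)) (mul_nonneg (norm_nonneg a) (norm_nonneg b))
            linarith
          nlinarith [mul_nonneg hB (sq_nonneg (‖a‖ - ‖b‖))]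
        rw [abs_mul, abs_of_nonneg hf]
        have := mul_le_mul_of_nonneg_left h5 hf
        linarith
      have h2 := hd' t
      have h3 := hd₂' t
      have h4 := hut t
      have h5 := mul_le_mul_of_nonneg_left h4 hB
      have h6 := hm t
      have h7 := coneEnergy_nonneg isCoef_zero u ε c t
      simp only [J]
      nlinarith
    have hJ0 : J 0 = 0 := by
      have e1 : ∀ x, enDens (fun _ => 0) u ((0 : ℝ), x) = 0 := fun x => by
        have ht : pd (Sum.inl ()) (u : M → ℂ) ((0 : ℝ), x) = 0 := h₁ x
        have hx : ∀ i, pd (Sum.inr i) (u : M → ℂ) ((0 : ℝ), x) = 0 := fun i => h₀.dx i x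
        simp [enDens, ht, hx]
      simp [J, coneEnergy, coneMass, e1, h₀ _]
    -- Gronwall with rate B + 1, in the time s = εt ≥ 0, so that past and future are treated alike.
    have hanti : Antitone fun r => Real.exp (-(B + 1) * r) * J (ε * r) := by
      have hder : ∀ r, HasDerivAt (fun r => Real.exp (-(B + 1) * r) * J (ε * r))
          (Real.exp (-(B + 1) * r) * (-(B + 1)) * J (ε * r)
            + Real.exp (-(B + 1) * r) * ((d (ε * r) + d₂ (ε * r)) * ε)) r := fun r => by
        have e1 : HasDerivAt (fun r => -(B + 1) * r) (-(B + 1)) r := by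
          simpa using (hasDerivAt_id r).const_mul (-(B + 1))
        have e2 : HasDerivAt (fun r => ε * r) ε r := by
          simpa using (hasDerivAt_id r).const_mul ε
        have e3 : HasDerivAt J (d (ε * r) + d₂ (ε * r)) (ε * r) := (hd _).add (hd₂ _)
        exact e1.exp.mul (HasDerivAt.comp r e3 e2)
      refine antitone_of_deriv_nonpos (fun r => (hder r).differentiableAt) fun r => ?_
      rw [(hder r).deriv]
      have := hbd (ε * r)
      have hp := Real.exp_pos (-(B + 1) * r)
      have h9 : Real.exp (-(B + 1) * r) * (-(B + 1)) * J (ε * r)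
            + Real.exp (-(B + 1) * r) * ((d (ε * r) + d₂ (ε * r)) * ε)
          = Real.exp (-(B + 1) * r) * (ε * (d (ε * r) + d₂ (ε * r)) - (B + 1) * J (ε * r)) := by ring
      rw [h9]
      exact mul_nonpos_of_nonneg_of_nonpos hp.le (by linarith)
    have h1 := hanti hs
    simp only [mul_zero, hJ0] at h1
    have h2 : J (ε * s) ≤ 0 := by
      by_contra hcon
      exact absurd h1 (not_le.2 (mul_pos (Real.exp_pos _) (not_le.1 hcon)))
    have h3 := coneEnergy_nonneg isCoef_zero u ε c (ε * s)
    exact le_antisymm (by simp only [J] at h2; linarith) (hm _)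
  ext ⟨t, x⟩
  obtain ⟨ε, s, hε, hs, rfl⟩ : ∃ ε s : ℝ, |ε| = 1 ∧ 0 ≤ s ∧ t = ε * s := by
    rcases le_total 0 t with h | h
    · exact ⟨1, t, by simp, h, by simp⟩
    · exact ⟨-1, -t, by simp, by linarith, by simp⟩
  -- With this constant the cutoff is 1 at the given point; a continuous nonnegative integrand with
  -- vanishing integral is zero there.
  set c := 1 + ‖x‖ + ε * (ε * s)
  have h0 := key ε hε s hs c
  rw [coneMass] at h0
  have hcont : Continuous fun y => coneFun ε c (ε * s, y) * ‖(u : M → ℂ) (ε * s, y)‖ ^ 2 :=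
    ((contDiff_coneFun ε c).continuous.comp (by fun_prop)).mul
      ((Sm.continuous_slice u (ε * s)).norm.pow 2)
  rw [integral_eq_zero_iff_of_nonneg (fun y => mul_nonneg (coneFun_nonneg _ _ _) (by positivity))
    (integrable_coneMass u ε c (ε * s)), hcont.ae_eq_iff_eq volume continuous_zero] at h0
  have h1 := congrFun h0 x
  simp only [Pi.zero_apply] at h1
  rw [coneFun_eq_one (p := (ε * s, x)) le_rfl, one_mul] at h1
  simpa using h1

end LogSharp

namespace LogSharp

/-! ### Existence of profiles -/

/-- Interpolate between sin² r and r² by a smooth step across [7π/8, π]; a convex combination of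
these stays positive there. -/
theorem exists_isProfile : ∃ f : ℝ → ℝ, IsProfile f := by
  have hπ := Real.pi_pos
  let β : ℝ → ℝ := fun r => Real.smoothTransition ((r - 7 * Real.pi / 8) * (8 / Real.pi))
  have hβ : ContDiff ℝ ∞ β := Real.smoothTransition.contDiff.comp
    ((contDiff_id.sub contDiff_const).mul contDiff_const)
  have hβ0 : ∀ r, r ≤ 7 * Real.pi / 8 → β r = 0 := fun r hr =>
    Real.smoothTransition.zero_of_nonpos (mul_nonpos_of_nonpos_of_nonneg (by linarith) (by positivity))
  have hβ1 : ∀ r, Real.pi ≤ r → β r = 1 := fun r hr => by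
    refine Real.smoothTransition.one_of_one_le ?_
    rw [mul_div_assoc', le_div_iff₀ hπ]
    linarith
  refine ⟨fun r => (1 - β r) * Real.sin r ^ 2 + β r * r ^ 2, ?_, fun r _ hr => ?_, fun r hr => ?_,
    fun r h1 h2 => ?_⟩
  · exact (((contDiff_const.sub hβ).mul (Real.contDiff_sin.pow 2)).add
      (hβ.mul (contDiff_id.pow 2))).contDiffOn
  · simp [hβ0 r hr]
  · simp [hβ1 r hr]
  · have hle : β r ≤ 1 := Real.smoothTransition.le_one _
    rcases h1.eq_or_lt with rfl | h1
    · rw [hβ0 _ le_rfl]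
      have := Real.sin_pos_of_pos_of_lt_pi (x := 7 * Real.pi / 8) (by positivity) (by linarith)
      simp only [sub_zero, one_mul, zero_mul, add_zero]
      positivity
    · have hr : 0 < r := lt_trans (by positivity) h1
      have : 0 < β r := Real.smoothTransition.pos_of_pos (mul_pos (by linarith) (by positivity))
      have h3 : 0 ≤ (1 - β r) * Real.sin r ^ 2 := mul_nonneg (by linarith) (by positivity)
      have h4 : 0 < β r * r ^ 2 := by positivity
      linarith

/-! ### The metric -/

variable {f : ℝ → ℝ}

/-- The quadratic form of the Riemannian metric. -/
noncomputable def spaceQuad (f : ℝ → ℝ) (x w : E3) : ℝ :=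
  rhoFun f x * ‖w‖ ^ 2 - kapFun f x * inner ℝ x w ^ 2

theorem ultrastatic_self (f : ℝ → ℝ) (p v : M) :
    ultrastatic f p v v = -v.1 ^ 2 + spaceQuad f p.2 v.2 := by
  rw [ultrastatic_apply, spaceQuad, real_inner_self_eq_norm_sq]; ring

theorem ultrastatic_T_left (f : ℝ → ℝ) (p v : M) : ultrastatic f p T v = -v.1 := by
  simp [ultrastatic_apply, T, e]

/-- The quadratic form has eigenvalues 1 and ρ relative to the Euclidean one. -/
theorem spaceQuad_bounds (f : ℝ → ℝ) (x w : E3) :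
    min 1 (rhoFun f x) * ‖w‖ ^ 2 ≤ spaceQuad f x w ∧
      spaceQuad f x w ≤ max 1 (rhoFun f x) * ‖w‖ ^ 2 := by
  have h1 : inner ℝ x w ^ 2 ≤ ‖x‖ ^ 2 * ‖w‖ ^ 2 := by
    rw [← mul_pow, sq_le_sq, abs_of_nonneg (by positivity : 0 ≤ ‖x‖ * ‖w‖)]
    exact abs_real_inner_le_norm x w
  have h2 : 0 ≤ inner ℝ x w ^ 2 := sq_nonneg _
  have h3 : 0 ≤ ‖w‖ ^ 2 := sq_nonneg _
  have hρ : rhoFun f x = 1 + ‖x‖ ^ 2 * kapFun f x := rfl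
  rw [spaceQuad]
  rcases le_total 0 (kapFun f x) with hk | hk
  · have h5 : 1 ≤ rhoFun f x := by rw [hρ]; have := mul_nonneg (sq_nonneg ‖x‖) hk; linarith
    rw [min_eq_left h5, max_eq_right h5]
    have h4 := mul_le_mul_of_nonneg_left h1 hk
    have h6 := mul_nonneg hk h2
    refine ⟨?_, by linarith⟩
    rw [hρ]; nlinarith
  · have h5 : rhoFun f x ≤ 1 := by
      rw [hρ]; have := mul_nonpos_of_nonneg_of_nonpos (sq_nonneg ‖x‖) hk; linarith
    rw [min_eq_right h5, max_eq_left h5]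
    have h4 := mul_le_mul_of_nonpos_left h1 hk
    have h6 := mul_nonpos_of_nonpos_of_nonneg hk h2
    refine ⟨by linarith, ?_⟩
    rw [hρ]; nlinarith

/-- Uniform equivalence with the Euclidean metric: ρ is continuous and positive on the compact ball
and equal to 1 outside it. All causality statements rest on this. -/
theorem exists_spaceQuad_bounds (hf : IsProfile f) : ∃ c C : ℝ, 0 < c ∧ 0 < C ∧ ∀ x w,
    c * ‖w‖ ^ 2 ≤ spaceQuad f x w ∧ spaceQuad f x w ≤ C * ‖w‖ ^ 2 := by
  have hK := isCompact_closedBall (0 : E3) Real.pi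
  have hne : (Metric.closedBall (0 : E3) Real.pi).Nonempty := ⟨0, by simp [Real.pi_pos.le]⟩
  have hc : ContinuousOn (rhoFun f) (Metric.closedBall (0 : E3) Real.pi) :=
    (contDiff_rhoFun hf).continuous.continuousOn
  obtain ⟨a, -, ha⟩ := hK.exists_isMinOn hne hc
  obtain ⟨b, -, hb⟩ := hK.exists_isMaxOn hne hc
  refine ⟨min 1 (rhoFun f a), max 1 (rhoFun f b), lt_min one_pos (rhoFun_pos hf a),
    lt_max_of_lt_left one_pos, fun x w => ?_⟩
  obtain ⟨h1, h2⟩ := spaceQuad_bounds f x w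
  have h3 : min 1 (rhoFun f a) ≤ min 1 (rhoFun f x) ∧ max 1 (rhoFun f x) ≤ max 1 (rhoFun f b) := by
    by_cases hx : ‖x‖ ≤ Real.pi
    · have hx' : x ∈ Metric.closedBall (0 : E3) Real.pi := mem_closedBall_zero_iff.2 hx
      exact ⟨min_le_min_left _ (ha hx'), max_le_max_left _ (hb hx')⟩
    · rw [rhoFun_eq_one hf (not_le.1 hx).le]
      simp
  exact ⟨(mul_le_mul_of_nonneg_right h3.1 (sq_nonneg _)).trans h1,
    h2.trans (mul_le_mul_of_nonneg_right h3.2 (sq_nonneg _))⟩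

theorem contDiff_ultrastatic (hf : IsProfile f) : ContDiff ℝ ∞ (ultrastatic f) := by
  refine contDiff_clm_apply_iff.2 fun v => contDiff_clm_apply_iff.2 fun w => ?_
  simp only [ultrastatic_apply]
  have h1 : ContDiff ℝ ∞ fun p : M => rhoFun f p.2 := (contDiff_rhoFun hf).comp contDiff_snd
  have h2 : ContDiff ℝ ∞ fun p : M => kapFun f p.2 := (contDiff_kapFun hf).comp contDiff_snd
  exact contDiff_const.add ((h1.mul contDiff_const).sub (h2.mul
    ((contDiff_snd.inner ℝ contDiff_const).mul (contDiff_snd.inner ℝ contDiff_const))))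

/-- An orthonormal frame of the ultrastatic metric. -/
noncomputable def frame (f : ℝ → ℝ) (p : M) : Ix → M :=
  Sum.elim (fun _ => ((1 : ℝ), (0 : E3))) fun i => ((0 : ℝ), (Real.sqrt (rhoFun f p.2))⁻¹ •
    (EuclideanSpace.single i (1 : ℝ) + (kapFun f p.2 / (Real.sqrt (rhoFun f p.2) + 1) * p.2 i) • p.2))

/-- The spatial vectors are the columns of the inverse square root of the metric, which is 1/√ρ
tangentially and 1 radially. -/
theorem ultrastatic_frame (hf : IsProfile f) (p : M) (a b : Ix) :
    ultrastatic f p (frame f p a) (frame f p b)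
      = if a = b then Sum.elim (fun _ => -1) (fun _ => 1) a else 0 := by
  rw [ultrastatic_apply]
  rcases a with a | i <;> rcases b with b | j
  · simp [frame]
  · simp [frame]
  · simp [frame]
  · obtain ⟨t, x⟩ := p
    have hpos := rhoFun_pos hf x
    have hδ : (inner ℝ (EuclideanSpace.single i (1 : ℝ)) (EuclideanSpace.single j (1 : ℝ)) : ℝ)
        = if i = j then 1 else 0 := by
      by_cases h : i = j
      · subst h; simp
      · simp [EuclideanSpace.inner_single_right, h]
    have hxi : ∀ i, (inner ℝ x (EuclideanSpace.single i (1 : ℝ)) : ℝ) = x i := fun i => by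
      simp [EuclideanSpace.inner_single_right]
    have hix : ∀ i, (inner ℝ (EuclideanSpace.single i (1 : ℝ)) x : ℝ) = x i := fun i => by
      simp [EuclideanSpace.inner_single_left]
    have hif : (if (Sum.inr i : Ix) = Sum.inr j then Sum.elim (fun _ => -1) (fun _ => (1 : ℝ)) (Sum.inr i : Ix) else 0)
        = if i = j then 1 else 0 := by simp
    have hκ : ‖x‖ ^ 2 * kapFun f x = rhoFun f x - 1 := by rw [rhoFun]; ring
    rw [hif]
    simp only [frame, Sum.elim_inr, inner_smul_left, inner_smul_right, inner_add_left, inner_add_right,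
      hδ, hxi, hix, real_inner_self_eq_norm_sq, RCLike.conj_to_real, mul_zero, neg_zero, zero_add]
    obtain ⟨m, hm0, hm2⟩ : ∃ m : ℝ, 0 < m ∧ rhoFun f x = m ^ 2 :=
      ⟨_, Real.sqrt_pos.2 hpos, (Real.sq_sqrt hpos.le).symm⟩
    rw [hm2] at hκ ⊢
    rw [Real.sqrt_sq hm0.le]
    have h2 : kapFun f x / (m + 1) * (m + 1) = kapFun f x := by field_simp
    -- With m = √ρ this is (m² − 1)/(m + 1) = m − 1, which makes the radial eigenvalue m⁻¹(1 + (m −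
    -- 1)) equal to 1.
    have h1 : kapFun f x / (m + 1) * ‖x‖ ^ 2 = m - 1 := by
      field_simp
      linear_combination hκ
    have hmn : m * m⁻¹ = 1 := mul_inv_cancel₀ hm0.ne'
    generalize kapFun f x / (m + 1) = c at *
    generalize (if i = j then (1 : ℝ) else 0) = δ
    linear_combination m⁻¹ ^ 2 * (m ^ 2 * x i * x j * h2 + (m ^ 2 * x i * x j * c
      - kapFun f x * x i * x j * (1 + c * ‖x‖ ^ 2 + m)) * h1) + δ * (m * m⁻¹ + 1) * hmn

theorem ultrastatic_isLorentz (hf : IsProfile f) : IsLorentzMetric (ultrastatic f) where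
  smooth := contDiff_ultrastatic hf
  symm p v w := by
    rw [ultrastatic_apply, ultrastatic_apply, real_inner_comm v.2 w.2]; ring
  signature p := by
    have hli : LinearIndependent ℝ (frame f p) := by
      rw [Fintype.linearIndependent_iff]
      intro g hg b
      have h1 : ultrastatic f p (∑ a, g a • frame f p a) (frame f p b) = 0 := by rw [hg]; simp
      rw [map_sum, _root_.sum_apply] at h1
      simp only [map_smul, smul_apply, ultrastatic_frame hf, smul_eq_mul, mul_ite, mul_zero,
        Finset.sum_ite_eq', Finset.mem_univ, if_true] at h1
      rcases b with b | b <;> simpa using h1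
    have hcard : Fintype.card Ix = Module.finrank ℝ M := by simp
    refine ⟨basisOfLinearIndependentOfCardEqFinrank hli hcard, fun μ ν => ?_⟩
    rw [coe_basisOfLinearIndependentOfCardEqFinrank]
    exact ultrastatic_frame hf p μ ν

theorem ultrastatic_isKilling (hf : IsProfile f) : IsKilling (ultrastatic f) (fun _ => T) := by
  intro p v w
  have h1 : fderiv ℝ (ultrastatic f) p T = 0 := by
    have h2 := ((contDiff_ultrastatic hf).differentiable (by simp) p).hasFDerivAt.hasLineDerivAt T
    have h3 : (fun s : ℝ => ultrastatic f (p + s • T)) = fun _ => ultrastatic f p := by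
      funext s
      ext v w <;> simp [ultrastatic_apply, T, e]
    rw [HasLineDerivAt, h3] at h2
    exact h2.unique (hasDerivAt_const (0 : ℝ) (ultrastatic f p))
  simp [h1]

theorem isCompleteField_T : IsCompleteField (fun _ => T) := fun p =>
  ⟨fun s => p + s • T, by simp, fun s => by
    simpa using ((hasDerivAt_id s).smul_const T).const_add p⟩

/-! ### Causality -/

/-- A bounded monotone time converges, and a position that is Lipschitz in time is then Cauchy. A
curve trapped on one side of the slice is therefore extendible. -/
theorem exists_tendsto_of_dominated {α : ℝ → ℝ} {β : ℝ → E3} {L A : ℝ} (hL : 0 ≤ L)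
    (hαβ : ∀ s s', ‖β s - β s'‖ ≤ L * |α s - α s'|) (hα : Monotone α) (hA : ∀ s, α s ≤ A) :
    ∃ q : M, Tendsto (fun s => (α s, β s)) atTop (𝓝 q) := by
  have h1 := tendsto_atTop_ciSup hα ⟨A, by rintro _ ⟨s, rfl⟩; exact hA s⟩
  have h2 : CauchySeq β := by
    have h3 := Metric.cauchySeq_iff'.1 h1.cauchySeq
    refine Metric.cauchySeq_iff'.2 fun ε hε => ?_
    obtain ⟨N, hN⟩ := h3 (ε / (L + 1)) (by positivity)
    refine ⟨N, fun n hn => ?_⟩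
    have h4 := hN n hn
    rw [Real.dist_eq, lt_div_iff₀ (by positivity)] at h4
    rw [dist_eq_norm]
    have h5 := hαβ n N
    nlinarith [abs_nonneg (α n - α N)]
  obtain ⟨y, hy⟩ := cauchySeq_tendsto_of_complete h2
  exact ⟨_, h1.prodMk_nhds hy⟩

/-- Time is strictly increasing along the curve, so there is at most one crossing. Without a
crossing the time is bounded towards the future or the past, and as the speed is bounded the curve
has an endpoint there. -/
theorem isCauchy_ultrastatic (hf : IsProfile f) : IsCauchy (ultrastatic f) (slice 0) := by
  obtain ⟨c, C, hc, -, hQ⟩ := exists_spaceQuad_bounds hf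
  intro γ hγ hT htop hbot
  have hd : ∀ s, HasDerivAt γ (deriv γ s) s := fun s =>
    (hγ.differentiable (by simp) s).hasDerivAt
  have hd1 : ∀ s, HasDerivAt (fun s => (γ s).1) (deriv γ s).1 s := fun s => (hd s).fst
  have hd2 : ∀ s, HasDerivAt (fun s => (γ s).2) (deriv γ s).2 s := fun s => (hd s).snd
  have hpos : ∀ s, 0 < (deriv γ s).1 := fun s => by
    have := (hT s).2
    rw [ultrastatic_T_left] at this
    linarith
  set L := (Real.sqrt c)⁻¹
  have hL : 0 < L := inv_pos.2 (Real.sqrt_pos.2 hc)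
  have hbound : ∀ s, ‖(deriv γ s).2‖ ≤ L * (deriv γ s).1 := fun s => by
    have h1 := (hT s).1
    rw [ultrastatic_self] at h1
    have h2 := (hQ (γ s).2 (deriv γ s).2).1
    rw [← div_eq_inv_mul, le_div_iff₀ (Real.sqrt_pos.2 hc)]
    refine abs_le_of_sq_le_sq' ?_ (hpos s).le |>.2
    rw [mul_pow, Real.sq_sqrt hc.le]
    linarith
  have hmono : StrictMono fun s => (γ s).1 := strictMono_of_deriv_pos fun s => by
    rw [(hd1 s).deriv]; exact hpos s
  have hle : ∀ s s', s ≤ s' → ‖(γ s').2 - (γ s).2‖ ≤ L * ((γ s').1 - (γ s).1) := by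
    intro s s' hss
    refine image_norm_le_of_norm_deriv_right_le_deriv_boundary (a := s) (b := s')
      (f := fun r => (γ r).2 - (γ s).2) (f' := fun r => (deriv γ r).2)
      (B := fun r => L * ((γ r).1 - (γ s).1)) (B' := fun r => L * (deriv γ r).1)
      (fun r _ => ((hd2 r).sub_const _).continuousAt.continuousWithinAt)
      (fun r _ => ((hd2 r).sub_const _).hasDerivWithinAt) (by simp)
      (fun r => ((hd1 r).sub_const _).const_mul L) (fun r _ => hbound r) (right_mem_Icc.2 hss)
  have hdom : ∀ s s', ‖(γ s).2 - (γ s').2‖ ≤ L * |(γ s).1 - (γ s').1| := by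
    intro s s'
    rcases le_total s s' with h | h
    · rw [norm_sub_rev, abs_sub_comm]
      exact (hle s s' h).trans (mul_le_mul_of_nonneg_left (le_abs_self _) hL.le)
    · exact (hle s' s h).trans (mul_le_mul_of_nonneg_left (le_abs_self _) hL.le)
  have hex : ∃ s, (γ s).1 = 0 := by
    by_contra hcon
    push Not at hcon
    have hcont : Continuous fun s => (γ s).1 := continuous_fst.comp hγ.continuous
    rcases (hcon 0).lt_or_gt with h0 | h0
    · refine htop (exists_tendsto_of_dominated (A := 0) hL.le hdom hmono.monotone fun s => ?_)
      by_contra hs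
      obtain ⟨r, hr⟩ := mem_range_of_exists_le_of_exists_ge hcont ⟨0, h0.le⟩ ⟨s, (not_le.1 hs).le⟩
      exact hcon r hr
    · have hge : ∀ s, 0 ≤ (γ s).1 := fun s => by
        by_contra hs
        obtain ⟨r, hr⟩ := mem_range_of_exists_le_of_exists_ge hcont ⟨s, (not_le.1 hs).le⟩ ⟨0, h0.le⟩
        exact hcon r hr
      -- The past end is reduced to the future end by reversing both the parameter and the time
      -- coordinate.
      obtain ⟨q, hq⟩ := exists_tendsto_of_dominated (α := fun s => -(γ (-s)).1)
        (β := fun s => (γ (-s)).2) (A := 0) hL.le (fun s s' => by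
          refine (hdom (-s) (-s')).trans (le_of_eq ?_)
          rw [← abs_neg]; ring_nf) (fun s s' h => neg_le_neg (hmono.monotone (neg_le_neg h)))
          fun s => neg_nonpos.2 (hge _)
      refine hbot ⟨(-q.1, q.2), ?_⟩
      have h1 := hq.comp tendsto_neg_atBot_atTop
      have h2 : Continuous fun q : M => ((-q.1, q.2) : M) := by fun_prop
      refine ((h2.tendsto q).comp h1).congr fun s => ?_
      simp
  obtain ⟨s, hs⟩ := hex
  exact ⟨s, hs, fun s' hs' => hmono.injective (hs'.trans hs.symm)⟩

/-- Steep straight lines are causal. -/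
theorem causalSegment_line {C : ℝ} (hC : ∀ x w, spaceQuad f x w ≤ C * ‖w‖ ^ 2) (p : M) {S : ℝ}
    {v : E3} (hS : 0 < S) (hv : C * ‖v‖ ^ 2 ≤ S ^ 2) : CausalSegment (ultrastatic f) p (p + (S, v)) := by
  refine ⟨fun s => p + s • ((S, v) : M), by fun_prop, by simp, by simp, fun s hs => ?_⟩
  have h1 : HasDerivAt (fun s : ℝ => p + s • ((S, v) : M)) (S, v) s := by
    simpa using ((hasDerivAt_id s).smul_const ((S, v) : M)).const_add p
  rw [h1.hasDerivWithinAt.derivWithin (uniqueDiffOn_Icc zero_lt_one s hs)]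
  refine ⟨fun h => hS.ne' (congrArg Prod.fst h), ?_, ?_⟩
  · rw [ultrastatic_self]
    have := hC (p + s • ((S, v) : M)).2 v
    simp only at this ⊢
    linarith
  · rw [ultrastatic_T_left]
    simpa using hS

theorem time_le_of_causalSegment {p q : M} (h : CausalSegment (ultrastatic f) p q) : p.1 ≤ q.1 := by
  obtain ⟨γ, hγ, rfl, rfl, hc⟩ := h
  have hmono : MonotoneOn (fun s => (γ s).1) (Icc 0 1) := by
    have hcont : ContinuousOn (fun s => (γ s).1) (Icc 0 1) := continuous_fst.comp_continuousOn hγ.continuousOn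
    have hd : ∀ s ∈ interior (Icc (0 : ℝ) 1), HasDerivAt (fun s => (γ s).1) (derivWithin γ (Icc 0 1) s).1 s := by
      intro s hs
      have h1 := (hγ.differentiableOn (by simp) s (interior_subset hs)).hasDerivWithinAt
      exact (h1.hasDerivAt (mem_interior_iff_mem_nhds.1 hs)).fst
    refine monotoneOn_of_deriv_nonneg (convex_Icc 0 1) hcont
      (fun s hs => (hd s hs).differentiableAt.differentiableWithinAt) fun s hs => ?_
    rw [(hd s hs).deriv]
    have := (hc s (interior_subset hs)).2.2
    rw [ultrastatic_T_left] at this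
    linarith
  exact hmono (by simp) (by simp) zero_le_one

theorem Jplus_slice_subset {p : M} (h : p ∈ Jplus (ultrastatic f) (slice 0)) : 0 ≤ p.1 := by
  obtain ⟨q, hq, hqp⟩ := h
  have h1 : q.1 ≤ p.1 := by
    induction hqp with
    | refl => exact le_rfl
    | tail _ h ih => exact ih.trans (time_le_of_causalSegment h)
  rw [slice, mem_ofPred_eq] at hq
  linarith

theorem mem_Jplus_slice (hf : IsProfile f) {p : M} (hp : 0 ≤ p.1) :
    p ∈ Jplus (ultrastatic f) (slice 0) := by
  obtain ⟨c, C, -, -, hQ⟩ := exists_spaceQuad_bounds hf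
  refine ⟨(0, p.2), rfl, ?_⟩
  rcases hp.eq_or_lt with h | h
  · rw [h]
  · have h1 := causalSegment_line (fun x w => (hQ x w).2) (0, p.2) (S := p.1) (v := 0) h (by
      simp; positivity)
    refine Relation.ReflTransGen.single ?_
    convert h1 using 1
    ext <;> simp

theorem exists_steep (C : ℝ) (hC : 0 < C) (v : E3) : ∃ S : ℝ, 0 < S ∧ C * ‖v‖ ^ 2 ≤ S ^ 2 := by
  refine ⟨Real.sqrt C * ‖v‖ + 1, by positivity, ?_⟩
  have h1 := Real.sq_sqrt hC.le
  have h2 : 0 ≤ Real.sqrt C * ‖v‖ := by positivity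
  nlinarith

/-- Any spatial displacement is causal if enough time is allowed, so the end is reached from every
point by one straight segment. -/
theorem Jminus_eq_univ (hf : IsProfile f) {S : Set E3} (hS : S.Nonempty) :
    Jminus (ultrastatic f) (asympRegion S) = univ := by
  obtain ⟨c, C, -, hC, hQ⟩ := exists_spaceQuad_bounds hf
  obtain ⟨y, hy⟩ := hS
  refine eq_univ_of_forall fun p => ?_
  obtain ⟨s, hs, hv⟩ := exists_steep C hC (y - p.2)
  refine ⟨p + (s, y - p.2), ?_, .single (causalSegment_line (fun x w => (hQ x w).2) p hs hv)⟩
  simpa [asympRegion] using hy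

theorem Jplus_eq_univ (hf : IsProfile f) {S : Set E3} (hS : S.Nonempty) :
    Jplus (ultrastatic f) (asympRegion S) = univ := by
  obtain ⟨c, C, -, hC, hQ⟩ := exists_spaceQuad_bounds hf
  obtain ⟨y, hy⟩ := hS
  refine eq_univ_of_forall fun p => ?_
  obtain ⟨s, hs, hv⟩ := exists_steep C hC (p.2 - y)
  refine ⟨p - (s, p.2 - y), ?_, .single ?_⟩
  · simpa [asympRegion] using hy
  · simpa using causalSegment_line (fun x w => (hQ x w).2) (p - (s, p.2 - y)) hs hv

/-! ### Asymptotic flatness -/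

/-- The identity chart of the exterior of the ball of radius `π`. -/
noncomputable def endChart : OpenPartialHomeomorph E3 E3 :=
  OpenPartialHomeomorph.ofSet {y : E3 | Real.pi < ‖y‖} (isOpen_lt continuous_const continuous_norm)

theorem bigO_zero {F : Type*} [NormedAddCommGroup F] [NormedSpace ℝ F] (k : ℕ) (b R : ℝ) :
    BigO k b R (fun _ => (0 : F)) := ⟨0, fun j _ y _ => by
  have : iteratedFDeriv ℝ j (fun _ : E3 => (0 : F)) y = 0 := by
    have := congrFun (iteratedFDeriv_fun_zero (𝕜 := ℝ) (E := E3) (F := F) (n := j)) y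
    exact this
  simp [this]⟩

/-- The metric is exactly Minkowskian for r > π, so mass zero and vanishing error terms serve; the
decay exponent a = 1 is an arbitrary admissible choice. -/
theorem isAsympFlatEnd_endChart (hf : IsProfile f) :
    IsAsympFlatEnd (ultrastatic f) Real.pi endChart where
  R_pos := Real.pi_pos
  source_eq := rfl
  compact_compl := by
    have h : endChart.targetᶜ = Metric.closedBall (0 : E3) Real.pi := by
      change {y : E3 | Real.pi < ‖y‖}ᶜ = _
      ext y
      simp
    rw [h]
    exact isCompact_closedBall _ _
  smooth := contDiffOn_id
  smooth_symm := contDiffOn_id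
  metric_form := by
    refine ⟨0, 1, fun _ => 0, fun _ => 0, fun _ => 0, fun _ => 0, one_pos, le_rfl, contDiffOn_const,
      contDiffOn_const, contDiffOn_const, contDiffOn_const, bigO_zero _ _ _, bigO_zero _ _ _,
      bigO_zero _ _ _, bigO_zero _ _ _, fun t y hy s s' v v' => ?_⟩
    have hΦ : (endChart : E3 → E3) = id := rfl
    have hy0 : ‖y‖ ≠ 0 := (Real.pi_pos.trans hy).ne'
    rw [ultrastatic_apply, hΦ, fderiv_id]
    simp only [id, ContinuousLinearMap.id_apply, rhoFun_eq_one hf hy.le, kapFun_eq_zero hf hy.le]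
    simp only [dsph, dr, inner_smul_left, inner_smul_right, inner_sub_left, inner_sub_right,
      real_inner_self_eq_norm_sq, RCLike.conj_to_real, real_inner_comm y]
    simp
    field_simp
    ring

theorem energy_ultrastatic (hf : IsProfile f) (ψ : M → ℂ) (t : ℝ) :
    energy (ultrastatic f) ψ t
      = ENNReal.ofReal (1 / 2) * ∫⁻ x, ENNReal.ofReal (enDens (kapFun f) ψ (t, x)) := by
  rw [energy, energyOn, setLIntegral_univ, ← lintegral_const_mul' _ _ ENNReal.ofReal_ne_top]
  simp only [one_mul, energyDensity_ultrastatic hf]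
  congr 1
  funext x
  rw [ENNReal.ofReal_mul (by norm_num)]

theorem energy_le_of_box (hf : IsProfile f) {ψ : M → ℂ} (hψ : ContDiff ℝ ∞ ψ) {t t' : ℝ}
    (hbox : ∀ s ∈ uIcc t t', ∀ x, box (ultrastatic f) ψ (s, x) = 0) :
    energy (ultrastatic f) ψ t' ≤ energy (ultrastatic f) ψ t := by
  rw [energy_ultrastatic hf, energy_ultrastatic hf]
  exact mul_le_mul' le_rfl <| lintegral_enDens_le hf.isCoef ⟨ψ, hψ⟩ fun s hs x =>
    (box_eq_zero_iff hf ⟨ψ, hψ⟩ (s, x)).1 (hbox s hs x)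

theorem satisfiesAssumptions_ultrastatic (hf : IsProfile f) :
    SatisfiesAssumptions (ultrastatic f) where
  lorentz := ultrastatic_isLorentz hf
  killing := ultrastatic_isKilling hf
  complete := isCompleteField_T
  spacelike p _ v hv := by
    obtain ⟨c, C, hc, -, hQ⟩ := exists_spaceQuad_bounds hf
    rw [ultrastatic_self]
    have h1 := (hQ p.2 v).1
    have h2 : 0 < c * ‖v‖ ^ 2 := mul_pos hc (pow_pos (norm_pos_iff.2 hv) 2)
    simp only
    linarith
  cauchy := isCauchy_ultrastatic hf
  T_timelike p := by
    rw [ultrastatic_T_left]; simp [T, e]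
  asympFlat := by
    have hne : endChart.target.Nonempty := by
      refine ⟨EuclideanSpace.single 0 4, ?_⟩
      change Real.pi < ‖_‖
      simpa using Real.pi_lt_four
    have hD : outerDomain (ultrastatic f) endChart.target = univ := by
      rw [outerDomain, Jminus_eq_univ hf hne, Jplus_eq_univ hf hne, univ_inter, closure_univ]
    refine ⟨Real.pi, endChart, isAsympFlatEnd_endChart hf, ⟨hD, ?_, ?_, ?_⟩, ?_, 1, one_pos, ?_⟩
    · rw [horizon, hD, frontier_univ]
    · rw [futureHorizon, Jminus_eq_univ hf hne, frontier_univ, inter_empty]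
    · rw [pastHorizon, Jplus_eq_univ hf hne, frontier_univ, inter_empty]
    · rintro p ⟨hp, -⟩
      refine ⟨p.1, Jplus_slice_subset hp, (0, p.2), ⟨rfl, by rw [hD]; trivial⟩, ?_⟩
      ext <;> simp [T, e]
    · intro ψ hψ hbox t t' ht htt'
      rw [ENNReal.ofReal_one, one_mul]
      refine energy_le_of_box hf hψ fun s hs x => hbox _ ⟨mem_Jplus_slice hf ?_, by rw [hD]; trivial⟩
      rw [uIcc_of_le htt'] at hs
      exact ht.trans hs.1

end LogSharp

namespace LogSharp

/-! ### Spherical harmonics of highest weight on the three-sphere -/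

theorem IsRadial.pow {u : Sm} (hu : IsRadial u) (n : ℕ) : IsRadial (u ^ n) := fun a b => by
  rw [Derivation.leibniz_pow, hu a b, smul_zero, smul_zero]

/-- The additional factor u avoids the exponent n − 1 and makes n = 0 unexceptional. -/
theorem mul_derivation_pow (D : Derivation ℂ Sm Sm) (u : Sm) (n : ℕ) :
    u * D (u ^ n) = n * (u ^ n * D u) := by
  rcases n with _ | n
  · simp
  · rw [Derivation.leibniz_pow, nsmul_eq_mul, smul_eq_mul, Nat.add_sub_cancel]
    ring

/-- `x₁ + i x₂`. -/
noncomputable def zSm : Sm := X 0 + algebraMap ℂ Sm Complex.I * X 1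

theorem algebraMap_I_mul_self : algebraMap ℂ Sm Complex.I * algebraMap ℂ Sm Complex.I = -1 := by
  rw [← map_mul, Complex.I_mul_I, map_neg, map_one]

theorem dx_zSm (i : Fin 3) : dx i zSm
    = if i = 0 then 1 else if i = 1 then algebraMap ℂ Sm Complex.I else 0 := by
  rw [zSm, map_add, Derivation.leibniz, Derivation.map_algebraMap, dx_X, dx_X]
  fin_cases i <;> simp

theorem Eu_zSm : Eu zSm = zSm := by
  rw [Eu_apply, dx_zSm, dx_zSm, dx_zSm, zSm]
  simp
  ring

theorem Eu_zSm_pow (l : ℕ) : Eu (zSm ^ l) = l * zSm ^ l := by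
  rcases l with _ | l
  · simp
  · rw [Derivation.leibniz_pow, Eu_zSm, nsmul_eq_mul, smul_eq_mul, Nat.add_sub_cancel]
    ring

/-- The gradient (1, i, 0) of x₁ + ix₂ is a null vector, so all powers are harmonic. -/
theorem lap_zSm_pow (l : ℕ) : lap (zSm ^ l) = 0 := by
  have h1 : ∀ i, dx i (dx i (zSm ^ l)) = ((l : Sm) * ((l - 1 : ℕ) : Sm) * zSm ^ (l - 1 - 1))
      * (dx i zSm * dx i zSm) := fun i => by
    have h2 : dx i (dx i zSm) = 0 := by
      rw [dx_zSm]
      split_ifs <;> simp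
    have h3 : dx i ((l : Sm)) = 0 := Derivation.map_natCast _ _
    rw [Derivation.leibniz_pow, nsmul_eq_mul, smul_eq_mul, Derivation.leibniz, Derivation.leibniz,
      h2, Derivation.leibniz_pow, h3]
    simp only [smul_eq_mul, nsmul_eq_mul, mul_zero, zero_add, add_zero]
    ring
  rw [lap, Fin.sum_univ_three, h1, h1, h1]
  simp only [dx_zSm]
  simp [algebraMap_I_mul_self]
  ring

/-- A harmonic polynomial, homogeneous of degree l: the polar decomposition gives 0 = l² + l +
Δ_{S²}. -/
theorem sphLap_zSm_pow (l : ℕ) : sphLap (zSm ^ l) = -((l * (l + 1) : Sm) * zSm ^ l) := by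
  have h := R2_mul_lap (zSm ^ l)
  rw [lap_zSm_pow, mul_zero, Eu_zSm_pow, Derivation.leibniz, Eu_zSm_pow, Derivation.map_natCast] at h
  simp only [smul_eq_mul, mul_zero, add_zero] at h
  linear_combination -h

/-- The function `(sin r / r)^l (x₁ + i x₂)^l`. -/
noncomputable def modeSm (l : ℕ) : Sm := sSm ^ l * zSm ^ l

theorem sphLap_modeSm (l : ℕ) : sphLap (modeSm l) = -((l * (l + 1) : Sm) * modeSm l) := by
  rw [modeSm, (isRadial_sSm.pow l).sphLap_mul, sphLap_zSm_pow]
  ring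

/-- The mode is sin^l r times an angular function, and r∂_r sin^l r = l r cos r sin^{l−1} r; the
factor s = sin r / r restores the missing power. -/
theorem sSm_mul_Eu_modeSm (l : ℕ) : sSm * Eu (modeSm l) = l * cSm * modeSm l := by
  have h := mul_derivation_pow Eu sSm l
  rw [Eu_sSm] at h
  rw [modeSm, Derivation.leibniz, Eu_zSm_pow, smul_eq_mul, smul_eq_mul]
  linear_combination zSm ^ l * h

theorem cSm_sq_add : cSm * cSm + R2 * sSm * sSm = 1 := by
  ext p
  rw [Sm.add_apply, Sm.mul_apply, Sm.mul_apply, Sm.mul_apply, R2_apply, sSm, cSm, liftR_apply,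
    liftR_apply, cosN_eq]
  have h1 := Real.sin_sq_add_cos_sq ‖p.2‖
  rw [← norm_mul_sincN] at h1
  have h2 : (((‖p.2‖ * sincN p.2) ^ 2 + Real.cos ‖p.2‖ ^ 2 : ℝ) : ℂ) = 1 := by rw [h1]; simp
  push_cast at h2 ⊢
  change _ = (1 : ℂ)
  linear_combination h2

/-- Division by r² is legitimate off the time axis, and the complement of the axis is dense. -/
theorem eq_zero_of_R2_mul {u : Sm} (h : R2 * u = 0) : u = 0 := by
  have h1 : EqOn (u : M → ℂ) (fun _ => 0) {p : M | p.2 ≠ 0} := fun p hp => by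
    have h2 : ((R2 * u : Sm) : M → ℂ) p = 0 := by rw [h]; rfl
    rw [Sm.mul_apply, R2_apply] at h2
    exact (mul_eq_zero.1 h2).resolve_left (by
      simpa using hp)
  have hd : Dense {p : M | p.2 ≠ 0} := by
    have : Dense ({0}ᶜ : Set E3) := dense_compl_singleton 0
    exact this.preimage isOpenMap_snd
  ext p
  exact congrFun (Continuous.ext_on hd (Sm.continuous u) continuous_const h1) p

/-- `κ` on the round sphere. -/
noncomputable def kapSphereSm : Sm := liftR kapSphere contDiff_kapSphere

theorem R2_mul_kapSphereSm : R2 * kapSphereSm = sSm * sSm - 1 := by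
  ext p
  rw [Sm.mul_apply, Sm.sub_apply, Sm.mul_apply, R2_apply, kapSphereSm, sSm, liftR_apply, liftR_apply]
  have h1 := norm_sq_mul_kapSphere p.2
  have h2 : ((‖p.2‖ ^ 2 * kapSphere p.2 : ℝ) : ℂ) = ((sincN p.2 ^ 2 - 1 : ℝ) : ℂ) := by rw [h1]
  push_cast at h2 ⊢
  change _ = _ - (1 : ℂ)
  linear_combination h2

theorem Eu_R2 : Eu R2 = 2 * R2 := by
  simp only [Eu_apply, R2, Fin.sum_univ_three, map_add, Derivation.leibniz, smul_eq_mul, dx_X]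
  simp
  ring

/-- `modeSm l` is an eigenfunction of the Laplacian of the round three-sphere. -/
theorem ellOp_modeSm (l : ℕ) :
    ellOp kapSphereSm (modeSm l) + (l * (l + 2) : Sm) * (sSm * sSm) * modeSm l = 0 := by
  -- After multiplication by r² only radial derivatives and the spherical Laplacian remain, and both
  -- are known on the mode.
  refine eq_zero_of_R2_mul ?_
  have hA := R2_mul_lap (modeSm l)
  have hΛ := sphLap_modeSm l
  have hB := R2_mul_kapSphereSm
  have hC := congrArg Eu hB
  have hD := sSm_mul_Eu_modeSm l
  have hE := congrArg Eu hD
  have hF := cSm_sq_add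
  simp only [Derivation.leibniz, map_sub, Eu_R2, Eu_sSm, Eu_cSm, smul_eq_mul,
    Derivation.map_one_eq_zero, Derivation.map_natCast, mul_zero, add_zero] at hC hE
  rw [ellOp_eq]
  set S := modeSm l
  linear_combination hA + (Eu (Eu S) + 3 * Eu S) * hB + Eu S * hC - 2 * Eu S * hB + hΛ + sSm * hE
    + ((l : Sm) + 1) * cSm * hD + (l * (l + 1) : Sm) * S * hF

/-- Derivatives are local, so identities of the round sphere apply wherever coefficients and
functions agree near a point. -/
theorem dd_congr {u v : Sm} {p : M} (h : (u : M → ℂ) =ᶠ[𝓝 p] v) (i : Ix) :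
    (dd i u : M → ℂ) =ᶠ[𝓝 p] (dd i v : M → ℂ) := by
  filter_upwards [h.eventuallyEq_nhds] with q hq
  rw [dd_apply, dd_apply, pd, pd, hq.fderiv_eq]

theorem Eu_congr {u v : Sm} {p : M} (h : (u : M → ℂ) =ᶠ[𝓝 p] v) :
    (Eu u : M → ℂ) =ᶠ[𝓝 p] (Eu v : M → ℂ) := by
  filter_upwards [dd_congr h (Sum.inr 0), dd_congr h (Sum.inr 1), dd_congr h (Sum.inr 2)] with q h0 h1 h2
  simp only [Eu_apply, Sm.add_apply, Sm.mul_apply, h0, h1, h2]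

theorem ellOp_congr {κ κ' u v : Sm} {p : M} (hκ : (κ : M → ℂ) =ᶠ[𝓝 p] κ') (h : (u : M → ℂ) =ᶠ[𝓝 p] v) :
    (ellOp κ u : M → ℂ) =ᶠ[𝓝 p] (ellOp κ' v : M → ℂ) := by
  filter_upwards [hκ, Eu_congr hκ, Eu_congr h, Eu_congr (Eu_congr h), dd_congr (dd_congr h (Sum.inr 0)) (Sum.inr 0),
    dd_congr (dd_congr h (Sum.inr 1)) (Sum.inr 1), dd_congr (dd_congr h (Sum.inr 2)) (Sum.inr 2)]
    with q h1 h2 h3 h4 h5 h6 h7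
  simp only [ellOp_eq, lap, Fin.sum_univ_three, Sm.add_apply, Sm.mul_apply, h1, h2, h3, h4, h5, h6, h7]

variable {f : ℝ → ℝ}

theorem kapSm_eventuallyEq (hf : IsProfile f) {p : M} (hp : ‖p.2‖ < 7 * Real.pi / 8) :
    (kapSm hf : M → ℂ) =ᶠ[𝓝 p] kapSphereSm := by
  have h1 : {q : M | ‖q.2‖ < 7 * Real.pi / 8} ∈ 𝓝 p :=
    (isOpen_lt (by fun_prop) continuous_const).mem_nhds hp
  filter_upwards [h1] with q hq
  rw [kapSm, kapSphereSm, liftR_apply, liftR_apply, kapFun_eq_sphere hf (le_of_lt hq)]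

theorem rhoSm_apply_sphere (hf : IsProfile f) {p : M} (hp : ‖p.2‖ < 7 * Real.pi / 8) :
    (rhoSm hf : M → ℂ) p = (sSm : M → ℂ) p * (sSm : M → ℂ) p := by
  rw [rhoSm, sSm, liftR_apply, liftR_apply, rhoFun_eq_sphere hf hp.le]
  push_cast
  ring

/-! ### Quasimodes -/

/-- A radial cutoff: `1` for `r ≤ 5π/6` and `0` for `r ≥ 41π/48`. -/
noncomputable def chiFun (x : E3) : ℝ :=
  coneEta ((‖x‖ ^ 2 - (5 * Real.pi / 6) ^ 2) * ((41 * Real.pi / 48) ^ 2 - (5 * Real.pi / 6) ^ 2)⁻¹)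

theorem contDiff_chiFun : ContDiff ℝ ∞ chiFun :=
  contDiff_coneEta.comp (((contDiff_norm_sq ℝ).sub contDiff_const).mul contDiff_const)

/-- The shell 5π/6 ≤ r ≤ 41π/48 where the cutoff varies lies inside the round region r < 7π/8, and
sin² r ≤ 1/4 on it. -/
theorem chi_width_pos : 0 < (41 * Real.pi / 48) ^ 2 - (5 * Real.pi / 6) ^ 2 := by
  have := pow_pos Real.pi_pos 2
  linarith

theorem chiFun_eq_one {x : E3} (h : ‖x‖ ≤ 5 * Real.pi / 6) : chiFun x = 1 := by
  refine coneEta_of_nonpos (mul_nonpos_of_nonpos_of_nonneg ?_ (inv_pos.2 chi_width_pos).le)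
  have := pow_le_pow_left₀ (norm_nonneg x) h 2
  linarith

theorem chiFun_eq_zero {x : E3} (h : 41 * Real.pi / 48 ≤ ‖x‖) : chiFun x = 0 := by
  refine coneEta_of_one_le ?_
  rw [← div_eq_mul_inv, le_div_iff₀ chi_width_pos]
  have := pow_le_pow_left₀ (by positivity) h 2
  linarith

theorem chiFun_nonneg (x : E3) : 0 ≤ chiFun x := coneEta_nonneg _
theorem chiFun_le_one (x : E3) : chiFun x ≤ 1 := coneEta_le_one _

/-- The cutoff `chiFun` on spacetime. -/
noncomputable def chiSm : Sm := liftR chiFun contDiff_chiFun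

theorem isRadial_chiSm : IsRadial chiSm := isRadial_liftR _ fun x y h => by rw [chiFun, chiFun, h]

/-- The quasimode. -/
noncomputable def quasiSm (l : ℕ) : Sm := chiSm * modeSm l

theorem sphLap_quasiSm (l : ℕ) : sphLap (quasiSm l) = -((l * (l + 1) : Sm) * quasiSm l) := by
  rw [quasiSm, isRadial_chiSm.sphLap_mul, sphLap_modeSm]
  ring

theorem dt_quasiSm (l : ℕ) : dt (quasiSm l) = 0 := by
  have h1 : dt chiSm = 0 := dt_lift _ _
  have h2 : dt sSm = 0 := dt_lift _ _
  have h3 : dt zSm = 0 := by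
    rw [zSm, map_add, Derivation.leibniz, Derivation.map_algebraMap, dt_X, dt_X]
    simp
  rw [quasiSm, modeSm, Derivation.leibniz, Derivation.leibniz, Derivation.leibniz_pow,
    Derivation.leibniz_pow, h1, h2, h3]
  simp

theorem quasiSm_eq_zero (l : ℕ) {p : M} (h : 41 * Real.pi / 48 ≤ ‖p.2‖) :
    (quasiSm l : M → ℂ) p = 0 := by
  rw [quasiSm, Sm.mul_apply, chiSm, liftR_apply, chiFun_eq_zero h, Complex.ofReal_zero, zero_mul]

theorem quasiSm_eq_mode (l : ℕ) {p : M} (h : ‖p.2‖ ≤ 5 * Real.pi / 6) :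
    (quasiSm l : M → ℂ) p = (modeSm l : M → ℂ) p := by
  rw [quasiSm, Sm.mul_apply, chiSm, liftR_apply, chiFun_eq_one h, Complex.ofReal_one, one_mul]

theorem norm_quasiSm_le (l : ℕ) (p : M) : ‖(quasiSm l : M → ℂ) p‖ ≤ ‖(modeSm l : M → ℂ) p‖ := by
  rw [quasiSm, Sm.mul_apply, norm_mul, chiSm, liftR_apply, Complex.norm_real,
    Real.norm_of_nonneg (chiFun_nonneg _)]
  exact mul_le_of_le_one_left (norm_nonneg _) (chiFun_le_one _)

/-- The error of the quasimode. -/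
noncomputable def errSm (hf : IsProfile f) (l : ℕ) : Sm :=
  ellOp (kapSm hf) (quasiSm l) + (l * (l + 2) : Sm) * rhoSm hf * quasiSm l

theorem R2_mul_gradForm (hf : IsProfile f) {u : Sm} (hu : IsRadial u) (v : Sm) :
    R2 * gradForm (kapSm hf) u v = rhoSm hf * Eu u * Eu v := by
  have h0 := hu.R2_mul_dx 0
  have h1 := hu.R2_mul_dx 1
  have h2 := hu.R2_mul_dx 2
  rw [gradForm, Fin.sum_univ_three, rhoSm_eq]
  linear_combination dx 0 v * h0 + dx 1 v * h1 + dx 2 v * h2 - Eu u * Eu_apply v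

theorem errSm_eq_zero_outside (hf : IsProfile f) (l : ℕ) {p : M} (h : 41 * Real.pi / 48 < ‖p.2‖) :
    (errSm hf l : M → ℂ) p = 0 := by
  have h1 : (quasiSm l : M → ℂ) =ᶠ[𝓝 p] ((0 : Sm) : M → ℂ) := by
    have h2 : {q : M | 41 * Real.pi / 48 < ‖q.2‖} ∈ 𝓝 p :=
      (isOpen_lt continuous_const (by fun_prop)).mem_nhds h
    filter_upwards [h2] with q hq
    exact quasiSm_eq_zero l (le_of_lt hq)
  have h3 := (ellOp_congr (κ := kapSm hf) EventuallyEq.rfl h1).eq_of_nhds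
  rw [errSm, Sm.add_apply, h3, Sm.mul_apply, h1.eq_of_nhds]
  simp [ellOp]

theorem errSm_eq_zero_inside (hf : IsProfile f) (l : ℕ) {p : M} (h : ‖p.2‖ < 5 * Real.pi / 6) :
    (errSm hf l : M → ℂ) p = 0 := by
  have hp : ‖p.2‖ < 7 * Real.pi / 8 := by linarith [Real.pi_pos]
  have h1 : (quasiSm l : M → ℂ) =ᶠ[𝓝 p] (modeSm l : M → ℂ) := by
    have h2 : {q : M | ‖q.2‖ < 5 * Real.pi / 6} ∈ 𝓝 p :=
      (isOpen_lt (by fun_prop) continuous_const).mem_nhds h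
    filter_upwards [h2] with q hq
    exact quasiSm_eq_mode l (le_of_lt hq)
  have h3 := (ellOp_congr (kapSm_eventuallyEq hf hp) h1).eq_of_nhds
  have h4 := congrArg (fun u : Sm => (u : M → ℂ) p) (ellOp_modeSm l)
  rw [errSm, Sm.add_apply, h3, Sm.mul_apply, Sm.mul_apply, h1.eq_of_nhds, rhoSm_apply_sphere hf hp]
  simp only [Sm.add_apply, Sm.mul_apply] at h4
  exact h4

/-- Since the mode is an exact eigenfunction, only the commutator with the cutoff survives. The
factor r²s trades the radial derivative of the mode for l cos r times the mode, without any
division. -/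
theorem R2_mul_errSm (hf : IsProfile f) (l : ℕ) {p : M} (hp : ‖p.2‖ < 7 * Real.pi / 8) :
    (R2 : M → ℂ) p * (sSm : M → ℂ) p * (errSm hf l : M → ℂ) p
      = ((R2 * sSm * ellOp (kapSm hf) chiSm : Sm) : M → ℂ) p * (modeSm l : M → ℂ) p
        + l * ((2 * (rhoSm hf * Eu chiSm * cSm) : Sm) : M → ℂ) p * (modeSm l : M → ℂ) p := by
  have h1 : R2 * sSm * errSm hf l = R2 * sSm * chiSm * (ellOp (kapSm hf) (modeSm l)
      + (l * (l + 2) : Sm) * rhoSm hf * modeSm l) + R2 * sSm * ellOp (kapSm hf) chiSm * modeSm l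
      + l * (2 * (rhoSm hf * Eu chiSm * cSm)) * modeSm l := by
    rw [errSm, quasiSm, ellOp_mul]
    linear_combination 2 * sSm * R2_mul_gradForm hf isRadial_chiSm (modeSm l)
      + 2 * rhoSm hf * Eu chiSm * sSm_mul_Eu_modeSm l
  have h3 := (ellOp_congr (kapSm_eventuallyEq hf hp) (EventuallyEq.refl _ (modeSm l : M → ℂ))).eq_of_nhds
  have h4 := congrArg (fun u : Sm => (u : M → ℂ) p) (ellOp_modeSm l)
  have h5 : ((ellOp (kapSm hf) (modeSm l) + (l * (l + 2) : Sm) * rhoSm hf * modeSm l : Sm) : M → ℂ) p = 0 := by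
    simp only [Sm.add_apply, Sm.mul_apply] at h4 ⊢
    rw [h3, rhoSm_apply_sphere hf hp]
    exact h4
  have h6 := congrArg (fun u : Sm => (u : M → ℂ) p) h1
  simp only [Sm.add_apply, Sm.mul_apply] at h5 h6 ⊢
  rw [h5, mul_zero, zero_add] at h6
  exact h6

/-- The commutator is of first order, hence one power of l; its coefficients are bounded on the
compact shell. -/
theorem norm_errSm_le (hf : IsProfile f) : ∃ C : ℝ, 0 < C ∧ ∀ (l : ℕ) (x : E3),
    ‖(errSm hf l : M → ℂ) (0, x)‖ ≤ C * (1 + l) * ‖(modeSm l : M → ℂ) (0, x)‖ := by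
  have hπ := Real.pi_pos
  let A : Set E3 := {x | 5 * Real.pi / 6 ≤ ‖x‖ ∧ ‖x‖ ≤ 41 * Real.pi / 48}
  have hA : IsCompact A := by
    refine (isCompact_closedBall (0 : E3) (41 * Real.pi / 48)).of_isClosed_subset ?_ fun x hx =>
      mem_closedBall_zero_iff.2 hx.2
    exact (isClosed_le continuous_const continuous_norm).inter
      (isClosed_le continuous_norm continuous_const)
  have hne : A.Nonempty := ⟨EuclideanSpace.single 0 (5 * Real.pi / 6), by
    simp only [A, mem_ofPred_eq, PiLp.norm_single, Real.norm_eq_abs]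
    rw [abs_of_pos (by positivity)]
    constructor <;> linarith⟩
  obtain ⟨C₁, h₁⟩ := hA.exists_bound_of_continuousOn
    (Sm.continuous_slice (R2 * sSm * ellOp (kapSm hf) chiSm) 0).continuousOn
  obtain ⟨C₂, h₂⟩ := hA.exists_bound_of_continuousOn
    (Sm.continuous_slice (2 * (rhoSm hf * Eu chiSm * cSm)) 0).continuousOn
  -- The factor r²s, by which the error formula is multiplied, is bounded below on the shell because
  -- 0 < r < π there.
  obtain ⟨a, haA, ha⟩ := hA.exists_isMinOn hne (Sm.continuous_slice (R2 * sSm) 0).norm.continuousOn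
  have hpos : 0 < ‖((R2 * sSm : Sm) : M → ℂ) (0, a)‖ := by
    have hr : 0 < ‖a‖ := lt_of_lt_of_le (by positivity) haA.1
    have hs := Real.sin_pos_of_pos_of_lt_pi hr (lt_of_le_of_lt haA.2 (by linarith))
    rw [← norm_mul_sincN] at hs
    rw [Sm.mul_apply, R2_apply, sSm, liftR_apply]
    have : sincN a ≠ 0 := by
      intro h
      rw [h, mul_zero] at hs
      exact lt_irrefl _ hs
    rw [norm_pos_iff]
    simp only [ne_eq, mul_eq_zero, not_or]
    exact ⟨by simpa using hr.ne', by exact_mod_cast this⟩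
  set c := ‖((R2 * sSm : Sm) : M → ℂ) (0, a)‖
  refine ⟨(|C₁| + |C₂| + 1) / c, by positivity, fun l x => ?_⟩
  by_cases hx : x ∈ A
  · have h3 := R2_mul_errSm hf l (p := (0, x)) (lt_of_le_of_lt hx.2 (by linarith))
    rw [← Sm.mul_apply R2 sSm] at h3
    have h4 := congrArg norm h3
    rw [norm_mul] at h4
    have h5 : c * ‖(errSm hf l : M → ℂ) (0, x)‖
        ≤ (|C₁| + |C₂| + 1) * (1 + l) * ‖(modeSm l : M → ℂ) (0, x)‖ := by
      refine (mul_le_mul_of_nonneg_right (ha hx) (norm_nonneg _)).trans ?_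
      rw [h4]
      refine (norm_add_le _ _).trans ?_
      rw [norm_mul, norm_mul, norm_mul, ← add_mul]
      refine mul_le_mul_of_nonneg_right ?_ (norm_nonneg _)
      have e1 := (h₁ x hx).trans (le_abs_self C₁)
      have e2 := (h₂ x hx).trans (le_abs_self C₂)
      have e3 : ‖((l : ℕ) : ℂ)‖ = l := by simp
      rw [e3]
      have e4 : (0 : ℝ) ≤ l := Nat.cast_nonneg l
      have e5 := mul_le_mul_of_nonneg_left e2 e4
      nlinarith [abs_nonneg C₁, abs_nonneg C₂, mul_nonneg e4 (abs_nonneg C₁)]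
    rw [div_mul_eq_mul_div, div_mul_eq_mul_div, le_div_iff₀ hpos]
    linarith
  · have h0 : (errSm hf l : M → ℂ) (0, x) = 0 := by
      by_cases h : 5 * Real.pi / 6 ≤ ‖x‖
      · exact errSm_eq_zero_outside hf l (not_le.1 fun h2 => hx ⟨h, h2⟩)
      · exact errSm_eq_zero_inside hf l (not_le.1 h)
    rw [h0, norm_zero]
    positivity

end LogSharp

namespace LogSharp

/-! ### Comparison of annuli -/

/-- `|Y|²` for the highest weight spherical harmonic `Y` of degree `l`. -/
noncomputable def angFun (l : ℕ) (x : E3) : ℝ := ((x 0 ^ 2 + x 1 ^ 2) / ‖x‖ ^ 2) ^ l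

/-- The closed annulus. -/
def annulus (a b : ℝ) : Set E3 := {x | a ≤ ‖x‖ ∧ ‖x‖ ≤ b}

theorem angFun_nonneg (l : ℕ) (x : E3) : 0 ≤ angFun l x := by unfold angFun; positivity

theorem angFun_le_one (l : ℕ) (x : E3) : angFun l x ≤ 1 := by
  refine pow_le_one₀ (by positivity) (div_le_one_of_le₀ ?_ (by positivity))
  rw [EuclideanSpace.norm_sq_eq, Fin.sum_univ_three]
  simp only [Real.norm_eq_abs, sq_abs]
  linarith [sq_nonneg (x 2)]

theorem measurable_angFun (l : ℕ) : Measurable (angFun l) := by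
  have h : ∀ i : Fin 3, Measurable fun x : E3 => x i := fun i =>
    (EuclideanSpace.proj (𝕜 := ℝ) i).continuous.measurable
  exact ((((h 0).pow_const 2).add ((h 1).pow_const 2)).div (measurable_norm.pow_const 2)).pow_const l

theorem isClosed_annulus (a b : ℝ) : IsClosed (annulus a b) :=
  (isClosed_le continuous_const continuous_norm).inter (isClosed_le continuous_norm continuous_const)

theorem annulus_subset (a b : ℝ) : annulus a b ⊆ Metric.closedBall 0 b := fun _ hx =>
  mem_closedBall_zero_iff.2 hx.2

theorem integrableOn_angFun (l : ℕ) (a b : ℝ) : IntegrableOn (angFun l) (annulus a b) := by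
  refine Measure.integrableOn_of_bounded (M := 1)
    ((measure_mono (annulus_subset a b)).trans_lt measure_closedBall_lt_top).ne
    (measurable_angFun l).aestronglyMeasurable (Eventually.of_forall fun x => ?_)
  rw [Real.norm_of_nonneg (angFun_nonneg l x)]
  exact angFun_le_one l x

theorem angFun_smul (l : ℕ) (x : E3) : angFun l ((2 : ℝ) • x) = angFun l x := by
  rw [angFun, angFun, norm_smul]
  congr 1
  simp only [PiLp.smul_apply, smul_eq_mul, Real.norm_eq_abs]
  rw [abs_of_pos (by norm_num : (0 : ℝ) < 2), mul_pow, mul_pow, mul_pow, ← mul_add]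
  exact mul_div_mul_left _ _ (by norm_num)

open scoped Pointwise in
theorem integral_angFun_double (l : ℕ) (a b : ℝ) :
    ∫ x in annulus (2 * a) (2 * b), angFun l x = 8 * ∫ x in annulus a b, angFun l x := by
  have h := Measure.setIntegral_comp_smul_of_pos (volume : Measure E3) (angFun l) (annulus a b)
    (R := 2) (by norm_num)
  have hs : (2 : ℝ) • annulus a b = annulus (2 * a) (2 * b) := by
    ext x
    rw [mem_smul_set_iff_inv_smul_mem₀ (by norm_num)]
    simp only [annulus, mem_ofPred_eq, norm_smul, norm_inv, Real.norm_eq_abs,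
      abs_of_pos (by norm_num : (0 : ℝ) < 2)]
    constructor <;> rintro ⟨h1, h2⟩ <;> constructor <;> linarith
  simp only [angFun_smul, hs, finrank_euclideanSpace, Fintype.card_fin, smul_eq_mul] at h
  rw [h]
  norm_num
  ring

/-- The integrand is homogeneous of degree 0, so scaling by 2 costs 2³ = 8 and moves the outer
annulus into the inner one. This replaces polar integration and is uniform in l. -/
theorem integral_angFun_outer (l : ℕ) :
    ∫ x in annulus (3 * Real.pi / 4) (7 * Real.pi / 8), angFun l x
      ≤ 8 * ∫ x in annulus (Real.pi / 4) (3 * Real.pi / 4), angFun l x := by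
  have hπ := Real.pi_pos
  have h := integral_angFun_double l (3 * Real.pi / 8) (7 * Real.pi / 16)
  rw [show 2 * (3 * Real.pi / 8) = 3 * Real.pi / 4 by ring,
    show 2 * (7 * Real.pi / 16) = 7 * Real.pi / 8 by ring] at h
  rw [h]
  refine mul_le_mul_of_nonneg_left (setIntegral_mono_set (integrableOn_angFun _ _ _)
    (Eventually.of_forall (angFun_nonneg l)) (LE.le.eventuallyLE fun x hx => ?_)) (by norm_num)
  exact ⟨by linarith [hx.1], by linarith [hx.2]⟩

theorem norm_modeSm_sq (l : ℕ) {t : ℝ} {x : E3} (hx : x ≠ 0) :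
    ‖(modeSm l : M → ℂ) (t, x)‖ ^ 2 = (Real.sin ‖x‖ ^ 2) ^ l * angFun l x := by
  have hr : ‖x‖ ≠ 0 := norm_ne_zero_iff.2 hx
  have hp : ∀ (u : Sm) (n : ℕ) (p : M), ((u ^ n : Sm) : M → ℂ) p = (u : M → ℂ) p ^ n := fun u n p => rfl
  have hz : ‖(zSm : M → ℂ) (t, x)‖ ^ 2 = x 0 ^ 2 + x 1 ^ 2 := by
    rw [Complex.sq_norm, zSm, Sm.add_apply, Sm.mul_apply, X_apply, X_apply]
    change Complex.normSq (_ + Complex.I * _) = _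
    rw [Complex.normSq_apply]
    simp
    ring
  have hs : ‖(sSm : M → ℂ) (t, x)‖ ^ 2 = Real.sin ‖x‖ ^ 2 / ‖x‖ ^ 2 := by
    rw [sSm, liftR_apply, Complex.norm_real, Real.norm_eq_abs, sq_abs, ← norm_mul_sincN]
    field_simp
  rw [modeSm, Sm.mul_apply, hp, hp, norm_mul, norm_pow, norm_pow, mul_pow, ← pow_mul, ← pow_mul,
    mul_comm l 2, pow_mul, pow_mul, hz, hs, angFun, ← mul_pow, ← mul_pow]
  congr 1
  ring

theorem sin_sq_ge_half {r : ℝ} (h1 : Real.pi / 4 ≤ r) (h2 : r ≤ 3 * Real.pi / 4) :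
    1 / 2 ≤ Real.sin r ^ 2 := by
  have h := Real.cos_nonpos_of_pi_div_two_le_of_le (x := 2 * r) (by linarith) (by linarith)
  rw [Real.sin_sq_eq_half_sub]
  linarith

theorem sin_sq_le_half {r : ℝ} (h1 : 3 * Real.pi / 4 ≤ r) (h2 : r ≤ Real.pi) :
    Real.sin r ^ 2 ≤ 1 / 2 := by
  have h := Real.cos_nonneg_of_neg_pi_div_two_le_of_le (x := 2 * r - 2 * Real.pi) (by linarith)
    (by linarith [Real.pi_pos])
  rw [Real.cos_sub_two_pi] at h
  rw [Real.sin_sq_eq_half_sub]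
  linarith

theorem sin_sq_le_quarter {r : ℝ} (h1 : 5 * Real.pi / 6 ≤ r) (h2 : r ≤ Real.pi) :
    Real.sin r ^ 2 ≤ 1 / 4 := by
  have h3 : Real.sin r ≤ 1 / 2 := by
    rw [← Real.sin_pi_sub, ← Real.sin_pi_div_six]
    exact Real.sin_le_sin_of_le_of_le_pi_div_two (by linarith [Real.pi_pos])
      (by linarith [Real.pi_pos]) (by linarith)
  have h4 : 0 ≤ Real.sin r := Real.sin_nonneg_of_nonneg_of_le_pi (by linarith [Real.pi_pos]) h2
  nlinarith

variable {f : ℝ → ℝ}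

theorem exists_rhoFun_bounds (hf : IsProfile f) : ∃ c C : ℝ, 0 < c ∧ 0 < C ∧
    ∀ x, c ≤ rhoFun f x ∧ rhoFun f x ≤ C := by
  have hK := isCompact_closedBall (0 : E3) Real.pi
  have hne : (Metric.closedBall (0 : E3) Real.pi).Nonempty := ⟨0, by simp [Real.pi_pos.le]⟩
  have hc : ContinuousOn (rhoFun f) (Metric.closedBall (0 : E3) Real.pi) :=
    (contDiff_rhoFun hf).continuous.continuousOn
  obtain ⟨a, -, ha⟩ := hK.exists_isMinOn hne hc
  obtain ⟨b, -, hb⟩ := hK.exists_isMaxOn hne hc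
  refine ⟨min 1 (rhoFun f a), max 1 (rhoFun f b), lt_min one_pos (rhoFun_pos hf a),
    lt_max_of_lt_left one_pos, fun x => ?_⟩
  by_cases hx : ‖x‖ ≤ Real.pi
  · have hx' : x ∈ Metric.closedBall (0 : E3) Real.pi := mem_closedBall_zero_iff.2 hx
    exact ⟨(min_le_right _ _).trans (ha hx'), (hb hx').trans (le_max_right _ _)⟩
  · rw [rhoFun_eq_one hf (not_le.1 hx).le]
    simp

/-- The density of the mass of the quasimode. -/
noncomputable def massDens (f : ℝ → ℝ) (l : ℕ) (x : E3) : ℝ :=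
  rhoFun f x * ‖(quasiSm l : M → ℂ) (0, x)‖ ^ 2

/-- The density of the error of the quasimode. -/
noncomputable def errDens (hf : IsProfile f) (l : ℕ) (x : E3) : ℝ :=
  (rhoFun f x)⁻¹ * ‖(errSm hf l : M → ℂ) (0, x)‖ ^ 2

theorem massDens_nonneg (hf : IsProfile f) (l : ℕ) (x : E3) : 0 ≤ massDens f l x :=
  mul_nonneg (rhoFun_pos hf x).le (sq_nonneg _)

theorem errDens_nonneg (hf : IsProfile f) (l : ℕ) (x : E3) : 0 ≤ errDens hf l x :=
  mul_nonneg (inv_nonneg.2 (rhoFun_pos hf x).le) (sq_nonneg _)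

theorem continuous_massDens (hf : IsProfile f) (l : ℕ) : Continuous (massDens f l) :=
  (contDiff_rhoFun hf).continuous.mul ((Sm.continuous_slice _ 0).norm.pow 2)

theorem continuous_errDens (hf : IsProfile f) (l : ℕ) : Continuous (errDens hf l) :=
  ((contDiff_rhoFun hf).continuous.inv₀ fun x => (rhoFun_pos hf x).ne').mul
    ((Sm.continuous_slice _ 0).norm.pow 2)

theorem hasCompactSupport_massDens (f : ℝ → ℝ) (l : ℕ) : HasCompactSupport (massDens f l) :=
  HasCompactSupport.intro (isCompact_closedBall (0 : E3) (41 * Real.pi / 48)) fun x hx => by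
    simp only [Metric.mem_closedBall, dist_zero_right, not_le] at hx
    rw [massDens, quasiSm_eq_zero l (p := (0, x)) hx.le]
    simp

theorem hasCompactSupport_errDens (hf : IsProfile f) (l : ℕ) : HasCompactSupport (errDens hf l) :=
  HasCompactSupport.intro (isCompact_closedBall (0 : E3) (41 * Real.pi / 48)) fun x hx => by
    simp only [Metric.mem_closedBall, dist_zero_right, not_le] at hx
    rw [errDens, errSm_eq_zero_outside hf l (p := (0, x)) hx]
    simp

theorem integrable_massDens (hf : IsProfile f) (l : ℕ) : Integrable (massDens f l) :=
  (continuous_massDens hf l).integrable_of_hasCompactSupport (hasCompactSupport_massDens f l)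

theorem integrable_errDens (hf : IsProfile f) (l : ℕ) : Integrable (errDens hf l) :=
  (continuous_errDens hf l).integrable_of_hasCompactSupport (hasCompactSupport_errDens hf l)

theorem integral_massDens_pos (hf : IsProfile f) (l : ℕ) : 0 < ∫ x, massDens f l x := by
  have hπ := Real.pi_pos
  refine (continuous_massDens hf l).integral_pos_of_hasCompactSupport_nonneg_nonzero
    (hasCompactSupport_massDens f l) (massDens_nonneg hf l)
    (x := EuclideanSpace.single 0 (Real.pi / 2)) ?_
  set x : E3 := EuclideanSpace.single 0 (Real.pi / 2)
  have hn : ‖x‖ = Real.pi / 2 := by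
    simp only [x, PiLp.norm_single, Real.norm_eq_abs]
    exact abs_of_pos (by positivity)
  have hx : x ≠ 0 := by
    rw [← norm_ne_zero_iff, hn]; positivity
  rw [massDens, quasiSm_eq_mode l (p := (0, x)) (by simp only [hn]; linarith), norm_modeSm_sq l hx, hn]
  have h1 : angFun l x = 1 := by
    have h2 : x 0 ^ 2 + x 1 ^ 2 = ‖x‖ ^ 2 := by
      rw [hn]; simp [x]
    rw [angFun, h2, div_self (by rw [hn]; positivity), one_pow]
  rw [h1]
  simpa using (rhoFun_pos hf x).ne'

/-- The quasimode is concentrated in `r ≤ 3π/4`, and its error is exponentially small. -/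
theorem quasimode_estimates (hf : IsProfile f) : ∃ C : ℝ, 0 < C ∧ ∀ l : ℕ, 1 ≤ l →
    0 < ∫ x in Metric.closedBall 0 (3 * Real.pi / 4), massDens f l x ∧
    ∫ x, massDens f l x ≤ C * ∫ x in Metric.closedBall 0 (3 * Real.pi / 4), massDens f l x ∧
    ∫ x, errDens hf l x ≤ C * l ^ 2 * (1 / 2) ^ l
      * ∫ x in Metric.closedBall 0 (3 * Real.pi / 4), massDens f l x := by
  have hπ := Real.pi_pos
  obtain ⟨c, C₁, hc, hC₁, hρ⟩ := exists_rhoFun_bounds hf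
  obtain ⟨C₂, hC₂, herr⟩ := norm_errSm_le hf
  -- Everything is expressed by the angular integrals over two annuli: sin² r ≥ 1/2 on the inner
  -- one, sin² r ≤ 1/2 on the outer one, and sin² r ≤ 1/4 where the error lives.
  have key : ∀ l : ℕ, 1 ≤ l →
      c * (1 / 2) ^ l * (∫ x in annulus (Real.pi / 4) (3 * Real.pi / 4), angFun l x)
        ≤ ∫ x in Metric.closedBall 0 (3 * Real.pi / 4), massDens f l x ∧
      ∫ x, massDens f l x ≤ (∫ x in Metric.closedBall 0 (3 * Real.pi / 4), massDens f l x)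
        + C₁ * (1 / 2) ^ l * ∫ x in annulus (3 * Real.pi / 4) (7 * Real.pi / 8), angFun l x ∧
      ∫ x, errDens hf l x ≤ c⁻¹ * (C₂ * (1 + l)) ^ 2 * (1 / 4) ^ l
        * ∫ x in annulus (3 * Real.pi / 4) (7 * Real.pi / 8), angFun l x := by
    intro l hl
    refine ⟨?_, ?_, ?_⟩
    · rw [← integral_const_mul]
      refine (setIntegral_mono_on ((integrableOn_angFun l _ _).const_mul _)
        (integrable_massDens hf l).integrableOn (isClosed_annulus _ _).measurableSet
        fun x hx => ?_).trans (setIntegral_mono_set (integrable_massDens hf l).integrableOn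
          (Eventually.of_forall (massDens_nonneg hf l)) (annulus_subset _ _).eventuallyLE)
      have hx0 : x ≠ 0 := by
        rw [← norm_pos_iff]; linarith [hx.1]
      rw [massDens, quasiSm_eq_mode l (p := (0, x)) (by simp only; linarith [hx.2]),
        norm_modeSm_sq l hx0, mul_assoc]
      have h1 := pow_le_pow_left₀ (by norm_num) (sin_sq_ge_half hx.1 hx.2) l
      exact mul_le_mul (hρ x).1 (mul_le_mul_of_nonneg_right h1 (angFun_nonneg l x))
        (mul_nonneg (by positivity) (angFun_nonneg l x)) (rhoFun_pos hf x).le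
    · have hB : MeasurableSet (Metric.closedBall (0 : E3) (3 * Real.pi / 4)) := measurableSet_closedBall
      rw [← integral_add_compl hB (integrable_massDens hf l), ← integral_const_mul]
      refine add_le_add_right ?_ _
      rw [← integral_indicator hB.compl, ← integral_indicator (isClosed_annulus _ _).measurableSet]
      refine integral_mono ((integrable_indicator_iff hB.compl).2 (integrable_massDens hf l).integrableOn)
        ((integrable_indicator_iff (isClosed_annulus _ _).measurableSet).2
          ((integrableOn_angFun l _ _).const_mul _)) fun x => ?_
      by_cases hx : x ∈ Metric.closedBall (0 : E3) (3 * Real.pi / 4)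
      · rw [indicator_of_notMem (by simpa using hx)]
        exact indicator_nonneg (fun y _ => mul_nonneg (by positivity) (angFun_nonneg l y)) x
      · rw [indicator_of_mem (by simpa using hx)]
        rw [mem_closedBall_zero_iff, not_le] at hx
        by_cases hx2 : ‖x‖ ≤ 7 * Real.pi / 8
        · rw [indicator_of_mem (show x ∈ annulus _ _ from ⟨hx.le, hx2⟩), massDens, mul_assoc]
          have hx0 : x ≠ 0 := by
            rw [← norm_pos_iff]; linarith
          have h1 := pow_le_pow_left₀ (sq_nonneg _) (sin_sq_le_half hx.le (by linarith)) l
          have h2 := pow_le_pow_left₀ (norm_nonneg _) (norm_quasiSm_le l (0, x)) 2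
          rw [norm_modeSm_sq l hx0] at h2
          exact mul_le_mul (hρ x).2 (h2.trans (mul_le_mul_of_nonneg_right h1 (angFun_nonneg l x)))
            (sq_nonneg _) hC₁.le
        · rw [massDens, quasiSm_eq_zero l (p := (0, x)) (by simp only; linarith)]
          simp only [norm_zero, ne_eq, OfNat.ofNat_ne_zero, not_false_eq_true, zero_pow, mul_zero]
          exact indicator_nonneg (fun y _ => mul_nonneg (by positivity) (angFun_nonneg l y)) x
    · rw [← integral_const_mul, ← integral_indicator (isClosed_annulus _ _).measurableSet]
      refine integral_mono (integrable_errDens hf l)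
        ((integrable_indicator_iff (isClosed_annulus _ _).measurableSet).2
          ((integrableOn_angFun l _ _).const_mul _)) fun x => ?_
      have hnn := indicator_nonneg (s := annulus (3 * Real.pi / 4) (7 * Real.pi / 8))
        (f := fun y => c⁻¹ * (C₂ * (1 + l)) ^ 2 * (1 / 4) ^ l * angFun l y)
        (fun y _ => mul_nonneg (by positivity) (angFun_nonneg l y)) x
      rcases lt_or_ge ‖x‖ (5 * Real.pi / 6) with h1 | h1
      · rw [errDens, errSm_eq_zero_inside hf l (p := (0, x)) h1]
        simpa using hnn
      · rcases lt_or_ge (41 * Real.pi / 48) ‖x‖ with h2 | h2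
        · rw [errDens, errSm_eq_zero_outside hf l (p := (0, x)) h2]
          simpa using hnn
        · rw [indicator_of_mem (show x ∈ annulus (3 * Real.pi / 4) (7 * Real.pi / 8) from
            ⟨by linarith, by linarith⟩), errDens, mul_assoc, mul_assoc]
          have hx0 : x ≠ 0 := by
            rw [← norm_pos_iff]; linarith
          have h3 := pow_le_pow_left₀ (sq_nonneg _) (sin_sq_le_quarter h1 (by linarith)) l
          have h4 := pow_le_pow_left₀ (norm_nonneg _) (herr l x) 2
          rw [mul_pow, norm_modeSm_sq l hx0] at h4
          refine mul_le_mul (inv_anti₀ hc (hρ x).1) (h4.trans ?_) (sq_nonneg _) (inv_nonneg.2 hc.le)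
          exact mul_le_mul_of_nonneg_left (mul_le_mul_of_nonneg_right h3 (angFun_nonneg l x)) (sq_nonneg _)
  refine ⟨1 + 8 * C₁ / c + 32 * C₂ ^ 2 / c ^ 2, by positivity, fun l hl => ?_⟩
  obtain ⟨h1, h2, h3⟩ := key l hl
  have h4 := integral_angFun_outer l
  have h5 := integral_massDens_pos hf l
  set N := ∫ x in Metric.closedBall 0 (3 * Real.pi / 4), massDens f l x
  set J := ∫ x in annulus (Real.pi / 4) (3 * Real.pi / 4), angFun l x
  set J' := ∫ x in annulus (3 * Real.pi / 4) (7 * Real.pi / 8), angFun l x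
  have hJ : 0 ≤ J := integral_nonneg (angFun_nonneg l)
  -- The two angular integrals are comparable, and 2^{-l} times the inner one is bounded by the mass
  -- in the ball.
  have h6 : (1 / 2 : ℝ) ^ l * J' ≤ 8 / c * N := by
    rw [div_mul_eq_mul_div, le_div_iff₀ hc]
    have : (1 / 2 : ℝ) ^ l * J' ≤ (1 / 2 : ℝ) ^ l * (8 * J) := mul_le_mul_of_nonneg_left h4 (by positivity)
    nlinarith
  have h7 : ∫ x, massDens f l x ≤ (1 + 8 * C₁ / c) * N := by
    refine h2.trans ?_
    have := mul_le_mul_of_nonneg_left h6 hC₁.le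
    have h8 : (1 + 8 * C₁ / c) * N = N + C₁ * (8 / c * N) := by ring
    rw [h8, mul_assoc]
    linarith
  have hN : 0 < N := by
    have : 0 < (1 + 8 * C₁ / c) * N := h5.trans_le h7
    exact (pos_iff_pos_of_mul_pos this).1 (by positivity)
  refine ⟨hN, h7.trans (mul_le_mul_of_nonneg_right (le_add_of_nonneg_right (by positivity)) hN.le), ?_⟩
  have hl1 : (1 : ℝ) ≤ l := by exact_mod_cast hl
  have h9 : (1 + (l : ℝ)) ^ 2 ≤ 4 * l ^ 2 := by nlinarith
  calc ∫ x, errDens hf l x ≤ c⁻¹ * (C₂ * (1 + l)) ^ 2 * (1 / 4) ^ l * J' := h3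
    -- Split 4^{-l} into two factors 2^{-l}: one is spent on the comparison with N, the other is the
    -- gain.
    _ = c⁻¹ * C₂ ^ 2 * (1 / 2) ^ l * ((1 + (l : ℝ)) ^ 2 * ((1 / 2) ^ l * J')) := by
        rw [show (1 / 4 : ℝ) = 1 / 2 * (1 / 2) by norm_num, mul_pow, mul_pow]; ring
    _ ≤ c⁻¹ * C₂ ^ 2 * (1 / 2) ^ l * (4 * l ^ 2 * (8 / c * N)) := by
        refine mul_le_mul_of_nonneg_left ?_ (by positivity)
        exact mul_le_mul h9 h6 (mul_nonneg (by positivity) (integral_nonneg (angFun_nonneg l)))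
          (by positivity)
    _ = (32 * C₂ ^ 2 / c ^ 2) * (l ^ 2 * (1 / 2) ^ l * N) := by field_simp; ring
    _ ≤ (1 + 8 * C₁ / c + 32 * C₂ ^ 2 / c ^ 2) * (l ^ 2 * (1 / 2) ^ l * N) :=
        mul_le_mul_of_nonneg_right (le_add_of_nonneg_left (by positivity)) (by positivity)
    _ = _ := by ring

end LogSharp

namespace LogSharp

/-! ### Solutions with data in a spherical mode -/

theorem dt_lap (u : Sm) : dt (lap u) = lap (dt u) := by simp only [lap, map_sum, dt_dx]

theorem dt_rot (a b : Fin 3) (u : Sm) : dt (rot a b u) = rot a b (dt u) := by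
  simp [rot_apply, Derivation.leibniz, dt_X, dt_dx]

theorem dt_sphLap (u : Sm) : dt (sphLap u) = sphLap (dt u) := by
  simp only [sphLap, map_add, dt_rot]

theorem sphLap_sub (u v : Sm) : sphLap (u - v) = sphLap u - sphLap v := by
  simp only [sphLap, map_sub]; ring

theorem sphLap_smul (c : ℂ) (u : Sm) : sphLap (c • u) = c • sphLap u := by
  simp only [sphLap, Derivation.map_smul, smul_add]

theorem lap_smul (c : ℂ) (u : Sm) : lap (c • u) = c • lap u := by
  simp only [lap, Derivation.map_smul, Finset.smul_sum]

variable {f : ℝ → ℝ}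

/-- The potential felt by `√ρ ψ` for a mode with eigenvalue `-c`. -/
noncomputable def modePot (hf : IsProfile f) (c : ℂ) : Sm :=
  nuSm hf * lap (muSm hf) - c • (kapSm hf * nuSm hf * nuSm hf)

theorem dt_modePot (hf : IsProfile f) (c : ℂ) : dt (modePot hf c) = 0 := by
  have h1 : dt (nuSm hf) = 0 := dt_lift _ _
  have h2 : dt (muSm hf) = 0 := dt_lift _ _
  have h3 : dt (kapSm hf) = 0 := dt_lift _ _
  have h4 : dt (lap (muSm hf)) = 0 := by rw [dt_lap, h2]; simp [lap]
  simp [modePot, Derivation.leibniz, h1, h3, h4]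

theorem isRadial_modePot (hf : IsProfile f) (c : ℂ) : IsRadial (modePot hf c) := by
  have h1 := (isRadial_muSm hf).of_mul_eq_one (muSm_mul_nuSm hf)
  refine (h1.mul (isRadial_muSm hf).lap).sub fun a b => ?_
  rw [Derivation.map_smul, ((isRadial_kapSm hf).mul h1).mul h1 a b, smul_zero]

theorem modePot_eq_zero (hf : IsProfile f) (c : ℂ) {p : M} (hp : Real.pi < ‖p.2‖) :
    (modePot hf c : M → ℂ) p = 0 := by
  have h1 : (muSm hf : M → ℂ) =ᶠ[𝓝 p] ((1 : Sm) : M → ℂ) := by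
    have h2 : {q : M | Real.pi < ‖q.2‖} ∈ 𝓝 p :=
      (isOpen_lt continuous_const (by fun_prop)).mem_nhds hp
    filter_upwards [h2] with q hq
    rw [muSm, liftR_apply, rhoFun_eq_one hf (le_of_lt hq), Real.sqrt_one]
    rfl
  have h3 : (lap (muSm hf) : M → ℂ) p = 0 := by
    simp only [lap, Sm.sum_apply]
    refine Finset.sum_eq_zero fun i _ => ?_
    rw [(dd_congr (dd_congr h1 _) _).eq_of_nhds]
    simp
  rw [modePot, Sm.sub_apply, Sm.smul_apply, Sm.mul_apply, Sm.mul_apply, Sm.mul_apply, h3, kapSm,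
    liftR_apply, kapFun_eq_zero hf hp.le]
  simp

/-- Solve the flat equation with potential for √ρψ and divide by √ρ. The reduction requires the flat
solution to stay in the spherical mode, which follows from uniqueness. -/
theorem exists_mode_solution (hf : IsProfile f) {q : Sm} {R : ℝ}
    (hR : ∀ p : M, R < ‖p.2‖ → (q : M → ℂ) p = 0) {c : ℂ} (hΛ : sphLap q = -c • q) (a : ℂ) :
    ∃ ψ : Sm, waveOp hf.isCoef ψ = 0 ∧ VanishAtZero (ψ - q) ∧ VanishAtZero (dt ψ - a • q) := by
  have hslice : ∀ u : Sm, ContDiff ℝ ∞ fun x => (u : M → ℂ) (0, x) := fun u =>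
    (Sm.contDiff u).comp (contDiff_const.prodMk contDiff_id)
  have hsupp : ∀ (u : Sm) (R : ℝ), (∀ p : M, R < ‖p.2‖ → (u : M → ℂ) p = 0) →
      HasCompactSupport fun x => (u : M → ℂ) (0, x) := fun u R h =>
    HasCompactSupport.intro (isCompact_closedBall (0 : E3) R) fun x hx => h (0, x) (by
      simpa using hx)
  have hQc := hsupp (modePot hf c) Real.pi fun p => modePot_eq_zero hf c
  have hμq : ∀ p : M, R < ‖p.2‖ → ((muSm hf * q : Sm) : M → ℂ) p = 0 := fun p hp => by
    rw [Sm.mul_apply, hR p hp, mul_zero]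
  obtain ⟨u, hu, hu0, hu1, huw⟩ := exists_wave_solution (hslice (modePot hf c)) hQc
    (hslice (muSm hf * q)) (hsupp _ R hμq) (hslice (a • (muSm hf * q)))
    (hsupp _ R fun p hp => by rw [Sm.smul_apply, hμq p hp, mul_zero])
  let Ψ : Sm := ⟨u, hu⟩
  have hpot : ∀ p : M, (modePot hf c : M → ℂ) (0, p.2) = (modePot hf c : M → ℂ) p := fun p =>
    (static_of_dt_eq_zero (dt_modePot hf c) p.1 p.2).symm
  have hΨ : dt (dt Ψ) = lap Ψ - modePot hf c * Ψ := by
    ext p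
    have h1 := huw p
    rw [hpot] at h1
    rw [Sm.sub_apply, Sm.mul_apply, lap, Sm.sum_apply]
    exact h1
  have h0 : VanishAtZero (Ψ - muSm hf * q) := fun x => by
    rw [Sm.sub_apply]; exact sub_eq_zero.2 (hu0 x)
  have h1 : VanishAtZero (dt Ψ - a • (muSm hf * q)) := fun x => by
    rw [Sm.sub_apply]; exact sub_eq_zero.2 (hu1 x)
  have hμΛ : sphLap (muSm hf * q) = -c • (muSm hf * q) := by
    rw [(isRadial_muSm hf).sphLap_mul, hΛ, mul_smul_comm]
  -- The spherical Laplacian commutes with Δ and with the radial potential, so Δ_{S²}Ψ + cΨ solves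
  -- the same equation, and with zero data.
  have hmode : sphLap Ψ + c • Ψ = 0 := by
    obtain ⟨B, hB⟩ := hQc.exists_bound_of_continuous (hslice _).continuous
    refine eq_zero_of_wave (q := modePot hf c) (B := B) (fun p => by rw [← hpot]; exact hB p.2) ?_ ?_ ?_
    · rw [map_add, map_add, Derivation.map_smul, Derivation.map_smul, dt_sphLap, dt_sphLap, hΨ,
        sphLap_sub, sphLap_lap, (isRadial_modePot hf c).sphLap_mul, lap_add, lap_smul, smul_sub,
        mul_add, mul_smul_comm]
      ring
    · have h2 := h0.sphLap.add (h0.smul c)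
      rw [sphLap_sub, hμΛ, smul_sub, neg_smul] at h2
      convert h2 using 1
      ring
    · have h2 := h1.sphLap.add (h1.smul c)
      rw [sphLap_sub, sphLap_smul, hμΛ, smul_sub, neg_smul, smul_neg, smul_comm a c] at h2
      rw [map_add, dt_sphLap, Derivation.map_smul]
      convert h2 using 1
      ring
  have hνμ : nuSm hf * muSm hf = 1 := by rw [mul_comm]; exact muSm_mul_nuSm hf
  have hνt : dt (nuSm hf) = 0 := dt_lift _ _
  refine ⟨nuSm hf * Ψ, ?_, ?_, ?_⟩
  · have h2 := ellOp_of_mode (isRadial_kapSm hf) (isRadial_muSm hf) (muSm_mul_nuSm hf)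
      (by rw [← rhoSm_eq, muSm_mul_self]) (c := c) (u := Ψ) (by
        rw [neg_smul]; exact eq_neg_of_add_eq_zero_left hmode)
    have h3 : dt (dt (nuSm hf * Ψ)) = nuSm hf * dt (dt Ψ) := by
      have h4 : ∀ u, dt (nuSm hf * u) = nuSm hf * dt u := fun u => by
        rw [Derivation.leibniz, hνt, smul_zero, add_zero, smul_eq_mul]
      rw [h4, h4]
    rw [waveOp, ← kapSm_eq_kSm hf, ← rhoSm_eq_rSm hf, h2, ← muSm_mul_self, h3, hΨ, modePot]
    linear_combination (muSm hf * (lap Ψ - (nuSm hf * lap (muSm hf)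
      - c • (kapSm hf * nuSm hf * nuSm hf)) * Ψ)) * hνμ
  · convert h0.mul_left (nuSm hf) using 1
    linear_combination q * hνμ
  · convert h1.mul_left (nuSm hf) using 1
    rw [Derivation.leibniz, hνt, mul_sub, mul_smul_comm, ← mul_assoc, hνμ]
    simp

end LogSharp

namespace LogSharp

/-! ### Energy densities -/

variable {k : E3 → ℝ}

theorem waveOp_dt (hk : IsCoef k) (u : Sm) : waveOp hk (dt u) = dt (waveOp hk u) := by
  have h1 : dt (rSm hk) = 0 := dt_lift _ _
  have h2 : dt (kSm hk) = 0 := dt_lift _ _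
  rw [waveOp, waveOp, map_sub, dt_ellOp h2, Derivation.leibniz, h1, smul_zero, add_zero, smul_eq_mul]

theorem waveOp_add (hk : IsCoef k) (u v : Sm) : waveOp hk (u + v) = waveOp hk u + waveOp hk v := by
  simp only [waveOp, map_add, ellOp_add]; ring

theorem waveOp_smul (hk : IsCoef k) (c : ℂ) (u : Sm) : waveOp hk (c • u) = c • waveOp hk u := by
  simp only [waveOp, Derivation.map_smul, ellOp_smul, smul_sub, mul_smul_comm]

theorem continuous_enDens (hk : IsCoef k) (u : Sm) : Continuous (enDens k u) := by
  have h := Complex.continuous_re.comp (Sm.continuous (energyForm (rSm hk) (kSm hk) u (cj u)))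
  refine h.congr fun x => ?_
  simp only [Function.comp_apply, ofReal_enDens hk, Complex.ofReal_re]

theorem enDens_ge (hk : IsCoef k) (u : Sm) (p : M) :
    (1 + ‖p.2‖ ^ 2 * k p.2) * ‖(dt u : M → ℂ) p‖ ^ 2 ≤ enDens k u p := by
  have h1 := (gradDens_bound hk p.2 fun i => pd (Sum.inr i) (u : M → ℂ) p).1
  rw [enDens, add_assoc, dd_apply]
  exact le_add_of_nonneg_right h1

theorem enDens_smul (k : E3 → ℝ) (c : ℂ) (u : Sm) (p : M) :
    enDens k ((c • u : Sm) : M → ℂ) p = ‖c‖ ^ 2 * enDens k u p := by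
  have h : ∀ μ, pd μ ((c • u : Sm) : M → ℂ) p = c * pd μ (u : M → ℂ) p := fun μ => by
    have := congrArg (fun v : Sm => (v : M → ℂ) p) ((dd μ).map_smul c u)
    exact this
  have h2 : ∑ i, (p.2 i : ℂ) * (c * pd (Sum.inr i) (u : M → ℂ) p)
      = c * ∑ i, (p.2 i : ℂ) * pd (Sum.inr i) (u : M → ℂ) p := by
    rw [Finset.mul_sum]
    exact Finset.sum_congr rfl fun i _ => by ring
  simp only [enDens, h, h2, norm_mul, mul_pow, ← Finset.mul_sum]
  ring

/-- The parallelogram law for the energy form, without its nonnegative term for u + v. -/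
theorem enDens_sub_le (hk : IsCoef k) (u v : Sm) (p : M) :
    enDens k ((u - v : Sm) : M → ℂ) p ≤ 2 * enDens k u p + 2 * enDens k v p := by
  have h1 : energyForm (rSm hk) (kSm hk) (u - v) (cj (u - v))
      + energyForm (rSm hk) (kSm hk) (u + v) (cj (u + v))
      = 2 * energyForm (rSm hk) (kSm hk) u (cj u) + 2 * energyForm (rSm hk) (kSm hk) v (cj v) := by
    simp only [energyForm, gradForm, map_add, map_sub, Fin.sum_univ_three]
    ring
  have h2 := congrArg (fun w : Sm => (w : M → ℂ) p) h1
  simp only [Sm.add_apply, Sm.mul_apply, ofReal_enDens hk] at h2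
  have h3 : enDens k ((u - v : Sm) : M → ℂ) p + enDens k ((u + v : Sm) : M → ℂ) p
      = 2 * enDens k u p + 2 * enDens k v p := by
    apply Complex.ofReal_injective
    push_cast
    exact h2
  linarith [enDens_nonneg hk ((u + v : Sm) : M → ℂ) p]

/-- Green's identity in pointwise form. -/
theorem gradForm_add_mul_ellOp (κ u v : Sm) :
    gradForm κ u v + v * ellOp κ u = ∑ i, dx i (v * (dx i u + κ * X i * Eu u)) := by
  simp only [gradForm, ellOp, Derivation.leibniz, smul_eq_mul, Eu_apply v, Fin.sum_univ_three]
  ring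

theorem ellOp_sub (κ u v : Sm) : ellOp κ (u - v) = ellOp κ u - ellOp κ v := by
  have h := ellOp_add κ (u - v) v
  rw [sub_add_cancel] at h
  rw [h, add_sub_cancel_right]

/-! ### The energy of the quasimode -/

variable {f : ℝ → ℝ}

theorem enDens_quasiSm_eq_zero (k : E3 → ℝ) (l : ℕ) {p : M} (h : 41 * Real.pi / 48 < ‖p.2‖) :
    enDens k (quasiSm l) p = 0 := by
  have h1 : (quasiSm l : M → ℂ) =ᶠ[𝓝 p] ((0 : Sm) : M → ℂ) := by
    have h2 : {q : M | 41 * Real.pi / 48 < ‖q.2‖} ∈ 𝓝 p :=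
      (isOpen_lt continuous_const (by fun_prop)).mem_nhds h
    filter_upwards [h2] with q hq
    exact quasiSm_eq_zero l (le_of_lt hq)
  have h3 : ∀ μ, pd μ (quasiSm l : M → ℂ) p = 0 := fun μ => by
    have := (dd_congr h1 μ).eq_of_nhds
    rw [map_zero] at this
    exact this
  simp [enDens, h3]

theorem integrable_enDens_quasiSm (hf : IsProfile f) (l : ℕ) :
    Integrable fun x => enDens (kapFun f) (quasiSm l) (0, x) :=
  (continuous_enDens_slice hf.isCoef (quasiSm l) 0).integrable_of_hasCompactSupport
    (HasCompactSupport.intro (isCompact_closedBall (0 : E3) (41 * Real.pi / 48)) fun x hx =>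
      enDens_quasiSm_eq_zero _ l (by simpa using hx))

/-- Testing the quasimode equation with the conjugate of q gives the gradient energy as λ² times the
mass minus Re⟨q, err⟩. The last term is at most mass plus error, since the weights ρ and ρ⁻¹ cancel
in the product. -/
theorem integral_enDens_quasiSm_le (hf : IsProfile f) (l : ℕ) :
    ∫ x, enDens (kapFun f) (quasiSm l) (0, x)
      ≤ (l * (l + 2) + 1) * (∫ x, massDens f l x) + ∫ x, errDens hf l x := by
  set q := quasiSm l
  set K := kapSm hf
  have hS : SpatialSupport (cj q) 0 (41 * Real.pi / 48) := fun s _ x hx => by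
    rw [cj_apply, quasiSm_eq_zero l (p := (s, x)) hx, map_zero]
  have hG : energyForm (rhoSm hf) K q (cj q) = -(cj q * errSm hf l)
      + (l * (l + 2) : Sm) * rhoSm hf * (q * cj q) + ∑ i, dx i (cj q * (dx i q + K * X i * Eu q)) := by
    rw [← gradForm_add_mul_ellOp, energyForm, dt_quasiSm, errSm]
    ring
  have hpt : ∀ x, (enDens (kapFun f) q (0, x) : ℂ)
      = ((-((starRingEnd ℂ) ((q : M → ℂ) (0, x)) * (errSm hf l : M → ℂ) (0, x)).re
          + l * (l + 2) * massDens f l x : ℝ) : ℂ)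
        + (-Complex.I * ((starRingEnd ℂ) ((q : M → ℂ) (0, x)) * (errSm hf l : M → ℂ) (0, x)).im
        + ∑ i, (dx i (cj q * (dx i q + K * X i * Eu q)) : M → ℂ) (0, x)) := by
    intro x
    have h1 := congrArg (fun u : Sm => (u : M → ℂ) (0, x)) hG
    have h2 := ofReal_enDens hf.isCoef q (0, x)
    rw [← kapSm_eq_kSm hf, ← rhoSm_eq_rSm hf] at h2
    rw [← h2]
    rw [h1, Sm.add_apply, Sm.add_apply, Sm.sum_apply, ← add_assoc]
    congr 1
    simp only [Sm.neg_apply, Sm.mul_apply, Sm.add_apply, cj_apply]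
    rw [Complex.mul_conj, Complex.normSq_eq_norm_sq, massDens]
    have h3 := Complex.re_add_im ((starRingEnd ℂ) ((q : M → ℂ) (0, x)) * (errSm hf l : M → ℂ) (0, x))
    rw [rhoSm, liftR_apply]
    change _ + (l : ℂ) * ((l : ℂ) + 2) * _ * _ = _
    push_cast
    linear_combination h3
  have hre : ∀ x, enDens (kapFun f) q (0, x)
      = -((starRingEnd ℂ) ((q : M → ℂ) (0, x)) * (errSm hf l : M → ℂ) (0, x)).re
          + l * (l + 2) * massDens f l x
        + ∑ i, ((dx i (cj q * (dx i q + K * X i * Eu q)) : M → ℂ) (0, x)).re := fun x => by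
    have h1 := congrArg Complex.re (hpt x)
    rw [Complex.add_re, Complex.add_re, Complex.ofReal_re, Complex.ofReal_re, Complex.re_sum] at h1
    rw [h1]
    simp
  have hd : ∀ i, Integrable fun x => (dx i (cj q * (dx i q + K * X i * Eu q)) : M → ℂ) (0, x) := fun i => by
    refine (Sm.continuous_slice _ 0).integrable_of_hasCompactSupport
      (HasCompactSupport.intro (isCompact_closedBall (0 : E3) (41 * Real.pi / 48)) fun x hx => ?_)
    simp only [Metric.mem_closedBall, dist_zero_right, not_le] at hx
    have h1 : ((cj q * (dx i q + K * X i * Eu q) : Sm) : M → ℂ) =ᶠ[𝓝 ((0 : ℝ), x)] ((0 : Sm) : M → ℂ) := by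
      have h2 : {p : M | 41 * Real.pi / 48 < ‖p.2‖} ∈ 𝓝 ((0 : ℝ), x) :=
        (isOpen_lt continuous_const (by fun_prop)).mem_nhds hx
      filter_upwards [h2] with p hp
      rw [Sm.mul_apply, cj_apply, quasiSm_eq_zero l (le_of_lt hp)]
      simp
    rw [(dd_congr h1 _).eq_of_nhds, map_zero]
    rfl
  have hd0 : ∀ i, ∫ x, ((dx i (cj q * (dx i q + K * X i * Eu q)) : M → ℂ) (0, x)).re = 0 := fun i => by
    have h1 := integral_re (hd i)
    rw [integral_dx_eq_zero (hS.mul_right _)] at h1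
    simpa using h1
  have hle : ∀ x, enDens (kapFun f) q (0, x) ≤ (l * (l + 2) + 1) * massDens f l x + errDens hf l x
        + ∑ i, ((dx i (cj q * (dx i q + K * X i * Eu q)) : M → ℂ) (0, x)).re := fun x => by
    rw [hre]
    have h1 := Complex.abs_re_le_norm
      ((starRingEnd ℂ) ((q : M → ℂ) (0, x)) * (errSm hf l : M → ℂ) (0, x))
    rw [norm_mul, RCLike.norm_conj] at h1
    have h2 : ‖(q : M → ℂ) (0, x)‖ * ‖(errSm hf l : M → ℂ) (0, x)‖ ≤ massDens f l x + errDens hf l x := by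
      have hρ := rhoFun_pos hf x
      have h3 : massDens f l x * errDens hf l x
          = (‖(q : M → ℂ) (0, x)‖ * ‖(errSm hf l : M → ℂ) (0, x)‖) ^ 2 := by
        rw [massDens, errDens]
        field_simp
        exact mul_comm _ _
      have h4 := massDens_nonneg hf l x
      have h5 := errDens_nonneg hf l x
      refine abs_le_of_sq_le_sq' ?_ (by positivity) |>.2
      nlinarith [mul_nonneg h4 h5]
    have h6 := neg_abs_le ((starRingEnd ℂ) ((q : M → ℂ) (0, x)) * (errSm hf l : M → ℂ) (0, x)).re
    linarith
  have hdr : ∀ i, Integrable fun x => ((dx i (cj q * (dx i q + K * X i * Eu q)) : M → ℂ) (0, x)).re :=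
    fun i => (hd i).re
  have hi1 : Integrable fun x => (l * (l + 2) + 1 : ℝ) * massDens f l x :=
    (integrable_massDens hf l).const_mul _
  have hi2 : Integrable fun x => ∑ i, ((dx i (cj q * (dx i q + K * X i * Eu q)) : M → ℂ) (0, x)).re :=
    integrable_finsetSum _ fun i _ => (hd i).re
  refine (integral_mono (integrable_enDens_quasiSm hf l)
    ((hi1.add (integrable_errDens hf l)).add hi2) hle).trans (le_of_eq ?_)
  simp only [Pi.add_apply]
  rw [integral_add (f := fun x => (l * (l + 2) + 1 : ℝ) * massDens f l x + errDens hf l x)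
    (hi1.add (integrable_errDens hf l)) hi2,
    integral_add hi1 (integrable_errDens hf l), integral_const_mul, integral_finsetSum _ fun i _ => hdr i]
  rw [Finset.sum_eq_zero fun i _ => hd0 i, add_zero]

end LogSharp

namespace LogSharp

/-! ### Slowly decaying solutions -/

variable {f : ℝ → ℝ}

/-- The frequency of the quasimode of degree `l`. -/
noncomputable def freq (l : ℕ) : ℝ := Real.sqrt (l * (l + 2))

theorem freq_sq (l : ℕ) : freq l ^ 2 = l * (l + 2) := Real.sq_sqrt (by positivity)

/-- `ψ` is the solution whose data are those of `e^{-iλt}` times the quasimode. -/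
structure IsSlowWave (hf : IsProfile f) (l : ℕ) (ψ : Sm) : Prop where
  wave : waveOp hf.isCoef ψ = 0
  data : VanishAtZero (ψ - quasiSm l)
  dt_data : VanishAtZero (dt ψ - (-(Complex.I * freq l)) • quasiSm l)

theorem exists_isSlowWave (hf : IsProfile f) (l : ℕ) : ∃ ψ, IsSlowWave hf l ψ := by
  obtain ⟨ψ, h1, h2, h3⟩ := exists_mode_solution hf (q := quasiSm l) (R := 41 * Real.pi / 48)
    (fun p hp => quasiSm_eq_zero l hp.le) (c := (l * (l + 1) : ℂ)) (by
      rw [sphLap_quasiSm, Algebra.smul_def]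
      simp
      ring) (-(Complex.I * freq l))
  exact ⟨ψ, h1, h2, h3⟩

/-- The difference between `∂_t ψ` and `-iλψ`. -/
noncomputable def phaseErr (l : ℕ) (ψ : Sm) : Sm := dt ψ + (Complex.I * freq l : ℂ) • ψ

namespace IsSlowWave

variable {hf : IsProfile f} {l : ℕ} {ψ : Sm}

theorem waveOp_phaseErr (h : IsSlowWave hf l ψ) : waveOp hf.isCoef (phaseErr l ψ) = 0 := by
  rw [phaseErr, waveOp_add, waveOp_dt, waveOp_smul, h.wave, map_zero, smul_zero, add_zero]

theorem vanishAtZero_phaseErr (h : IsSlowWave hf l ψ) : VanishAtZero (phaseErr l ψ) := by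
  have h1 := h.dt_data.add (h.data.smul (Complex.I * freq l))
  convert h1 using 1
  rw [phaseErr, smul_sub, neg_smul]
  ring

/-- At t = 0 the equation gives ρ∂_tη = div((1 + κxxᵀ)∇q) + λ²ρq, which is the error of the
quasimode. -/
theorem dt_phaseErr (h : IsSlowWave hf l ψ) :
    VanishAtZero (rhoSm hf * dt (phaseErr l ψ) - errSm hf l) := by
  have h0 : rhoSm hf * dt (dt ψ) = ellOp (kapSm hf) ψ := by
    have := h.wave
    rw [waveOp, ← kapSm_eq_kSm hf, ← rhoSm_eq_rSm hf] at this
    exact sub_eq_zero.1 this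
  have h1 := (h.data.ellOp (kapSm hf)).add ((h.dt_data.mul_left (rhoSm hf)).smul (Complex.I * freq l))
  convert h1 using 1
  have h2 : algebraMap ℂ Sm (Complex.I * freq l) * algebraMap ℂ Sm (Complex.I * freq l)
      = -(l * (l + 2) : Sm) := by
    rw [← map_mul]
    have : (Complex.I * freq l) * (Complex.I * freq l) = -((l : ℂ) * (l + 2)) := by
      have h3 : ((freq l ^ 2 : ℝ) : ℂ) = l * (l + 2) := by rw [freq_sq]; push_cast; ring
      push_cast at h3
      linear_combination (freq l : ℂ) ^ 2 * Complex.I_mul_I - h3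
    have h3 : algebraMap ℂ Sm 2 = 2 := map_ofNat _ 2
    rw [this]
    simp [h3]
  rw [phaseErr, errSm, ellOp_sub, map_add, Derivation.map_smul, neg_smul]
  simp only [Algebra.smul_def]
  linear_combination h0 - rhoSm hf * quasiSm l * h2

/-- As η vanishes on the initial slice, only the term ρ|∂_tη|² = ρ⁻¹|err|² remains. -/
theorem enDens_phaseErr (h : IsSlowWave hf l ψ) (x : E3) :
    enDens (kapFun f) (phaseErr l ψ) (0, x) = errDens hf l x := by
  have h1 : ∀ i, pd (Sum.inr i) (phaseErr l ψ : M → ℂ) ((0 : ℝ), x) = 0 := fun i =>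
    h.vanishAtZero_phaseErr.dx i x
  have h2 := h.dt_phaseErr x
  rw [Sm.sub_apply, Sm.mul_apply, sub_eq_zero, rhoSm, liftR_apply] at h2
  have hρ := rhoFun_pos hf x
  rw [errDens, ← h2, norm_mul, Complex.norm_real, Real.norm_of_nonneg hρ.le, enDens, dd_apply]
  simp only [h1]
  rw [← rhoFun]
  simp
  field_simp

theorem enDens_eq (h : IsSlowWave hf l ψ) (x : E3) : enDens (kapFun f) ψ (0, x)
    = l * (l + 2) * massDens f l x + enDens (kapFun f) (quasiSm l) (0, x) := by
  have h1 : ∀ i, pd (Sum.inr i) (ψ : M → ℂ) ((0 : ℝ), x) = pd (Sum.inr i) (quasiSm l : M → ℂ) (0, x) :=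
    fun i => by
      have := h.data.dx i x
      rw [map_sub, Sm.sub_apply] at this
      exact sub_eq_zero.1 this
  have h2 : pd (Sum.inl ()) (ψ : M → ℂ) ((0 : ℝ), x)
      = -(Complex.I * freq l) * (quasiSm l : M → ℂ) (0, x) := by
    have := h.dt_data x
    rw [Sm.sub_apply, Sm.smul_apply] at this
    exact sub_eq_zero.1 this
  have h3 : pd (Sum.inl ()) (quasiSm l : M → ℂ) ((0 : ℝ), x) = 0 := by
    have := congrArg (fun u : Sm => (u : M → ℂ) ((0 : ℝ), x)) (dt_quasiSm l)
    exact this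
  simp only [enDens, h1, h2, h3, massDens]
  rw [← rhoFun, norm_mul, norm_neg, norm_mul, Complex.norm_I, Complex.norm_real, mul_pow, one_mul,
    Real.norm_eq_abs, sq_abs, freq_sq]
  simp
  ring

/-- The key smallness for all times: η is an exact solution, so its energy never exceeds its initial
value, the squared error. -/
theorem lintegral_enDens_phaseErr (h : IsSlowWave hf l ψ) (t : ℝ) :
    ∫⁻ x, ENNReal.ofReal (enDens (kapFun f) (phaseErr l ψ) (t, x))
      ≤ ENNReal.ofReal (∫ x, errDens hf l x) := by
  refine (lintegral_enDens_le hf.isCoef (phaseErr l ψ) (t₁ := 0) (t₂ := t) fun s _ x => by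
    rw [h.waveOp_phaseErr]; rfl).trans ?_
  simp only [h.enDens_phaseErr]
  rw [ofReal_integral_eq_lintegral_ofReal (integrable_errDens hf l)
    (Eventually.of_forall (errDens_nonneg hf l))]

theorem lintegral_enDens_zero (h : IsSlowWave hf l ψ) :
    ∫⁻ x, ENNReal.ofReal (enDens (kapFun f) ψ (0, x)) ≤ ENNReal.ofReal
      ((2 * (l * (l + 2)) + 1) * (∫ x, massDens f l x) + ∫ x, errDens hf l x) := by
  have hi : Integrable fun x => enDens (kapFun f) ψ (0, x) := by
    simp only [h.enDens_eq]
    exact ((integrable_massDens hf l).const_mul _).add (integrable_enDens_quasiSm hf l)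
  rw [← ofReal_integral_eq_lintegral_ofReal hi
    (Eventually.of_forall fun x => enDens_nonneg hf.isCoef _ _)]
  refine ENNReal.ofReal_le_ofReal ?_
  simp only [h.enDens_eq]
  rw [integral_add ((integrable_massDens hf l).const_mul _) (integrable_enDens_quasiSm hf l),
    integral_const_mul]
  linarith [integral_enDens_quasiSm_le hf l]

theorem energyOn_weight_le (h : IsSlowWave hf l ψ) :
    energyOn (ultrastatic f) ψ 0 univ (fun x => 1 + ‖x‖) ≤ ENNReal.ofReal
      (2 * ((2 * (l * (l + 2)) + 1) * (∫ x, massDens f l x) + ∫ x, errDens hf l x)) := by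
  rw [ENNReal.ofReal_mul two_pos.le]
  refine le_trans ?_ (mul_le_mul' le_rfl h.lintegral_enDens_zero)
  rw [energyOn, setLIntegral_univ, ← lintegral_const_mul' _ _ ENNReal.ofReal_ne_top]
  refine lintegral_mono fun x => ?_
  simp only [energyDensity_ultrastatic hf]
  rw [← ENNReal.ofReal_mul two_pos.le]
  refine ENNReal.ofReal_le_ofReal ?_
  have hn := enDens_nonneg hf.isCoef (ψ : M → ℂ) (0, x)
  -- The data live in r ≤ 41π/48 < 3, where the weight is at most 4; with the factor 1/2 of the
  -- energy this gives the constant 2.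
  by_cases hx : ‖x‖ ≤ 3
  · nlinarith
  · have : enDens (kapFun f) ψ (0, x) = 0 := by
      rw [h.enDens_eq, enDens_quasiSm_eq_zero _ l, massDens, quasiSm_eq_zero l]
      · simp
      all_goals simp only; linarith [Real.pi_lt_d2]
    rw [this]
    simp

/-- Since ∂_tψ = η − iλψ, the energy of ∂_tψ is λ² times that of ψ up to constants and the error. -/
theorem energy_Tder_le (h : IsSlowWave hf l ψ) :
    energy (ultrastatic f) (Tder ψ) 0 ≤ ENNReal.ofReal ((∫ x, errDens hf l x) + l * (l + 2)
      * ((2 * (l * (l + 2)) + 1) * (∫ x, massDens f l x) + ∫ x, errDens hf l x)) := by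
  have hT : Tder (ψ : M → ℂ) = (dt ψ : M → ℂ) := rfl
  have hdt : dt ψ = phaseErr l ψ - (Complex.I * freq l : ℂ) • ψ := by rw [phaseErr]; ring
  have hF : 0 ≤ ∫ x, errDens hf l x := integral_nonneg (errDens_nonneg hf l)
  have hA : 0 ≤ ∫ x, massDens f l x := integral_nonneg (massDens_nonneg hf l)
  have hpt : ∀ x, ENNReal.ofReal (enDens (kapFun f) (dt ψ) (0, x))
      ≤ ENNReal.ofReal 2 * ENNReal.ofReal (enDens (kapFun f) (phaseErr l ψ) (0, x))
        + ENNReal.ofReal (2 * (l * (l + 2))) * ENNReal.ofReal (enDens (kapFun f) ψ (0, x)) := fun x => by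
    rw [← ENNReal.ofReal_mul two_pos.le, ← ENNReal.ofReal_mul (by positivity),
      ← ENNReal.ofReal_add (mul_nonneg two_pos.le (enDens_nonneg hf.isCoef _ _))
        (mul_nonneg (by positivity) (enDens_nonneg hf.isCoef _ _))]
    refine ENNReal.ofReal_le_ofReal ?_
    have h1 := enDens_sub_le hf.isCoef (phaseErr l ψ) ((Complex.I * freq l : ℂ) • ψ) (0, x)
    rw [enDens_smul, ← hdt, norm_mul, Complex.norm_I, Complex.norm_real, one_mul, Real.norm_eq_abs,
      sq_abs, freq_sq] at h1
    linarith
  rw [energy_ultrastatic hf, hT]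
  have hm : Measurable fun x => ENNReal.ofReal (enDens (kapFun f) (phaseErr l ψ) (0, x)) :=
    (continuous_enDens_slice hf.isCoef _ 0).measurable.ennreal_ofReal
  calc ENNReal.ofReal (1 / 2) * ∫⁻ x, ENNReal.ofReal (enDens (kapFun f) (dt ψ) (0, x))
      ≤ ENNReal.ofReal (1 / 2) * (ENNReal.ofReal 2 * ENNReal.ofReal (∫ x, errDens hf l x)
        + ENNReal.ofReal (2 * (l * (l + 2))) * ENNReal.ofReal
        ((2 * (l * (l + 2)) + 1) * (∫ x, massDens f l x) + ∫ x, errDens hf l x)) := by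
        refine mul_le_mul' le_rfl ((lintegral_mono hpt).trans ?_)
        rw [lintegral_add_left (hm.const_mul _), lintegral_const_mul' _ _ ENNReal.ofReal_ne_top,
          lintegral_const_mul' _ _ ENNReal.ofReal_ne_top]
        exact add_le_add (mul_le_mul' le_rfl (h.lintegral_enDens_phaseErr 0))
          (mul_le_mul' le_rfl h.lintegral_enDens_zero)
    _ = _ := by
        rw [← ENNReal.ofReal_mul two_pos.le, ← ENNReal.ofReal_mul (by positivity),
          ← ENNReal.ofReal_add (by positivity) (by positivity), ← ENNReal.ofReal_mul (by norm_num)]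
        congr 1
        ring

/-- Cauchy–Schwarz, obtained by integrating 2m|g| ≤ m² + |g|² with m the mean of |g|. -/
theorem sq_norm_integral_le {g : ℝ → ℂ} (hg : Continuous g) {τ : ℝ} (hτ : 0 < τ) :
    ‖∫ t in (0 : ℝ)..τ, g t‖ ^ 2 ≤ τ * ∫ t in (0 : ℝ)..τ, ‖g t‖ ^ 2 := by
  have h1 : ‖∫ t in (0 : ℝ)..τ, g t‖ ≤ ∫ t in (0 : ℝ)..τ, ‖g t‖ :=
    intervalIntegral.norm_integral_le_integral_norm hτ.le
  set I := ∫ t in (0 : ℝ)..τ, ‖g t‖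
  have h2 : 2 * (I / τ) * I ≤ (I / τ) ^ 2 * τ + ∫ t in (0 : ℝ)..τ, ‖g t‖ ^ 2 := by
    have h3 : ∫ t in (0 : ℝ)..τ, 2 * (I / τ) * ‖g t‖
        ≤ ∫ t in (0 : ℝ)..τ, ((I / τ) ^ 2 + ‖g t‖ ^ 2) := by
      refine intervalIntegral.integral_mono_on hτ.le (by
        exact Continuous.intervalIntegrable (by fun_prop) _ _) (by
        exact Continuous.intervalIntegrable (by fun_prop) _ _) fun t _ => ?_
      nlinarith [sq_nonneg (I / τ - ‖g t‖)]
    rw [intervalIntegral.integral_const_mul, intervalIntegral.integral_add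
      (Continuous.intervalIntegrable (by fun_prop) _ _)
      (Continuous.intervalIntegrable (by fun_prop) _ _), intervalIntegral.integral_const] at h3
    simp only [sub_zero, smul_eq_mul] at h3
    linarith
  have h4 : I ^ 2 ≤ τ * ∫ t in (0 : ℝ)..τ, ‖g t‖ ^ 2 := by
    have h5 : I / τ * τ = I := div_mul_cancel₀ _ hτ.ne'
    generalize I / τ = a at *
    have : I ^ 2 = τ * (a * I) := by rw [← h5]; ring
    rw [this]
    refine mul_le_mul_of_nonneg_left ?_ hτ.le
    have : a ^ 2 * τ = a * I := by rw [← h5]; ring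
    linarith
  exact (pow_le_pow_left₀ (norm_nonneg _) h1 2).trans h4

/-- Comparison of `∂_t ψ` at time `τ` with the quasimode. -/
theorem massDens_le (h : IsSlowWave hf l ψ) {τ : ℝ} (hτ : 0 < τ) (x : E3) :
    l * (l + 2) * massDens f l x ≤ 2 * enDens (kapFun f) ψ (τ, x)
      + 2 * τ * ∫ t in (0 : ℝ)..τ, enDens (kapFun f) (phaseErr l ψ) (t, x) := by
  -- The derivative of e^{iλt}∂_tψ: removing the phase leaves only ∂_tη, so ∂_tψ stays close to
  -- −iλe^{−iλt}q.
  let g : ℝ → ℂ := fun t => Complex.exp (Complex.I * freq l * t) * (dt (phaseErr l ψ) : M → ℂ) (t, x)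
  have hline : ∀ u : Sm, Continuous fun t : ℝ => (u : M → ℂ) (t, x) := fun u =>
    (Sm.continuous u).comp (by fun_prop)
  have hg : Continuous g := by
    refine Continuous.mul ?_ (hline _)
    fun_prop
  have hder : ∀ t : ℝ, HasDerivAt (fun t : ℝ => Complex.exp (Complex.I * freq l * t) * (dt ψ : M → ℂ) (t, x))
      (g t) t := fun t => by
    have h1 : HasDerivAt (fun t : ℝ => Complex.exp (Complex.I * freq l * t))
        (Complex.exp (Complex.I * freq l * t) * (Complex.I * freq l)) t := by
      have h2 : HasDerivAt (fun t : ℝ => Complex.I * freq l * t) (Complex.I * freq l) t := by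
        simpa using (Complex.ofRealCLM.hasDerivAt (x := t)).const_mul (Complex.I * (freq l : ℂ))
      exact h2.cexp
    refine (h1.mul (hasDerivAt_time (dt ψ) t x)).congr_deriv ?_
    simp only [g, phaseErr, map_add, Derivation.map_smul, Sm.add_apply, Sm.smul_apply]
    ring
  have hint := intervalIntegral.integral_eq_sub_of_hasDerivAt (a := 0) (b := τ) (fun t _ => hder t)
    (hg.intervalIntegrable _ _)
  have h0 : (dt ψ : M → ℂ) (0, x) = -(Complex.I * freq l) * (quasiSm l : M → ℂ) (0, x) := by
    have := h.dt_data x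
    rw [Sm.sub_apply, Sm.smul_apply] at this
    exact sub_eq_zero.1 this
  have hexp : ∀ t : ℝ, ‖Complex.exp (Complex.I * freq l * t)‖ = 1 := fun t => by
    have : Complex.I * freq l * t = ((freq l * t : ℝ) : ℂ) * Complex.I := by push_cast; ring
    rw [this, Complex.norm_exp_ofReal_mul_I]
  simp only [Complex.ofReal_zero, mul_zero, Complex.exp_zero, one_mul, h0] at hint
  have hsq := sq_norm_integral_le hg hτ
  have hgn : ∀ t, ‖g t‖ = ‖(dt (phaseErr l ψ) : M → ℂ) (t, x)‖ := fun t => by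
    simp only [g, norm_mul, hexp, one_mul]
  simp only [hgn] at hsq
  have hq : l * (l + 2) * ‖(quasiSm l : M → ℂ) (0, x)‖ ^ 2 ≤ 2 * ‖(dt ψ : M → ℂ) (τ, x)‖ ^ 2
      + 2 * (τ * ∫ t in (0 : ℝ)..τ, ‖(dt (phaseErr l ψ) : M → ℂ) (t, x)‖ ^ 2) := by
    have h2 : (Complex.I * freq l) * (quasiSm l : M → ℂ) (0, x)
        = (∫ t in (0 : ℝ)..τ, g t) - Complex.exp (Complex.I * freq l * τ) * (dt ψ : M → ℂ) (τ, x) := by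
      rw [hint]; ring
    have h3 := congrArg norm h2
    rw [norm_mul, norm_mul, Complex.norm_I, one_mul, Complex.norm_real, Real.norm_eq_abs] at h3
    have h4 := norm_sub_le (∫ t in (0 : ℝ)..τ, g t)
      (Complex.exp (Complex.I * freq l * τ) * (dt ψ : M → ℂ) (τ, x))
    rw [← h3, norm_mul, hexp, one_mul] at h4
    have h5 := pow_le_pow_left₀ (by positivity) h4 2
    rw [mul_pow, sq_abs, freq_sq] at h5
    nlinarith [sq_nonneg (‖∫ t in (0 : ℝ)..τ, g t‖ - ‖(dt ψ : M → ℂ) (τ, x)‖)]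
  have hρ := rhoFun_pos hf x
  have h6 : rhoFun f x * ∫ t in (0 : ℝ)..τ, ‖(dt (phaseErr l ψ) : M → ℂ) (t, x)‖ ^ 2
      ≤ ∫ t in (0 : ℝ)..τ, enDens (kapFun f) (phaseErr l ψ) (t, x) := by
    rw [← intervalIntegral.integral_const_mul]
    refine intervalIntegral.integral_mono_on hτ.le ?_ ?_ fun t _ => enDens_ge hf.isCoef _ (t, x)
    · exact (continuous_const.mul ((hline _).norm.pow 2)).intervalIntegrable _ _
    · exact ((continuous_enDens hf.isCoef _).comp (by fun_prop)).intervalIntegrable _ _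
  have h7 := enDens_ge hf.isCoef ψ (τ, x)
  have h8 := mul_le_mul_of_nonneg_left hq hρ.le
  have h9 := mul_le_mul_of_nonneg_left h6 (by positivity : 0 ≤ 2 * τ)
  change rhoFun f x * _ ≤ _ at h7
  rw [massDens]
  linarith

/-- Integrate the pointwise comparison over the ball. By Tonelli each time slice of η contributes at
most F, in total 2τ²F. The 4 is the 2 of the comparison times the 2 that removes the factor 1/2 of
the energy. -/
theorem le_energyOn_ball (h : IsSlowWave hf l ψ) {τ : ℝ} (hτ : 0 < τ) :
    ENNReal.ofReal ((l * (l + 2) * (∫ x in Metric.closedBall 0 (3 * Real.pi / 4), massDens f l x)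
      - 2 * τ ^ 2 * ∫ x, errDens hf l x) / 4)
      ≤ energyOn (ultrastatic f) ψ τ (Metric.closedBall 0 (3 * Real.pi / 4)) (fun _ => 1) := by
  set B := Metric.closedBall (0 : E3) (3 * Real.pi / 4)
  set η := phaseErr l ψ
  have hF : 0 ≤ ∫ x, errDens hf l x := integral_nonneg (errDens_nonneg hf l)
  have hηc := continuous_enDens hf.isCoef η
  have hpt : ∀ x, ENNReal.ofReal (l * (l + 2) * massDens f l x)
      ≤ ENNReal.ofReal 2 * ENNReal.ofReal (enDens (kapFun f) ψ (τ, x)) + ENNReal.ofReal (2 * τ)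
        * ∫⁻ t in Ioc 0 τ, ENNReal.ofReal (enDens (kapFun f) η (t, x)) := fun x => by
    have hi : IntegrableOn (fun t => enDens (kapFun f) η (t, x)) (Ioc 0 τ) := by
      have : Continuous fun t : ℝ => enDens (kapFun f) η (t, x) := hηc.comp (by fun_prop)
      exact (intervalIntegrable_iff_integrableOn_Ioc_of_le hτ.le).1 (this.intervalIntegrable _ _)
    have hnn : 0 ≤ ∫ t in Ioc 0 τ, enDens (kapFun f) η (t, x) :=
      integral_nonneg fun t => enDens_nonneg hf.isCoef _ _
    rw [← ofReal_integral_eq_lintegral_ofReal hi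
      (Eventually.of_forall fun t => enDens_nonneg hf.isCoef _ _), ← ENNReal.ofReal_mul two_pos.le,
      ← ENNReal.ofReal_mul (by positivity), ← ENNReal.ofReal_add
        (mul_nonneg two_pos.le (enDens_nonneg hf.isCoef _ _)) (by positivity),
      ← intervalIntegral.integral_of_le hτ.le]
    exact ENNReal.ofReal_le_ofReal (h.massDens_le hτ x)
  have hm : Measurable (Function.uncurry fun (x : E3) (t : ℝ) => ENNReal.ofReal (enDens (kapFun f) η (t, x))) :=
    (hηc.comp (by fun_prop : Continuous fun q : E3 × ℝ => (q.2, q.1))).measurable.ennreal_ofReal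
  have hmψ : Measurable fun x => ENNReal.ofReal (enDens (kapFun f) ψ (τ, x)) :=
    (continuous_enDens_slice hf.isCoef ψ τ).measurable.ennreal_ofReal
  have hmain : ENNReal.ofReal (l * (l + 2) * ∫ x in B, massDens f l x)
      ≤ ENNReal.ofReal 2 * (∫⁻ x in B, ENNReal.ofReal (enDens (kapFun f) ψ (τ, x)))
        + ENNReal.ofReal (2 * τ ^ 2 * ∫ x, errDens hf l x) := by
    rw [← integral_const_mul, ofReal_integral_eq_lintegral_ofReal
      ((integrable_massDens hf l).const_mul _).integrableOn
      (Eventually.of_forall fun x => mul_nonneg (by positivity) (massDens_nonneg hf l x))]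
    refine (lintegral_mono hpt).trans ?_
    rw [lintegral_add_left (hmψ.const_mul _), lintegral_const_mul' _ _ ENNReal.ofReal_ne_top,
      lintegral_const_mul' _ _ ENNReal.ofReal_ne_top]
    refine add_le_add_right ?_ _
    rw [lintegral_lintegral_swap hm.aemeasurable]
    calc ENNReal.ofReal (2 * τ) * ∫⁻ t in Ioc 0 τ, ∫⁻ x in B, ENNReal.ofReal (enDens (kapFun f) η (t, x))
        ≤ ENNReal.ofReal (2 * τ) * ∫⁻ _ in Ioc 0 τ, ENNReal.ofReal (∫ x, errDens hf l x) := by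
          refine mul_le_mul' le_rfl (lintegral_mono fun t => ?_)
          exact (setLIntegral_le_lintegral _ _).trans (h.lintegral_enDens_phaseErr t)
      _ = _ := by
          rw [setLIntegral_const, Real.volume_Ioc, sub_zero, ← ENNReal.ofReal_mul hF,
            ← ENNReal.ofReal_mul (by positivity)]
          congr 1
          ring
  have hE : energyOn (ultrastatic f) ψ τ B (fun _ => 1)
      = ENNReal.ofReal (1 / 2) * ∫⁻ x in B, ENNReal.ofReal (enDens (kapFun f) ψ (τ, x)) := by
    rw [energyOn, ← lintegral_const_mul' _ _ ENNReal.ofReal_ne_top]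
    refine lintegral_congr fun x => ?_
    rw [one_mul, energyDensity_ultrastatic hf, ENNReal.ofReal_mul (by norm_num)]
  have h1 := tsub_le_iff_right.2 hmain
  rw [← ENNReal.ofReal_sub _ (by positivity)] at h1
  have h2 := mul_le_mul' (le_refl (ENNReal.ofReal (1 / 4))) h1
  rw [← ENNReal.ofReal_mul (by norm_num), ← mul_assoc, ← ENNReal.ofReal_mul (by norm_num)] at h2
  rw [hE, show (1 / 2 : ℝ) = 1 / 4 * 2 by norm_num, div_eq_inv_mul, ← one_div]
  exact h2

end IsSlowWave

/-- Waves on the ultrastatic spacetime decay no faster than logarithmically. -/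
theorem exists_slow_wave (hf : IsProfile f) {h : ℝ → ℝ} (h0 : ∀ t, 0 ≤ t → 0 ≤ h t)
    (hlim : Tendsto (fun t => h t * Real.log (2 + t) ^ 2) atTop (𝓝 0)) :
    ∃ t₀ : ℝ, 0 < t₀ ∧ ∀ τ : ℝ, t₀ < τ →
      ∃ ψ : M → ℂ, ContDiff ℝ ∞ ψ ∧
        (∀ p, box (ultrastatic f) ψ p = 0) ∧
        (∀ t, energy (ultrastatic f) ψ t < ⊤) ∧
        energyOn (ultrastatic f) ψ 0 univ (fun x => 1 + ‖x‖) < ⊤ ∧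
        energy (ultrastatic f) (Tder ψ) 0 < ⊤ ∧
        ENNReal.ofReal (h τ) * (energyOn (ultrastatic f) ψ 0 univ (fun x => 1 + ‖x‖)
            + energy (ultrastatic f) (Tder ψ) 0)
          < energyOn (ultrastatic f) ψ τ (Metric.closedBall 0 (3 * Real.pi / 4)) (fun _ => 1) := by
  obtain ⟨C, hC, hest⟩ := quasimode_estimates hf
  -- The constant comes from 41 · 8 · 36 = 11808 < 12000, the factors collected at the end.
  have hev : ∀ᶠ t in atTop, h t * Real.log (2 + t) ^ 2 < 1 / (12000 * C) :=
    hlim.eventually_lt_const (by positivity)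
  obtain ⟨t₁, ht₁⟩ := eventually_atTop.1 hev
  -- The bound τ ≥ 4C lets the third power of 2 + τ absorb the constant C in the error estimate.
  refine ⟨max t₁ (4 * C), lt_max_of_lt_right (by positivity), fun τ hτ => ?_⟩
  have hτ1 : t₁ ≤ τ := (le_max_left _ _).trans hτ.le
  have hτC : 4 * C ≤ τ := (le_max_right _ _).trans hτ.le
  have hτ0 : 0 < τ := lt_of_lt_of_le (by positivity) hτC
  set Λ := Real.log (2 + τ)
  have hlog2 : 0.69 < Real.log 2 := by linarith [Real.log_two_gt_d9]
  have hΛ : Real.log 2 ≤ Λ := Real.log_le_log two_pos (by linarith)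
  have hΛ0 : 0 < Λ := by linarith
  have hlog0 : 0 < Real.log 2 := by linarith
  -- Chosen so that 2^l ≥ (2 + τ)³, which makes τ² times the error small while l stays of size log
  -- τ.
  set l := ⌈3 * Λ / Real.log 2⌉₊
  have hl3 : 3 * Λ / Real.log 2 ≤ l := Nat.le_ceil _
  have hl1 : 1 ≤ l := Nat.one_le_ceil_iff.2 (by positivity)
  -- Here 3/log 2 ≤ 4.4, and the 1 from rounding up is at most 1.6 Λ because Λ ≥ log 2.
  have hl6 : (l : ℝ) ≤ 6 * Λ := by
    have h1 := (Nat.ceil_lt_add_one (by positivity : 0 ≤ 3 * Λ / Real.log 2)).le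
    have h2 : 3 * Λ / Real.log 2 ≤ 4.4 * Λ := by
      rw [div_le_iff₀ (by linarith)]
      nlinarith
    have h3 : (l : ℝ) ≤ 3 * Λ / Real.log 2 + 1 := h1
    linarith
  have hpow : (1 / 2 : ℝ) ^ l * (2 + τ) ^ 3 ≤ 1 := by
    have h1 : (2 + τ) ^ 3 ≤ (2 : ℝ) ^ l := by
      rw [← Real.log_le_log_iff (by positivity) (by positivity), Real.log_pow, Real.log_pow]
      rw [div_le_iff₀ (by linarith)] at hl3
      exact_mod_cast hl3
    rw [one_div, inv_pow, inv_mul_le_iff₀ (by positivity), mul_one]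
    exact h1
  obtain ⟨hN, hA, hF⟩ := hest l hl1
  obtain ⟨ψ, hψ⟩ := exists_isSlowWave hf l
  have e1 := hψ.energyOn_weight_le
  have e2 := hψ.energy_Tder_le
  have e3 := hψ.le_energyOn_ball hτ0
  have hbox : ∀ p, box (ultrastatic f) ψ p = 0 := fun p => by
    rw [box_eq_zero_iff hf]
    have := congrArg (fun u : Sm => (u : M → ℂ) p) hψ.wave
    exact this
  set N := ∫ x in Metric.closedBall 0 (3 * Real.pi / 4), massDens f l x
  set A := ∫ x, massDens f l x
  set F := ∫ x, errDens hf l x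
  have hl1' : (1 : ℝ) ≤ l := by exact_mod_cast hl1
  set L : ℝ := (l : ℝ)
  have hF0 : 0 ≤ F := integral_nonneg (errDens_nonneg hf l)
  have hA0 : 0 ≤ A := integral_nonneg (massDens_nonneg hf l)
  have hp1 : (1 / 2 : ℝ) ^ l ≤ 1 := pow_le_one₀ (by norm_num) (by norm_num)
  have hL2 : 1 ≤ L ^ 2 := one_le_pow₀ hl1'
  have hLL : L * (L + 2) ≤ 3 * L ^ 2 := by nlinarith
  have hCN : 0 < C * N := by positivity
  have hFle : F ≤ L ^ 2 * (C * N) := by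
    refine hF.trans ?_
    have := mul_le_mul_of_nonneg_left hp1 (by positivity : 0 ≤ C * L ^ 2 * N)
    linarith
  have hW : (2 * (L * (L + 2)) + 1) * A + F ≤ 8 * L ^ 2 * (C * N) := by
    have h1 : (2 * (L * (L + 2)) + 1) * A ≤ (7 * L ^ 2) * (C * N) :=
      mul_le_mul (by linarith) hA hA0 (by positivity)
    linarith
  set W := (2 * (L * (L + 2)) + 1) * A + F
  have hW0 : 0 ≤ W := by positivity
  -- The constant is 41 = 16 + 1 + 24, from the bounds for 2W, F and λ²W.
  have htot : 2 * W + (F + L * (L + 2) * W) ≤ 41 * L ^ 4 * (C * N) := by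
    have h1 : L * (L + 2) * W ≤ 3 * L ^ 2 * (8 * L ^ 2 * (C * N)) :=
      mul_le_mul hLL hW hW0 (by positivity)
    have h2 : L ^ 2 * (C * N) ≤ L ^ 4 * (C * N) := by
      refine mul_le_mul_of_nonneg_right ?_ hCN.le
      nlinarith
    nlinarith
  -- The error takes away at most half of L²N, and the energy bound carries the factor 1/4.
  have hlow : L ^ 2 * N / 8 ≤ (L * (L + 2) * N - 2 * τ ^ 2 * F) / 4 := by
    have h1 : τ ^ 2 * (C * (1 / 2) ^ l) ≤ 1 / 4 := by
      have h2 : τ ^ 2 * (4 * C) ≤ (2 + τ) ^ 3 := by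
        have := mul_le_mul_of_nonneg_left hτC (sq_nonneg τ)
        nlinarith
      have h3 := mul_le_mul_of_nonneg_left h2 (by positivity : (0 : ℝ) ≤ (1 / 2) ^ l)
      linarith
    have h4 : τ ^ 2 * F ≤ 1 / 4 * (L ^ 2 * N) := by
      refine (mul_le_mul_of_nonneg_left hF (sq_nonneg τ)).trans ?_
      have := mul_le_mul_of_nonneg_right h1 (by positivity : 0 ≤ L ^ 2 * N)
      linarith
    nlinarith [mul_pos (lt_of_lt_of_le one_pos hl1') hN]
  -- The quotient of the two sides is a multiple of h(τ)L², and L² ≤ 36Λ² brings in the hypothesis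
  -- on h.
  have hh : h τ * (41 * L ^ 4 * (C * N)) < L ^ 2 * N / 8 := by
    have h1 := ht₁ τ hτ1
    rw [lt_div_iff₀ (by positivity)] at h1
    have h2 : L ^ 2 ≤ 36 * Λ ^ 2 := by
      have := pow_le_pow_left₀ (by positivity) hl6 2
      linarith
    have h3 : h τ * L ^ 2 * (328 * C) < 1 := by
      have := mul_le_mul_of_nonneg_left h2 (h0 τ hτ0.le)
      have h4 := mul_le_mul_of_nonneg_right this (by positivity : 0 ≤ 328 * C)
      have h5 : 0 ≤ h τ * Λ ^ 2 * C := mul_nonneg (mul_nonneg (h0 τ hτ0.le) (sq_nonneg _)) hC.le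
      linarith
    have h4 := mul_lt_mul_of_pos_right h3 (by positivity : 0 < L ^ 2 * N / 8)
    linarith
  have hE : energyOn (ultrastatic f) ψ 0 univ (fun x => 1 + ‖x‖) + energy (ultrastatic f) (Tder ψ) 0
      ≤ ENNReal.ofReal (2 * W + (F + L * (L + 2) * W)) := by
    rw [ENNReal.ofReal_add (by positivity) (by positivity)]
    exact add_le_add e1 e2
  refine ⟨ψ, Sm.contDiff ψ, hbox, fun t => ?_, e1.trans_lt ENNReal.ofReal_lt_top,
    e2.trans_lt ENNReal.ofReal_lt_top, ?_⟩
  · refine (energy_le_of_box hf (Sm.contDiff ψ) (t := 0) fun s _ x => hbox (s, x)).trans_lt ?_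
    rw [energy_ultrastatic hf]
    exact ENNReal.mul_lt_top ENNReal.ofReal_lt_top
      (hψ.lintegral_enDens_zero.trans_lt ENNReal.ofReal_lt_top)
  · refine (mul_le_mul' le_rfl hE).trans_lt (lt_of_lt_of_le ?_ e3)
    rw [← ENNReal.ofReal_mul (h0 τ hτ0.le)]
    refine (ENNReal.ofReal_lt_ofReal_iff (lt_of_lt_of_le (by positivity) hlow)).2 ?_
    exact ((mul_le_mul_of_nonneg_left htot (h0 τ hτ0.le)).trans_lt hh).trans_le hlow

end LogSharp

theorem mainTheorem5 :
    (∃ f : ℝ → ℝ, LogSharp.IsProfile f) ∧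
    ∀ f : ℝ → ℝ, LogSharp.IsProfile f →
      LogSharp.SatisfiesAssumptions (LogSharp.ultrastatic f) ∧
      ∀ h : ℝ → ℝ, (∀ t, 0 ≤ t → 0 ≤ h t) →
        Tendsto (fun t => h t * Real.log (2 + t) ^ 2) atTop (𝓝 0) →
        ∃ t₀ : ℝ, 0 < t₀ ∧ ∀ τ : ℝ, t₀ < τ →
          ∃ ψ : LogSharp.M → ℂ, ContDiff ℝ ∞ ψ ∧
            (∀ p, LogSharp.box (LogSharp.ultrastatic f) ψ p = 0) ∧
            (∀ t, LogSharp.energy (LogSharp.ultrastatic f) ψ t < ⊤) ∧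
            LogSharp.energyOn (LogSharp.ultrastatic f) ψ 0 univ (fun x => 1 + ‖x‖) < ⊤ ∧
            LogSharp.energy (LogSharp.ultrastatic f) (LogSharp.Tder ψ) 0 < ⊤ ∧
            ENNReal.ofReal (h τ) *
                (LogSharp.energyOn (LogSharp.ultrastatic f) ψ 0 univ (fun x => 1 + ‖x‖)
                  + LogSharp.energy (LogSharp.ultrastatic f) (LogSharp.Tder ψ) 0)
              < LogSharp.energyOn (LogSharp.ultrastatic f) ψ τ
                  (Metric.closedBall 0 (3 * Real.pi / 4)) (fun _ => 1) :=
  ⟨LogSharp.exists_isProfile, fun _ hf => ⟨LogSharp.satisfiesAssumptions_ultrastatic hf,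
    fun _ h0 hlim => LogSharp.exists_slow_wave hf h0 hlim⟩⟩
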